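/- **Setting.** Let $p,d,n,m\ge 1$, and let $F_1,\dots,F_n,\,G_1,\dots,G_m:\mathbb R^p\times\mathbb R^d\to\mathbb R$ be differentiable. Put $f=\frac1n\sum_i F_i$, $g=\frac1m\sum_j G_j$, $y^*(x)=\arg\min_y g(x,y)$ and $\Phi(x)=f(x,y^*(x))$. Norms of vectors are Euclidean, $\|\cdot\|_F$ is the Frobenius norm, and $w=(x,y)$. Assume, with constants $\mu_g>0$ and $L_f,L_g,M,\rho,\tau,\sigma,D\ge 0$: 1. every $G_j(x,\cdot)$ is $\mu_g$-strongly convex; 2. for every $j$, $\nabla G_j$ is $L_g$-Lipschitz in $w$, $\nabla_y G_j$ is differentiable, and $\|\nabla_y^2G_j(w_1)-\nabla_y^2G_j(w_2)\|_F\le\rho\|w_1-w_2\|$, $\|\nabla_x\nabla_yG_j(w_1)-\nabla_x\nabla_yG_j(w_2)\|_F\le\tau\|w_1-w_2\|$ for all $w_1,w_2$; 3. for every $i$, $F_i$ is $M$-Lipschitz and $\nabla F_i$ is $L_f$-Lipschitz; 4. $\frac1m\sum_j\|\nabla G_j(w)-\nabla g(w)\|^2\le\sigma^2$ for all $w$;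 5. $\|y^*(x)\|\le D$ for all $x$, and $\Phi$ is bounded below, $\Phi^*=\inf\Phi$. **Algorithm (PZOBO-S).** Given $x_0\in\mathbb R^p$, $y_0\in\mathbb R^d$, step sizes $\alpha,\beta$, a smoothing parameter $\mu>0$, and integers $K,S,Q,D_f\ge1$, $N\ge 0$: for $k=0,1,\dots$ draw, independently of each other and of the past, standard Gaussian vectors $u_{k,1},\dots,u_{k,Q}\in\mathbb R^p$, inner batches $\mathcal S_0,\dots,\mathcal S_{N-1}$ of $S$ i.i.d. uniform indices in $\{1,\dots,m\}$, and an outer batch $\mathcal D_F$ of $D_f$ i.i.d. uniform indices in $\{1,\dots,n\}$. For a batch, $G(\cdot;\mathcal S)$ and $F(\cdot;\mathcal D_F)$ denote the averages of the sampled functions. For $x\in\mathbb R^p$ let $Y^0(x)=y_0$, $Y^{t}(x)=Y^{t-1}(x)-\alpha\nabla_yG(x,Y^{t-1}(x);\mathcal S_{t-1})$ for $t=1,\dots,N$ (the same batches for all $x$). With $Y_k^N=Y^N(x_k)$ and $\delta_j=\frac1\mu\big(Y^N(x_k+\mu u_{k,j})-Y^N_k\big)$ set $$\widehat\nabla\Phi(x_k)=\nabla_xF(x_k,Y_k^N;\mathcal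 D_F)+\frac1Q\sum_{j=1}^Q\big\langle\delta_j,\nabla_yF(x_k,Y_k^N;\mathcal D_F)\big\rangle u_{k,j},\qquad x_{k+1}=x_k-\beta\widehat\nabla\Phi(x_k).$$ **Theorem (Convergence of PZOBO-S).** Let $L=\max\{L_f,L_g\}$, $\alpha=\frac{2}{L+\mu_g}$ and $\beta=\frac1{L_\Phi\sqrt K}$ with $$L_\Phi=L+\frac{2L^2+\tau M^2}{\mu_g}+\frac{\rho LM+L^3+\tau ML}{\mu_g^2}+\frac{\rho L^2M}{\mu_g^3}.$$ For all $c, D_0, \Delta_\Phi$ there is a constant $C$, depending only on $L_f,L_g,M,\rho,\tau,\mu_g,\sigma,D,D_0,\Delta_\Phi,c$ (and not on $p,d,n,m,K,N,S,Q,D_f,\mu$ or on the functions), such that whenever $\|y_0\|\le D_0$, $\Phi(x_0)-\Phi^*\le\Delta_\Phi$ and $0<\mu\le c/\sqrt{Kdp^3}$, for all $K,S,Q,D_f\ge1$ and $N\ge 0$ (in particular for $Q,D_f=\mathcal O(1)$), the function $\Phi$ is differentiable, the expectations below are finite, and $$\frac{1-\frac1{\sqrt K}}{K}\sum_{k=0}^{K-1}\mathbb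 E\|\nabla\Phi(x_k)\|^2\le C\left(\frac p{\sqrt K}+(1-\alpha\mu_g)^N+\frac1{\sqrt S}\right).$$ -/

import Mathlib

open MeasureTheory ProbabilityTheory
open scoped NNReal

noncomputable section

namespace PZOBO

/-- The space `ℝᵖ` of outer variables (and, with `d`, of inner variables), with the Euclidean norm. -/
abbrev Vec (p : ℕ) : Type := EuclideanSpace ℝ (Fin p)

/-- The space of pairs `w = (x, y) ∈ ℝᵖ × ℝᵈ`, with the Euclidean norm
`‖w‖² = ‖x‖² + ‖y‖²`. -/
abbrev Joint (p d : ℕ) : Type := WithLp 2 (Vec p × Vec d)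

/-- The pair `(x, y)`. -/
abbrev pt {p d : ℕ} (x : Vec p) (y : Vec d) : Joint p d := WithLp.toLp 2 (x, y)

/-- The average `(1/k) ∑ᵢ hᵢ` of finitely many objective functions. It gives the finite-sum
objectives `f`, `g` as well as the mini-batch objectives. -/
def avg {p d k : ℕ} (h : Fin k → Joint p d → ℝ) : Joint p d → ℝ :=
  fun w => (1 / (k : ℝ)) * ∑ i, h i w

/-- The partial gradient `∇ₓ h(x, y)`. -/
def gradX {p d : ℕ} (h : Joint p d → ℝ) (x : Vec p) (y : Vec d) : Vec p :=
  gradient (fun x' => h (pt x' y)) x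

/-- The partial gradient `∇_y h(x, y)`. -/
def gradY {p d : ℕ} (h : Joint p d → ℝ) (x : Vec p) (y : Vec d) : Vec d :=
  gradient (fun y' => h (pt x y')) y

/-- The Hessian `∇²_y h(w)` in the inner variable, a `d × d` matrix. -/
def hessYY {p d : ℕ} (h : Joint p d → ℝ) (w : Joint p d) : Matrix (Fin d) (Fin d) ℝ :=
  Matrix.of fun i j =>
    fderiv ℝ (fun y' => gradY h w.fst y') w.snd (EuclideanSpace.single j 1) i

/-- The mixed derivative `∇ₓ∇_y h(w)`, written as the `d × p` Jacobian matrix of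
`x ↦ ∇_y h(x, y)`. -/
def mixedXY {p d : ℕ} (h : Joint p d → ℝ) (w : Joint p d) : Matrix (Fin d) (Fin p) ℝ :=
  Matrix.of fun i j =>
    fderiv ℝ (fun x' => gradY h x' w.snd) w.fst (EuclideanSpace.single j 1) i

/-- The Frobenius norm of a real matrix. -/
def frobNorm {a b : ℕ} (A : Matrix (Fin a) (Fin b) ℝ) : ℝ :=
  Real.sqrt (∑ i, ∑ j, A i j ^ 2)

/-- The assumptions on one inner sample function `G(·; ζ)`: strong convexity in `y`,
Lipschitz gradient, and Lipschitz second derivatives `∇²_y G`, `∇ₓ∇_y G`. -/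
structure InnerAssumption {p d : ℕ} (G : Joint p d → ℝ) (μg : ℝ) (Lg ρ τ : ℝ≥0) : Prop where
  strongConvex : ∀ x : Vec p, StrongConvexOn Set.univ μg (fun y : Vec d => G (pt x y))
  differentiable : Differentiable ℝ G
  lipschitz_grad : LipschitzWith Lg (gradient G)
  differentiable_gradY : Differentiable ℝ (fun w : Joint p d => gradY G w.fst w.snd)
  lipschitz_hessYY : ∀ w₁ w₂ : Joint p d,
    frobNorm (hessYY G w₁ - hessYY G w₂) ≤ ρ * ‖w₁ - w₂‖
  lipschitz_mixedXY : ∀ w₁ w₂ : Joint p d,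
    frobNorm (mixedXY G w₁ - mixedXY G w₂) ≤ τ * ‖w₁ - w₂‖

/-- The assumptions on one outer sample function `F(·; ξ)`: it is Lipschitz with Lipschitz
gradient. -/
structure OuterAssumption {p d : ℕ} (F : Joint p d → ℝ) (M Lf : ℝ≥0) : Prop where
  differentiable : Differentiable ℝ F
  lipschitz : LipschitzWith M F
  lipschitz_grad : LipschitzWith Lf (gradient F)

/-- Bounded variance: `E_ζ ‖∇G(w; ζ) - ∇g(w)‖² ≤ σ²` for `ζ` uniform over the `m` samples and
`g` the average of the `G(·; ζ)`. -/
def BoundedVariance {p d m : ℕ} (G : Fin m → Joint p d → ℝ) (σ : ℝ) : Prop :=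
  ∀ w : Joint p d,
    (1 / (m : ℝ)) * ∑ j, ‖gradient (G j) w - gradient (avg G) w‖ ^ 2 ≤ σ ^ 2

/-- The inner solution `y*(x) = argmin_y g(x, y)`. -/
def innerSol {p d : ℕ} (g : Joint p d → ℝ) (x : Vec p) : Vec d :=
  Classical.epsilon fun y : Vec d => ∀ y' : Vec d, g (pt x y) ≤ g (pt x y')

/-- The total objective `Φ(x) = f(x, y*(x))` of the finite-sum problem, where `f` and `g` are the
averages of the outer and of the inner sample functions and `y*(x) = argmin_y g(x, y)`. -/
def totalObj {p d n m : ℕ} (F : Fin n → Joint p d → ℝ) (G : Fin m → Joint p d → ℝ)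
    (x : Vec p) : ℝ :=
  avg F (pt x (innerSol (avg G) x))

/-- `N` steps of mini-batch SGD on the inner problem at the outer point `x`, started at `y₀`,
with step size `α`; the step from `Y^t` to `Y^{t+1}` uses the batch `s t` of `S` sample indices. -/
def innerSGD {p d m S : ℕ} (G : Fin m → Joint p d → ℝ) (α : ℝ) (y₀ : Vec d) (x : Vec p) :
    (N : ℕ) → (Fin N → Fin S → Fin m) → Vec d
  | 0, _ => y₀
  | N + 1, s =>
    let y := innerSGD G α y₀ x N (fun t => s t.castSucc)
    y - α • gradY (avg fun i => G (s (Fin.last N) i)) x y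

/-- The random draws of one outer iteration: the `Q` Gaussian directions, the `N` inner batches of
`S` indices each, and the outer batch of `Df` indices. -/
abbrev Draw (p n m N S Q Df : ℕ) : Type :=
  (Fin Q → Vec p) × (Fin N → Fin S → Fin m) × (Fin Df → Fin n)

/-- The law of the draws of one outer iteration: all directions and all indices are independent,
the directions are standard Gaussian vectors of `ℝᵖ`, and the indices are uniform. -/
def drawLaw (p n m N S Q Df : ℕ) : Measure (Draw p n m N S Q Df) :=
  (Measure.pi fun _ : Fin Q => stdGaussian (Vec p)).prod
    ((Measure.pi fun _ : Fin N => Measure.pi fun _ : Fin S => uniformOn (Set.univ : Set (Fin m))).prod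
      (Measure.pi fun _ : Fin Df => uniformOn (Set.univ : Set (Fin n))))

/-- The hypergradient estimator of PZOBO-S at `x`, with smoothing parameter `μ`. All SGD runs use
the same inner batches. -/
def hyperGradEst {p d n m N S Q Df : ℕ} (F : Fin n → Joint p d → ℝ) (G : Fin m → Joint p d → ℝ)
    (α μ : ℝ) (y₀ : Vec d) (x : Vec p) (ω : Draw p n m N S Q Df) : Vec p :=
  let u := ω.1
  let s := ω.2.1
  let FD : Joint p d → ℝ := avg fun i => F (ω.2.2 i)
  let Y : Vec d := innerSGD G α y₀ x N s
  let δ : Fin Q → Vec d := fun j => (1 / μ) • (innerSGD G α y₀ (x + μ • u j) N s - Y)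
  gradX FD x Y + (1 / (Q : ℝ)) • ∑ j, (inner ℝ (δ j) (gradY FD x Y)) • u j

/-- The outer iterates `x_k` of PZOBO-S along a realization `ω₀, ω₁, …` of the draws. -/
def iterate {p d n m N S Q Df : ℕ} (F : Fin n → Joint p d → ℝ) (G : Fin m → Joint p d → ℝ)
    (α β μ : ℝ) (x₀ : Vec p) (y₀ : Vec d) (ω : ℕ → Draw p n m N S Q Df) : ℕ → Vec p
  | 0 => x₀
  | k + 1 =>
    let x := iterate F G α β μ x₀ y₀ ω k
    x - β • hyperGradEst F G α μ y₀ x (ω k)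

/-- The constant `L_Φ` that sets the outer step size. -/
def LΦ (L M ρ τ μg : ℝ) : ℝ :=
  L + (2 * L ^ 2 + τ * M ^ 2) / μg + (ρ * L * M + L ^ 3 + τ * M * L) / μg ^ 2
    + ρ * L ^ 2 * M / μg ^ 3

end PZOBO

end

/-! The scheme is biased stochastic gradient descent on `Φ`. If the estimator has, at every point,
bias at most `b` and second moment at most `C₂`, the quadratic upper bound for `Φ` gives an expected
decrease per step of at least `β‖∇Φ‖²/2 - βb²/2 - lβ²C₂` (`Setup.le_integral_decrease`). Telescoping
with `β` of order `1/√K` bounds the average of `E‖∇Φ‖²` by a constant times `1/√K + b² + C₂/√K`. So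
it suffices that `C₂ = O(p)` and `b² = O(p/√K + r^N + 1/√S)` with `r = 1 - αμg`. Only the mean of
the estimator has to be close to `∇Φ`, not the estimator itself, which is why `Q` and `D_f` may be
one.

The engine is contraction. For `α = 2/(L+μg)` the inner step of every sample function contracts in
`y` by `r` (`gradient_step_contraction`), and batch averages inherit this (`Reg.mean`). All errors
along the inner iterates therefore obey recursions `e ≤ r e + c`, with bounds uniform in `N` and in
the batches: `Y^N` is `Λ`-Lipschitz in `x`, where `Λ = L/μg`, and its linearization `jac` has a
quadratic remainder with constant `taylorConst`. The same argument at the fixed point differentiates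
`y*` without the implicit function theorem (`Reg.solution_taylor`) and yields the quadratic
remainder of `Φ` (`Setup.totalObj_taylor`).

The bias (`Setup.bias_le`) is the sum of three gaps. (a) Replacing difference quotients by Jacobians
costs `O(μ E‖u‖³) = O(μ p^{3/2}) = O(1/√K)`, because `E⟨Ju, v⟩u = Jᵀv` for Gaussian `u`. (b)
Replacing the iterates by `y*(x)` costs the expected distance of `Y^N` and of its Jacobian to their
values frozen at `y*(x)`, of order `r^N + N r^N + 1/√S`. Since each batch step is itself a
contraction, sampling noise matters only at `y*(x)`. (c) The frozen Jacobian recursion is affine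
with independent coefficients, so its expectation follows the deterministic full-gradient recursion,
which converges like `r^N` to the Jacobian of `y*`. No variance bound on second derivatives is
needed. Squaring, `(N r^N)² = O(r^N)`, so the rate `(1 - αμg)^N` survives.

The second moment is `O(p)`: the linearized part is governed by `E⟨a, u⟩²‖u‖² = O(p‖a‖²)`, and the
remainder by `μ² E‖u‖⁶ = O(μ²p³)`, which is bounded. -/

noncomputable section

namespace PZOBO

/-! ### Smooth and strongly convex functions; contraction of a gradient step -/

section Smooth

variable {E : Type*} [NormedAddCommGroup E] [InnerProductSpace ℝ E]

/-- The derivative of a function along a line, in terms of its gradient. -/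
theorem hasDerivAt_line [CompleteSpace E] {φ : E → ℝ} {g : E → E}
    (hg : ∀ y, HasGradientAt φ (g y) y) (y v : E) (t : ℝ) :
    HasDerivAt (fun t : ℝ => φ (y + t • v)) (inner ℝ (g (y + t • v)) v) t := by
  have h1 : HasDerivAt (fun t : ℝ => y + t • v) v t := by
    simpa using ((hasDerivAt_id t).smul_const v).const_add y
  have h2 := (hg (y + t • v)).hasFDerivAt.comp_hasDerivAt t h1
  rw [InnerProductSpace.toDual_apply_apply] at h2
  exact h2

/-- The descent lemma: a quadratic upper bound for functions with Lipschitz gradient. -/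
theorem le_quadratic_of_lipschitz_gradient [CompleteSpace E] {φ : E → ℝ} {g : E → E} {l : ℝ}
    (hg : ∀ y, HasGradientAt φ (g y) y) (hl : ∀ y z, ‖g y - g z‖ ≤ l * ‖y - z‖) (y z : E) :
    φ z ≤ φ y + inner ℝ (g y) (z - y) + l / 2 * ‖z - y‖ ^ 2 := by
  set v := z - y with hv
  -- `ψ` is `φ` along the segment minus the claimed upper bound, up to a constant. Its derivative is
  -- `⟨g(y+tv) - g(y), v⟩ - l t‖v‖²`, nonpositive by Cauchy–Schwarz, and `ψ 1 ≤ ψ 0` is the claim.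
  let ψ : ℝ → ℝ := fun t => φ (y + t • v) - t * inner ℝ (g y) v - l / 2 * ‖v‖ ^ 2 * t ^ 2
  have hd : ∀ t, HasDerivAt ψ
      (inner ℝ (g (y + t • v)) v - inner ℝ (g y) v - l / 2 * ‖v‖ ^ 2 * (2 * t)) t := by
    intro t
    have h1 := hasDerivAt_line hg y v t
    have h2 := (hasDerivAt_id t).mul_const (inner ℝ (g y) v)
    have h3 := (hasDerivAt_pow 2 t).const_mul (l / 2 * ‖v‖ ^ 2)
    have h4 := (h1.sub h2).sub h3
    norm_num at h4
    exact h4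
  have hanti : AntitoneOn ψ (Set.Icc 0 1) := by
    apply antitoneOn_of_deriv_nonpos (convex_Icc 0 1)
    · exact fun t _ => (hd t).continuousAt.continuousWithinAt
    · exact fun t _ => (hd t).differentiableAt.differentiableWithinAt
    · intro t ht
      rw [interior_Icc] at ht
      rw [(hd t).deriv, ← inner_sub_left]
      have h1 := real_inner_le_norm (g (y + t • v) - g y) v
      have h2 := hl (y + t • v) y
      rw [add_sub_cancel_left, norm_smul, Real.norm_of_nonneg ht.1.le] at h2
      have h3 := mul_le_mul_of_nonneg_right h2 (norm_nonneg v)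
      nlinarith
  have h01 := hanti (by simp) (by simp) zero_le_one
  simp only [ψ, zero_smul, add_zero, one_smul] at h01
  have : y + v = z := by simp [hv]
  rw [this] at h01
  linarith

/-- A two-sided first-order Taylor estimate for functions with Lipschitz gradient. -/
theorem abs_sub_inner_le_of_lipschitz_gradient [CompleteSpace E] {φ : E → ℝ} {g : E → E} {l : ℝ}
    (hg : ∀ y, HasGradientAt φ (g y) y) (hl : ∀ y z, ‖g y - g z‖ ≤ l * ‖y - z‖) (y z : E) :
    |φ z - φ y - inner ℝ (g y) (z - y)| ≤ l / 2 * ‖z - y‖ ^ 2 := by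
  have h1 := le_quadratic_of_lipschitz_gradient hg hl y z
  have hg' : ∀ y, HasGradientAt (fun y => -φ y) (-g y) y := by
    intro y
    have := (hg y).hasFDerivAt.neg
    rw [hasGradientAt_iff_hasFDerivAt, map_neg]
    exact this
  have h2 := le_quadratic_of_lipschitz_gradient hg' (l := l)
    (fun y z => by rw [← neg_sub', norm_neg]; exact hl y z) y z
  rw [inner_neg_left] at h2
  rw [abs_le]
  constructor <;> linarith

/-- The first-order lower bound for strongly convex functions. -/
theorem quadratic_le_of_strongConvexOn [CompleteSpace E] {φ : E → ℝ} {g : E → E} {m : ℝ}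
    (hg : ∀ y, HasGradientAt φ (g y) y) (hm : StrongConvexOn Set.univ m φ) (y z : E) :
    φ y + inner ℝ (g y) (z - y) + m / 2 * ‖z - y‖ ^ 2 ≤ φ z := by
  set v := z - y with hv
  have hd := hasDerivAt_line hg y v 0
  have hs := hd.tendsto_slope_zero_right
  simp only [zero_smul, add_zero, zero_add, smul_eq_mul] at hs
  -- Strong convexity at `(1-t)y + tz`, divided by `t`, bounds the difference quotient of `φ` by
  -- this expression; the claim is its limit as `t → 0⁺`.
  have hlim : Filter.Tendsto (fun t : ℝ => φ z - φ y - (1 - t) * (m / 2 * ‖v‖ ^ 2))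
      (nhdsWithin 0 (Set.Ioi 0)) (nhds (φ z - φ y - (1 - 0) * (m / 2 * ‖v‖ ^ 2))) := by
    apply Filter.Tendsto.mono_left _ nhdsWithin_le_nhds
    exact Continuous.tendsto (by fun_prop) 0
  have key := le_of_tendsto_of_tendsto hs hlim (by
    have h1 : Set.Ioc (0 : ℝ) 1 ∈ nhdsWithin (0 : ℝ) (Set.Ioi 0) := Ioc_mem_nhdsGT one_pos
    filter_upwards [h1] with t ht
    have h2 := hm.2 (Set.mem_univ y) (Set.mem_univ z) (sub_nonneg.2 ht.2) ht.1.le (by ring)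
    have h3 : (1 - t) • y + t • z = y + t • v := by rw [hv]; module
    rw [h3, norm_sub_rev, ← hv] at h2
    simp only [smul_eq_mul] at h2
    rw [inv_mul_le_iff₀ ht.1]
    nlinarith)
  linarith

/-- Co-coercivity of the gradient, from the quadratic lower and upper bounds. -/
theorem sq_norm_sub_le_inner_of_quadratic {h : E → ℝ} {g : E → E} {l : ℝ} (hl : 0 ≤ l)
    (lo : ∀ y z, h y + inner ℝ (g y) (z - y) ≤ h z)
    (up : ∀ y z, h z ≤ h y + inner ℝ (g y) (z - y) + l / 2 * ‖z - y‖ ^ 2) (y z : E) :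
    ‖g y - g z‖ ^ 2 ≤ l * inner ℝ (g y - g z) (y - z) := by
  -- The lower bound based at `y` and the upper bound based at `z` are compared at the common point
  -- `z - s(g z - g y)`.
  have step : ∀ (s : ℝ) (y z : E), h y - h z + inner ℝ (g y) (z - y)
      + (s - l / 2 * s ^ 2) * ‖g y - g z‖ ^ 2 ≤ 0 := by
    intro s y z
    have h1 := lo y (z - s • (g z - g y))
    have h2 := up z (z - s • (g z - g y))
    have e1 : z - s • (g z - g y) - y = (z - y) - s • (g z - g y) := by abel
    have e2 : z - s • (g z - g y) - z = - (s • (g z - g y)) := by abel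
    rw [e1, inner_sub_right, inner_smul_right] at h1
    rw [e2, inner_neg_right, inner_smul_right, norm_neg, norm_smul, mul_pow, Real.norm_eq_abs,
      sq_abs] at h2
    have e3 : inner ℝ (g z) (g z - g y) - inner ℝ (g y) (g z - g y) = ‖g z - g y‖ ^ 2 := by
      rw [← inner_sub_left, real_inner_self_eq_norm_sq]
    rw [norm_sub_rev (g y)]
    have e4 := congrArg (fun q => s * q) e3
    linarith
  have both : ∀ s : ℝ, (2 * s - l * s ^ 2) * ‖g y - g z‖ ^ 2 ≤ inner ℝ (g y - g z) (y - z) := by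
    intro s
    have h1 := step s y z
    have h2 := step s z y
    rw [norm_sub_rev (g z)] at h2
    rw [← neg_sub y z, inner_neg_right] at h1
    rw [inner_sub_left]
    linarith
  -- For `l > 0` the best choice is `s = 1/l`. For `l = 0` the bound is linear in `s`, and a large
  -- `s` forces `g y = g z`.
  rcases hl.eq_or_lt with rfl | hl
  · set X := ‖g y - g z‖ ^ 2
    set W : ℝ := inner ℝ (g y - g z) (y - z)
    by_contra hX
    have hX : 0 < X := by simpa using hX
    have h1 := both ((|W| + 1) / X)
    have h2 : (2 * ((|W| + 1) / X) - 0 * ((|W| + 1) / X) ^ 2) * X = 2 * (|W| + 1) := by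
      field_simp
      ring
    rw [h2] at h1
    have h3 := le_abs_self W
    have h4 := abs_nonneg W
    linarith
  · have h1 := both (1 / l)
    have h2 : 2 * (1 / l) - l * (1 / l) ^ 2 = 1 / l := by field_simp; ring
    rw [h2, one_div, inv_mul_le_iff₀ hl] at h1
    exact h1

/-- The gradient step with the optimal step size `2 / (L + m)` is a contraction with factor
`1 - α m = (L - m) / (L + m)`. -/
theorem gradient_step_contraction [CompleteSpace E] {φ : E → ℝ} {g : E → E} {L m : ℝ}
    (hm0 : 0 < m) (hmL : m ≤ L)
    (hg : ∀ y, HasGradientAt φ (g y) y) (hm : StrongConvexOn Set.univ m φ)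
    (hl : ∀ y z, ‖g y - g z‖ ≤ L * ‖y - z‖) (y z : E) :
    ‖(y - (2 / (L + m)) • g y) - (z - (2 / (L + m)) • g z)‖
      ≤ (1 - 2 / (L + m) * m) * ‖y - z‖ := by
  have hpos : 0 < L + m := by linarith
  -- Co-coercivity is applied to `φ - (m/2)‖·‖²`, which is convex with quadratic upper constant `L -
  -- m`. Expanded, it reads `‖a‖² + Lm‖b‖² ≤ (L+m)⟨a, b⟩`, which is exactly the inequality needed
  -- for the factor `(L-m)/(L+m)`.
  have hco := sq_norm_sub_le_inner_of_quadratic (h := fun y => φ y - m / 2 * ‖y‖ ^ 2)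
    (g := fun y => g y - m • y) (l := L - m) (by linarith)
    (fun y z => by
      have h1 := quadratic_le_of_strongConvexOn hg hm y z
      have h2 : ‖z‖ ^ 2 = ‖y‖ ^ 2 + 2 * inner ℝ y (z - y) + ‖z - y‖ ^ 2 := by
        rw [← norm_add_sq_real]; simp
      rw [inner_sub_left, inner_smul_left]
      simp only [conj_trivial]
      rw [h2]
      linarith)
    (fun y z => by
      have h1 := le_quadratic_of_lipschitz_gradient hg hl y z
      have h2 : ‖z‖ ^ 2 = ‖y‖ ^ 2 + 2 * inner ℝ y (z - y) + ‖z - y‖ ^ 2 := by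
        rw [← norm_add_sq_real]; simp
      rw [inner_sub_left, inner_smul_left]
      simp only [conj_trivial]
      rw [h2]
      linarith) y z
  set a := g y - g z with ha
  set b := y - z with hb
  have e1 : g y - m • y - (g z - m • z) = a - m • b := by rw [ha, hb]; module
  have e2 : (y - (2 / (L + m)) • g y) - (z - (2 / (L + m)) • g z) = b - (2 / (L + m)) • a := by
    rw [ha, hb]; module
  rw [e1, inner_sub_left, inner_smul_left, real_inner_self_eq_norm_sq, norm_sub_sq_real,
    inner_smul_right, norm_smul, mul_pow, Real.norm_eq_abs, sq_abs] at hco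
  simp only [conj_trivial] at hco
  rw [e2]
  have hr : 1 - 2 / (L + m) * m = (L - m) / (L + m) := by field_simp; ring
  have hr0 : 0 ≤ (L - m) / (L + m) := div_nonneg (by linarith) hpos.le
  rw [hr]
  refine le_of_sq_le_sq ?_ (by positivity)
  rw [norm_sub_sq_real, inner_smul_right, norm_smul, mul_pow, Real.norm_eq_abs, sq_abs,
    mul_pow, real_inner_comm, div_pow, div_pow]
  have h3 : ‖b‖ ^ 2 - 2 * (2 / (L + m) * inner ℝ a b) + 2 ^ 2 / (L + m) ^ 2 * ‖a‖ ^ 2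
      = ((L + m) ^ 2 * ‖b‖ ^ 2 - 4 * (L + m) * inner ℝ a b + 4 * ‖a‖ ^ 2) / (L + m) ^ 2 := by
    field_simp; ring
  rw [h3, div_mul_eq_mul_div]
  gcongr
  nlinarith

/-- A strongly convex function on a nontrivial space has modulus at most the Lipschitz constant of
its gradient. -/
theorem strongConvex_modulus_le [CompleteSpace E] [Nontrivial E] {φ : E → ℝ} {g : E → E} {L m : ℝ}
    (hg : ∀ y, HasGradientAt φ (g y) y) (hm : StrongConvexOn Set.univ m φ)
    (hl : ∀ y z, ‖g y - g z‖ ≤ L * ‖y - z‖) : m ≤ L := by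
  obtain ⟨z, hz⟩ := exists_ne (0 : E)
  have h1 := quadratic_le_of_strongConvexOn hg hm 0 z
  have h2 := le_quadratic_of_lipschitz_gradient hg hl 0 z
  have h3 : 0 < ‖z - 0‖ ^ 2 := by simpa [sq_pos_iff] using hz
  nlinarith

end Smooth

/-! ### Taylor estimates and differentiability from a quadratic remainder -/

section Taylor

variable {E F : Type*} [NormedAddCommGroup E] [NormedSpace ℝ E] [NormedAddCommGroup F]
  [NormedSpace ℝ F]

/-- First-order Taylor estimate for maps with Lipschitz derivative. -/
theorem norm_sub_fderiv_le {A : E → F} {k : ℝ} (hk : 0 ≤ k) (hA : Differentiable ℝ A)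
    (hl : ∀ w w', ‖fderiv ℝ A w - fderiv ℝ A w'‖ ≤ k * ‖w - w'‖) (w w' : E) :
    ‖A w' - A w - fderiv ℝ A w (w' - w)‖ ≤ k * ‖w' - w‖ ^ 2 := by
  -- Mean value inequality for `A` minus its linearization at `w`; the sharp factor `1/2` is not
  -- needed.
  have h := (convex_segment w w').norm_image_sub_le_of_norm_fderiv_le'
    (f := A) (φ := fderiv ℝ A w) (C := k * ‖w' - w‖)
    (fun x _ => hA x)
    (fun x hx => (hl x w).trans (by
      gcongr
      have := norm_sub_le_of_mem_segment hx
      exact this))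
    (left_mem_segment ℝ w w') (right_mem_segment ℝ w w')
  calc _ ≤ _ := h
    _ = _ := by ring

/-- A quadratic remainder bound gives the derivative. -/
theorem hasFDerivAt_of_norm_sub_le_sq {f : E → F} {f' : E →L[ℝ] F} {x : E} {k : ℝ}
    (h : ∀ v, ‖f (x + v) - f x - f' v‖ ≤ k * ‖v‖ ^ 2) : HasFDerivAt f f' x := by
  rw [hasFDerivAt_iff_isLittleO_nhds_zero]
  have h1 : (fun v => f (x + v) - f x - f' v) =O[nhds 0] fun v : E => ‖v‖ ^ 2 :=
    Asymptotics.IsBigO.of_bound k (Filter.Eventually.of_forall fun v => by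
      simpa using h v)
  refine h1.trans_isLittleO ?_
  simpa using Asymptotics.isLittleO_norm_pow_id one_lt_two (E' := E)

end Taylor

end PZOBO

namespace PZOBO

/-! ### Empirical means -/

section Mean

variable {V W : Type*} [NormedAddCommGroup V] [NormedSpace ℝ V] [NormedAddCommGroup W]
  [NormedSpace ℝ W] {k : ℕ}

/-- The mean of finitely many vectors. -/
def mean (v : Fin k → V) : V := (1 / (k : ℝ)) • ∑ i, v i

theorem mean_sub (v w : Fin k → V) : mean (fun i => v i - w i) = mean v - mean w := by
  simp [mean, Finset.sum_sub_distrib, smul_sub]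

theorem mean_smul (a : ℝ) (v : Fin k → V) : mean (fun i => a • v i) = a • mean v := by
  simp only [mean, ← Finset.smul_sum]
  rw [smul_comm]

theorem mean_const (hk : 1 ≤ k) (v : V) : mean (fun _ : Fin k => v) = v := by
  have : (k : ℝ) ≠ 0 := by positivity
  simp [mean, ← Nat.cast_smul_eq_nsmul ℝ, smul_smul, this]

theorem map_mean (T : V →L[ℝ] W) (v : Fin k → V) : T (mean v) = mean fun i => T (v i) := by
  simp [mean, map_smul, map_sum]

theorem norm_mean_le_mean (v : Fin k → V) : ‖mean v‖ ≤ mean fun i => ‖v i‖ := by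
  rw [mean, mean, norm_smul, smul_eq_mul, Real.norm_of_nonneg (by positivity)]
  gcongr
  exact norm_sum_le _ _

theorem mean_le_mean {v w : Fin k → ℝ} (h : ∀ i, v i ≤ w i) : mean v ≤ mean w := by
  unfold mean
  rw [smul_eq_mul, smul_eq_mul]
  gcongr with i
  exact h i

theorem norm_mean_le (hk : 1 ≤ k) {v : Fin k → V} {c : ℝ} (h : ∀ i, ‖v i‖ ≤ c) : ‖mean v‖ ≤ c :=
  (norm_mean_le_mean v).trans ((mean_le_mean h).trans_eq (mean_const hk c))

theorem sq_norm_mean_le (v : Fin k → V) : ‖mean v‖ ^ 2 ≤ mean fun i => ‖v i‖ ^ 2 := by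
  rcases Nat.eq_zero_or_pos k with rfl | hk
  · simp [mean]
  have hk' : (0 : ℝ) < k := by exact_mod_cast hk
  calc ‖mean v‖ ^ 2 ≤ (mean fun i => ‖v i‖) ^ 2 := by
        gcongr; exact norm_mean_le_mean v
    _ ≤ mean fun i => ‖v i‖ ^ 2 := by
        simp only [mean, smul_eq_mul]
        rw [mul_pow]
        have := sq_sum_le_card_mul_sum_sq (s := Finset.univ) (f := fun i : Fin k => ‖v i‖)
        rw [Finset.card_univ, Fintype.card_fin] at this
        calc _ ≤ (1 / (k : ℝ)) ^ 2 * (k * ∑ i, ‖v i‖ ^ 2) := by gcongr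
          _ = _ := by field_simp

theorem hasFDerivAt_mean {A : Fin k → V → W} {A' : Fin k → V →L[ℝ] W} {w : V}
    (h : ∀ i, HasFDerivAt (A i) (A' i) w) :
    HasFDerivAt (fun w => mean fun i => A i w) (mean A') w := by
  simp only [mean]
  exact (HasFDerivAt.fun_sum fun i _ => h i).const_smul _

theorem differentiable_mean {A : Fin k → V → W} (h : ∀ i, Differentiable ℝ (A i)) :
    Differentiable ℝ (fun w => mean fun i => A i w) :=
  fun w => (hasFDerivAt_mean fun i => (h i w).hasFDerivAt).differentiableAt

theorem fderiv_mean {A : Fin k → V → W} (h : ∀ i, Differentiable ℝ (A i)) (w : V) :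
    fderiv ℝ (fun w => mean fun i => A i w) w = mean fun i => fderiv ℝ (A i) w :=
  (hasFDerivAt_mean fun i => (h i w).hasFDerivAt).fderiv

end Mean

/-! ### Partial gradients on the product space and the regularity of `∇_y G` -/

variable {p d : ℕ}

theorem avg_eq_mean {k : ℕ} (h : Fin k → Joint p d → ℝ) (w : Joint p d) :
    avg h w = mean fun i => h i w := rfl

/-- The inclusion `x ↦ (x, 0)`. -/
def inlL : Vec p →L[ℝ] Joint p d :=
  ((WithLp.prodContinuousLinearEquiv 2 ℝ (Vec p) (Vec d)).symm : _ →L[ℝ] _).comp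
    (ContinuousLinearMap.inl ℝ (Vec p) (Vec d))

/-- The inclusion `y ↦ (0, y)`. -/
def inrL : Vec d →L[ℝ] Joint p d :=
  ((WithLp.prodContinuousLinearEquiv 2 ℝ (Vec p) (Vec d)).symm : _ →L[ℝ] _).comp
    (ContinuousLinearMap.inr ℝ (Vec p) (Vec d))

theorem inlL_apply (x : Vec p) : (inlL x : Joint p d) = pt x 0 := rfl

theorem inrL_apply (y : Vec d) : (inrL y : Joint p d) = pt 0 y := rfl

theorem pt_sub (x x' : Vec p) (y y' : Vec d) : pt x y - pt x' y' = pt (x - x') (y - y') := rfl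

theorem pt_eq_add (x : Vec p) (y : Vec d) : pt x y = inlL x + inrL y := by
  rw [inlL_apply, inrL_apply, ← WithLp.toLp_add]
  simp

theorem norm_inlL (x : Vec p) : ‖(inlL x : Joint p d)‖ = ‖x‖ := by
  rw [inlL_apply]; exact WithLp.norm_toLp_fst 2 _ _ x

theorem norm_inrL (y : Vec d) : ‖(inrL y : Joint p d)‖ = ‖y‖ := by
  rw [inrL_apply]; exact WithLp.norm_toLp_snd 2 _ _ y

theorem norm_pt_le (x : Vec p) (y : Vec d) : ‖pt x y‖ ≤ ‖x‖ + ‖y‖ := by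
  rw [pt_eq_add]
  exact (norm_add_le _ _).trans_eq (by rw [norm_inlL, norm_inrL])

theorem norm_pt_sub_right (x : Vec p) (y y' : Vec d) : ‖pt x y - pt x y'‖ = ‖y - y'‖ := by
  rw [pt_sub, sub_self, ← inrL_apply, norm_inrL]

theorem norm_pt_sub_left (x x' : Vec p) (y : Vec d) : ‖pt x y - pt x' y‖ = ‖x - x'‖ := by
  rw [pt_sub, sub_self, ← inlL_apply, norm_inlL]

theorem hasFDerivAt_pt_right (x : Vec p) (y : Vec d) :
    HasFDerivAt (fun y' : Vec d => pt x y') inrL y := by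
  have h : (fun y' : Vec d => pt x y') = fun y' => inlL x + inrL y' := funext fun y' => pt_eq_add x y'
  rw [h]
  exact inrL.hasFDerivAt.const_add _

theorem hasFDerivAt_pt_left (x : Vec p) (y : Vec d) :
    HasFDerivAt (fun x' : Vec p => pt x' y) inlL x := by
  have h : (fun x' : Vec p => pt x' y) = fun x' => inlL x' + inrL y := funext fun x' => pt_eq_add x' y
  rw [h]
  exact inlL.hasFDerivAt.add_const _

theorem hasGradientAt_right {h : Joint p d → ℝ} (hh : Differentiable ℝ h) (x : Vec p) (y : Vec d) :
    HasGradientAt (fun y' => h (pt x y')) (gradient h (pt x y)).snd y := by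
  have h1 := (hh (pt x y)).hasGradientAt.hasFDerivAt.comp y (hasFDerivAt_pt_right x y)
  have e : InnerProductSpace.toDual ℝ (Vec d) (gradient h (pt x y)).snd
      = (InnerProductSpace.toDual ℝ (Joint p d) (gradient h (pt x y))).comp inrL := by
    ext v
    rw [ContinuousLinearMap.comp_apply, InnerProductSpace.toDual_apply_apply,
      InnerProductSpace.toDual_apply_apply, inrL_apply, WithLp.prod_inner_apply]
    simp
  rw [hasGradientAt_iff_hasFDerivAt, e]
  exact h1

theorem hasGradientAt_left {h : Joint p d → ℝ} (hh : Differentiable ℝ h) (x : Vec p) (y : Vec d) :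
    HasGradientAt (fun x' => h (pt x' y)) (gradient h (pt x y)).fst x := by
  have h1 := (hh (pt x y)).hasGradientAt.hasFDerivAt.comp x (hasFDerivAt_pt_left x y)
  have e : InnerProductSpace.toDual ℝ (Vec p) (gradient h (pt x y)).fst
      = (InnerProductSpace.toDual ℝ (Joint p d) (gradient h (pt x y))).comp inlL := by
    ext v
    rw [ContinuousLinearMap.comp_apply, InnerProductSpace.toDual_apply_apply,
      InnerProductSpace.toDual_apply_apply, inlL_apply, WithLp.prod_inner_apply]
    simp
  rw [hasGradientAt_iff_hasFDerivAt, e]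
  exact h1

theorem gradY_eq {h : Joint p d → ℝ} (hh : Differentiable ℝ h) (x : Vec p) (y : Vec d) :
    gradY h x y = (gradient h (pt x y)).snd :=
  (hasGradientAt_right hh x y).gradient

theorem gradX_eq {h : Joint p d → ℝ} (hh : Differentiable ℝ h) (x : Vec p) (y : Vec d) :
    gradX h x y = (gradient h (pt x y)).fst :=
  (hasGradientAt_left hh x y).gradient

theorem hasGradientAt_avg {k : ℕ} {h : Fin k → Joint p d → ℝ} (hh : ∀ i, Differentiable ℝ (h i))
    (w : Joint p d) : HasGradientAt (avg h) (mean fun i => gradient (h i) w) w := by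
  have h1 := hasFDerivAt_mean fun i => (hh i w).hasGradientAt.hasFDerivAt
  have e : InnerProductSpace.toDual ℝ (Joint p d) (mean fun i => gradient (h i) w)
      = mean fun i => InnerProductSpace.toDual ℝ (Joint p d) (gradient (h i) w) := by
    simp only [mean, map_smulₛₗ, map_sum, conj_trivial]
  rw [hasGradientAt_iff_hasFDerivAt, e]
  exact h1

theorem differentiable_avg {k : ℕ} {h : Fin k → Joint p d → ℝ} (hh : ∀ i, Differentiable ℝ (h i)) :
    Differentiable ℝ (avg h) := fun w => (hasGradientAt_avg hh w).differentiableAt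

theorem gradient_avg {k : ℕ} {h : Fin k → Joint p d → ℝ} (hh : ∀ i, Differentiable ℝ (h i))
    (w : Joint p d) : gradient (avg h) w = mean fun i => gradient (h i) w :=
  (hasGradientAt_avg hh w).gradient

theorem gradY_avg {k : ℕ} {h : Fin k → Joint p d → ℝ} (hh : ∀ i, Differentiable ℝ (h i))
    (x : Vec p) (y : Vec d) : gradY (avg h) x y = mean fun i => gradY (h i) x y := by
  rw [gradY_eq (differentiable_avg hh), gradient_avg hh]
  simp only [fun i => gradY_eq (hh i) x y]
  exact map_mean (WithLp.sndL 2 ℝ (Vec p) (Vec d)) _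

theorem gradX_avg {k : ℕ} {h : Fin k → Joint p d → ℝ} (hh : ∀ i, Differentiable ℝ (h i))
    (x : Vec p) (y : Vec d) : gradX (avg h) x y = mean fun i => gradX (h i) x y := by
  rw [gradX_eq (differentiable_avg hh), gradient_avg hh]
  simp only [fun i => gradX_eq (hh i) x y]
  exact map_mean (WithLp.fstL 2 ℝ (Vec p) (Vec d)) _

theorem norm_snd_le (w : Joint p d) : ‖w.snd‖ ≤ ‖w‖ := WithLp.norm_snd_le _ w

theorem norm_fst_le (w : Joint p d) : ‖w.fst‖ ≤ ‖w‖ := WithLp.norm_fst_le _ w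

/-- The operator norm is bounded by the Frobenius norm of the matrix. -/
theorem opNorm_le_frobNorm {a b : ℕ} (T : Vec b →L[ℝ] Vec a) :
    ‖T‖ ≤ frobNorm (Matrix.of fun i j => T (EuclideanSpace.single j 1) i) := by
  refine T.opNorm_le_bound (Real.sqrt_nonneg _) fun v => ?_
  have hT : ∀ i, T v i = ∑ j, T (EuclideanSpace.single j 1) i * v j := by
    intro i
    have hv : v = ∑ j, v j • EuclideanSpace.single j (1 : ℝ) := by
      ext k
      simp [Finset.sum_apply, Pi.single_apply]
    conv_lhs => rw [hv]
    simp [map_sum, map_smul, mul_comm]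
  rw [frobNorm, EuclideanSpace.norm_eq, EuclideanSpace.norm_eq v, ← Real.sqrt_mul (by positivity)]
  apply Real.sqrt_le_sqrt
  rw [Finset.sum_mul]
  refine Finset.sum_le_sum fun i _ => ?_
  simp only [Real.norm_eq_abs, sq_abs, Matrix.of_apply]
  rw [hT i]
  exact Finset.sum_mul_sq_le_sq_mul_sq _ _ _

/-- The regularity of a map `A(x, y)` (a partial gradient `∇_y G`) used in the analysis: it is
`L`-Lipschitz, the step `y ↦ y - α A(x, y)` contracts by `r`, and the derivative is
`κ`-Lipschitz. -/
structure Reg (A : Joint p d → Vec d) (α L r κ : ℝ) : Prop where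
  lip : ∀ w w', ‖A w - A w'‖ ≤ L * ‖w - w'‖
  contr : ∀ x y y', ‖(y - α • A (pt x y)) - (y' - α • A (pt x y'))‖ ≤ r * ‖y - y'‖
  diff : Differentiable ℝ A
  lipD : ∀ w v, ‖fderiv ℝ A w - fderiv ℝ A v‖ ≤ κ * ‖w - v‖

/-- Averages of regular maps are regular. -/
theorem Reg.mean {k : ℕ} (hk : 1 ≤ k) {A : Fin k → Joint p d → Vec d} {α L r κ : ℝ}
    (h : ∀ i, Reg (A i) α L r κ) : Reg (fun w => mean fun i => A i w) α L r κ where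
  lip w w' := by
    rw [← mean_sub]
    exact norm_mean_le hk fun i => (h i).lip w w'
  contr x y y' := by
    -- A gradient step of an average is the average of the gradient steps, so contraction passes to
    -- means.
    have e : ∀ y, y - α • PZOBO.mean (fun i => A i (pt x y))
        = PZOBO.mean fun i => (y - α • A i (pt x y)) := by
      intro y
      rw [mean_sub, mean_const hk, mean_smul]
    rw [e, e, ← mean_sub]
    exact norm_mean_le hk fun i => (h i).contr x y y'
  diff := differentiable_mean fun i => (h i).diff
  lipD w v := by
    rw [fderiv_mean (fun i => (h i).diff), fderiv_mean (fun i => (h i).diff), ← mean_sub]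
    exact norm_mean_le hk fun i => (h i).lipD w v

/-- The partial derivative in `x`. -/
def DX (A : Joint p d → Vec d) (w : Joint p d) : Vec p →L[ℝ] Vec d := (fderiv ℝ A w).comp inlL

/-- The partial derivative in `y`. -/
def DY (A : Joint p d → Vec d) (w : Joint p d) : Vec d →L[ℝ] Vec d := (fderiv ℝ A w).comp inrL

theorem fderiv_pt (A : Joint p d → Vec d) (w : Joint p d) (a : Vec p) (b : Vec d) :
    fderiv ℝ A w (pt a b) = DX A w a + DY A w b := by
  rw [pt_eq_add, map_add]; rfl

theorem DX_sub_apply_norm_le (A B : Joint p d → Vec d) (w w' : Joint p d) :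
    ‖DX A w - DX B w'‖ ≤ ‖fderiv ℝ A w - fderiv ℝ B w'‖ := by
  refine ContinuousLinearMap.opNorm_le_bound _ (norm_nonneg _) fun v => ?_
  have := (fderiv ℝ A w - fderiv ℝ B w').le_opNorm (inlL v)
  rwa [norm_inlL] at this

theorem DY_sub_apply_norm_le (A B : Joint p d → Vec d) (w w' : Joint p d) :
    ‖DY A w - DY B w'‖ ≤ ‖fderiv ℝ A w - fderiv ℝ B w'‖ := by
  refine ContinuousLinearMap.opNorm_le_bound _ (norm_nonneg _) fun v => ?_
  have := (fderiv ℝ A w - fderiv ℝ B w').le_opNorm (inrL v)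
  rwa [norm_inrL] at this

theorem hasFDerivAt_DX {A : Joint p d → Vec d} (hA : Differentiable ℝ A) (x : Vec p) (y : Vec d) :
    HasFDerivAt (fun x' => A (pt x' y)) (DX A (pt x y)) x :=
  (hA (pt x y)).hasFDerivAt.comp x (hasFDerivAt_pt_left x y)

theorem hasFDerivAt_DY {A : Joint p d → Vec d} (hA : Differentiable ℝ A) (x : Vec p) (y : Vec d) :
    HasFDerivAt (fun y' => A (pt x y')) (DY A (pt x y)) y :=
  (hA (pt x y)).hasFDerivAt.comp y (hasFDerivAt_pt_right x y)

/-- A derivative is bounded by a Lipschitz constant. -/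
theorem norm_fderiv_le_of_lip {E F : Type*} [NormedAddCommGroup E] [NormedSpace ℝ E]
    [NormedAddCommGroup F] [NormedSpace ℝ F] {f : E → F} {f' : E →L[ℝ] F} {x : E} {C : ℝ}
    (hC : 0 ≤ C) (hf : HasFDerivAt f f' x) (h : ∀ y z, ‖f y - f z‖ ≤ C * ‖y - z‖) : ‖f'‖ ≤ C :=
  hf.le_of_lip' hC (Filter.Eventually.of_forall fun y => h y x)

theorem Reg.norm_DX_le {A : Joint p d → Vec d} {α L r κ : ℝ} (h : Reg A α L r κ) (hL : 0 ≤ L)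
    (w : Joint p d) : ‖DX A w‖ ≤ L :=
  norm_fderiv_le_of_lip hL (hasFDerivAt_DX h.diff w.fst w.snd) fun y z => by
    simpa [norm_pt_sub_left] using h.lip (pt y w.snd) (pt z w.snd)

theorem Reg.norm_step_le {A : Joint p d → Vec d} {α L r κ : ℝ} (h : Reg A α L r κ) (hr : 0 ≤ r)
    (w : Joint p d) : ‖ContinuousLinearMap.id ℝ (Vec d) - α • DY A w‖ ≤ r :=
  norm_fderiv_le_of_lip hr ((hasFDerivAt_id w.snd).sub
    ((hasFDerivAt_DY h.diff w.fst w.snd).const_smul α)) fun y z => h.contr w.fst y z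

/-- When the contraction factor vanishes, the derivative of a regular map is constant. -/
theorem fderiv_eq_of_contr_zero {A : Joint p d → Vec d} {α L : ℝ} (hα : α * L = 1)
    (hL : 0 < L) (lip : ∀ w w', ‖A w - A w'‖ ≤ L * ‖w - w'‖)
    (contr : ∀ x y y', ‖(y - α • A (pt x y)) - (y' - α • A (pt x y'))‖ ≤ 0)
    (hA : Differentiable ℝ A) (w w' : Joint p d) : fderiv ℝ A w = fderiv ℝ A w' := by
  -- The map `y ↦ y - α A(x, y)` is constant in `y`, so the `y`-derivative is `α⁻¹ = L` times the
  -- identity.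
  have hY : ∀ w b, DY A w b = L • b := by
    intro w b
    have h1 : ‖ContinuousLinearMap.id ℝ (Vec d) - α • DY A w‖ ≤ 0 :=
      norm_fderiv_le_of_lip le_rfl ((hasFDerivAt_id w.snd).sub
        ((hasFDerivAt_DY hA w.fst w.snd).const_smul α)) fun y z => by
          simpa using contr w.fst y z
    have h2 := DFunLike.congr_fun (norm_le_zero_iff.1 h1) b
    simp only [sub_apply, ContinuousLinearMap.id_apply,
      smul_apply, zero_apply] at h2
    have h3 : L • (b - α • DY A w b) = 0 := by rw [h2, smul_zero]
    rw [smul_sub, smul_smul, mul_comm L, hα, one_smul] at h3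
    exact (sub_eq_zero.1 h3).symm
  have hX : ∀ w a, DX A w a = 0 := by
    intro w a
    have hn : ‖fderiv ℝ A w‖ ≤ L :=
      norm_fderiv_le_of_lip hL.le (hA w).hasFDerivAt fun y z => lip y z
    by_contra hne
    have hb : 0 < ‖DX A w a‖ ^ 2 := by positivity
    set b := DX A w a with hbdef
    -- The `y`-part already exhausts the operator norm `L`. On `(a, t b)` with `b = DX A w a`, the
    -- derivative equals `(1 + Lt) b`; the `t²` terms cancel against the bound `L`, and the
    -- surviving linear term is unbounded in `t` unless `b = 0`.
    have key : ∀ t : ℝ, ‖b‖ ^ 2 * (1 + 2 * L * t) ≤ L ^ 2 * ‖a‖ ^ 2 := by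
      intro t
      have h1 := (fderiv ℝ A w).le_of_opNorm_le hn (pt a (t • b))
      rw [fderiv_pt, hY, ← hbdef, smul_smul] at h1
      have h2 : b + (L * t) • b = (1 + L * t) • b := by module
      rw [h2] at h1
      have h3 : ‖(1 + L * t) • b‖ ^ 2 ≤ (L * ‖pt a (t • b)‖) ^ 2 := by gcongr
      rw [norm_smul, mul_pow, mul_pow, WithLp.prod_norm_sq_eq_of_L2, Real.norm_eq_abs,
        sq_abs] at h3
      have h4 : ‖t • b‖ ^ 2 = t ^ 2 * ‖b‖ ^ 2 := by
        rw [norm_smul, mul_pow, Real.norm_eq_abs, sq_abs]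
      rw [WithLp.toLp_fst, WithLp.toLp_snd, h4] at h3
      nlinarith
    have := key ((L ^ 2 * ‖a‖ ^ 2) / (2 * L * ‖b‖ ^ 2))
    have e : ‖b‖ ^ 2 * (1 + 2 * L * ((L ^ 2 * ‖a‖ ^ 2) / (2 * L * ‖b‖ ^ 2)))
        = ‖b‖ ^ 2 + L ^ 2 * ‖a‖ ^ 2 := by field_simp
    linarith
  ext1 v
  have hv : v = pt v.fst v.snd := rfl
  rw [hv, fderiv_pt, fderiv_pt, hX, hX, hY, hY]

/-- The partial gradient `∇_y G` of an inner sample function is regular. -/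
theorem InnerAssumption.reg {G : Joint p d → ℝ} {μg : ℝ} {Lg ρ τ : ℝ≥0}
    (h : InnerAssumption G μg Lg ρ τ) (hμ : 0 < μg) {L : ℝ} (hL : (Lg : ℝ) ≤ L) (hμL : μg ≤ L)
    {α r : ℝ} (hα : α = 2 / (L + μg)) (hr : r = 1 - α * μg) :
    Reg (fun w : Joint p d => gradY G w.fst w.snd) α L r (r * ((ρ + τ) / r)) := by
  have hA : ∀ w : Joint p d, gradY G w.fst w.snd = (gradient G w).snd :=
    fun w => gradY_eq h.differentiable w.fst w.snd
  have lip : ∀ w w' : Joint p d,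
      ‖gradY G w.fst w.snd - gradY G w'.fst w'.snd‖ ≤ L * ‖w - w'‖ := by
    intro w w'
    rw [hA, hA, ← WithLp.sub_snd]
    refine (norm_snd_le _).trans ?_
    have := h.lipschitz_grad.dist_le_mul w w'
    rw [dist_eq_norm, dist_eq_norm] at this
    exact this.trans (by gcongr)
  have contr : ∀ (x : Vec p) (y y' : Vec d), ‖(y - α • gradY G x y) - (y' - α • gradY G x y')‖
      ≤ r * ‖y - y'‖ := by
    intro x y y'
    rw [hr, hα]
    refine gradient_step_contraction hμ hμL (φ := fun y => G (pt x y)) (fun y => ?_)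
      (h.strongConvex x) (fun y z => ?_) y y'
    · rw [gradY_eq h.differentiable]
      exact hasGradientAt_right h.differentiable x y
    · simpa [norm_pt_sub_right] using lip (pt x y) (pt x z)
  refine ⟨lip, contr, h.differentiable_gradY, fun w w' => ?_⟩
  -- The constant `r * ((ρ + τ) / r)` is `ρ + τ` for `r ≠ 0` and `0` for `r = 0`. In the second case
  -- `μg = L` and the derivative is constant, so `0` is correct. The factor `r` later turns `N
  -- r^(N-1)` into `N r^N`, which at `r = 0`, `N = 1` really requires a vanishing constant.
  by_cases hr0 : r = 0
  · rw [fderiv_eq_of_contr_zero (α := α) (L := L) ?_ (hμ.trans_le hμL) lip ?_ h.differentiable_gradY w w']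
    · simp [hr0]
    · have : L + μg ≠ 0 := by linarith
      rw [hr0, hα] at hr
      field_simp at hr
      rw [hα, div_mul_eq_mul_div, div_eq_one_iff_eq this]
      linarith
    · intro x y y'
      simpa [hr0] using contr x y y'
  · rw [mul_div_cancel₀ _ hr0]
    set A := fun w : Joint p d => gradY G w.fst w.snd with hAdef
    have hX : ‖DX A w - DX A w'‖ ≤ τ * ‖w - w'‖ := by
      refine (opNorm_le_frobNorm _).trans ((h.lipschitz_mixedXY w w').trans_eq' ?_)
      congr 1
      ext i j
      simp only [Matrix.of_apply, mixedXY, Matrix.sub_apply]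
      have e : ∀ w : Joint p d, fderiv ℝ (fun x' => gradY G x' w.snd) w.fst = DX A w := fun w =>
        (hasFDerivAt_DX h.differentiable_gradY w.fst w.snd).fderiv
      rw [e, e]
      rfl
    have hY : ‖DY A w - DY A w'‖ ≤ ρ * ‖w - w'‖ := by
      refine (opNorm_le_frobNorm _).trans ((h.lipschitz_hessYY w w').trans_eq' ?_)
      congr 1
      ext i j
      simp only [Matrix.of_apply, hessYY, Matrix.sub_apply]
      have e : ∀ w : Joint p d, fderiv ℝ (fun y' => gradY G w.fst y') w.snd = DY A w := fun w =>
        (hasFDerivAt_DY h.differentiable_gradY w.fst w.snd).fderiv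
      rw [e, e]
      rfl
    refine ContinuousLinearMap.opNorm_le_bound _ (by positivity) fun v => ?_
    have hv : v = pt v.fst v.snd := rfl
    have e : (fderiv ℝ A w - fderiv ℝ A w') v
        = (DX A w - DX A w') v.fst + (DY A w - DY A w') v.snd := by
      rw [sub_apply]
      conv_lhs => rw [hv, fderiv_pt, fderiv_pt]
      simp only [sub_apply]
      abel
    rw [e]
    calc _ ≤ τ * ‖w - w'‖ * ‖v‖ + ρ * ‖w - w'‖ * ‖v‖ := by
          refine (norm_add_le _ _).trans (add_le_add ?_ ?_)
          · refine (ContinuousLinearMap.le_of_opNorm_le _ hX _).trans ?_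
            gcongr
            exact norm_fst_le v
          · refine (ContinuousLinearMap.le_of_opNorm_le _ hY _).trans ?_
            gcongr
            exact norm_snd_le v
      _ = _ := by ring

/-- Strong convexity bounds growth from below and the Lipschitz gradient bounds it from above;
comparing them needs a nonzero vector, hence `1 ≤ d`. -/
theorem InnerAssumption.modulus_le {G : Joint p d → ℝ} {μg : ℝ} {Lg ρ τ : ℝ≥0} (hd : 1 ≤ d)
    (h : InnerAssumption G μg Lg ρ τ) : μg ≤ Lg := by
  have : Nonempty (Fin d) := ⟨⟨0, hd⟩⟩
  refine strongConvex_modulus_le (fun y => hasGradientAt_right h.differentiable 0 y)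
    (h.strongConvex 0) fun y z => ?_
  rw [← WithLp.sub_snd]
  refine (norm_snd_le _).trans ?_
  have := h.lipschitz_grad.dist_le_mul (pt 0 y) (pt 0 z)
  rwa [dist_eq_norm, dist_eq_norm, norm_pt_sub_right] at this

end PZOBO

/-! ### Recursions for the inner iterates and their Jacobians -/

namespace PZOBO

variable {p d : ℕ}

/-- Relations between the constants of the inner recursion: step size `α`, Lipschitz constant `L`,
contraction factor `r`, Lipschitz constant `κ` of the derivative, and the bound `Λ` on the
Jacobians. -/
structure Consts (α L r κ Λ : ℝ) : Prop where
  α_nonneg : 0 ≤ α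
  L_nonneg : 0 ≤ L
  r_nonneg : 0 ≤ r
  r_lt_one : r < 1
  κ_nonneg : 0 ≤ κ
  Λ_nonneg : 0 ≤ Λ
  Λ_eq : r * Λ + α * L = Λ

variable {α L r κ Λ : ℝ}

theorem le_div_of_le_mul_add {e r c : ℝ} (hr : r < 1) (h : e ≤ r * e + c) : e ≤ c / (1 - r) := by
  rw [le_div_iff₀ (by linarith)]
  linarith

/-- By `Λ_eq`, `α L = (1 - r) Λ`, so absorbing `r * e` on the left leaves exactly `Λ`. -/
theorem Consts.le_Λ_mul (hc : Consts α L r κ Λ) {e t : ℝ} (h : e ≤ r * e + α * L * t) :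
    e ≤ Λ * t := by
  have h1 : (1 - r) * e ≤ (1 - r) * (Λ * t) := by
    have : α * L = (1 - r) * Λ := by linarith [hc.Λ_eq]
    rw [this] at h
    linarith
  exact le_of_mul_le_mul_left h1 (by linarith [hc.r_lt_one])

/-- The constant of the quadratic remainder of the inner iterates. -/
def taylorConst (α r κ Λ : ℝ) : ℝ := α * κ * (1 + Λ) ^ 2 / (1 - r)

theorem Consts.taylorConst_nonneg (hc : Consts α L r κ Λ) : 0 ≤ taylorConst α r κ Λ := by
  have := hc.α_nonneg
  have := hc.κ_nonneg
  have := hc.r_lt_one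
  unfold taylorConst
  have : 0 ≤ 1 - r := by linarith
  positivity

/-- The constant is the fixed point of the remainder recursion, so each step reproduces the same
bound and no dependence on `N` accumulates. -/
theorem Consts.taylorConst_eq (hc : Consts α L r κ Λ) :
    r * taylorConst α r κ Λ + α * κ * (1 + Λ) ^ 2 = taylorConst α r κ Λ := by
  have : 1 - r ≠ 0 := by linarith [hc.r_lt_one]
  unfold taylorConst
  field_simp
  ring

/-- The effect of a gradient step on the Jacobian of the iterate. -/
def jacStep (A : Joint p d → Vec d) (α : ℝ) (w : Joint p d) (J : Vec p →L[ℝ] Vec d) :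
    Vec p →L[ℝ] Vec d :=
  (ContinuousLinearMap.id ℝ (Vec d) - α • DY A w).comp J - α • DX A w

section Step

variable {A : Joint p d → Vec d}

/-- The two variables are moved one at a time: `y` at fixed `x'`, where the step contracts, and `x`
at fixed `y`, where only Lipschitz continuity is available. -/
theorem Reg.step_lip (hA : Reg A α L r κ) (hα : 0 ≤ α) (x x' : Vec p) (y y' : Vec d) :
    ‖(y' - α • A (pt x' y')) - (y - α • A (pt x y))‖ ≤ r * ‖y' - y‖ + α * L * ‖x' - x‖ := by
  have e : (y' - α • A (pt x' y')) - (y - α • A (pt x y))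
      = ((y' - α • A (pt x' y')) - (y - α • A (pt x' y))) - α • (A (pt x' y) - A (pt x y)) := by
    module
  rw [e]
  refine (norm_sub_le _ _).trans (add_le_add (hA.contr x' y' y) ?_)
  rw [norm_smul, Real.norm_of_nonneg hα, mul_assoc]
  gcongr
  simpa [norm_pt_sub_left] using hA.lip (pt x' y) (pt x y)

theorem Reg.norm_jacStep_le (hA : Reg A α L r κ) (hc : Consts α L r κ Λ) (w : Joint p d)
    (J : Vec p →L[ℝ] Vec d) : ‖jacStep A α w J‖ ≤ r * ‖J‖ + α * L := by
  refine (norm_sub_le _ _).trans (add_le_add ?_ ?_)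
  · refine (ContinuousLinearMap.opNorm_comp_le _ _).trans ?_
    gcongr
    exact hA.norm_step_le hc.r_nonneg w
  · rw [norm_smul, Real.norm_of_nonneg hc.α_nonneg]
    exact mul_le_mul_of_nonneg_left (hA.norm_DX_le hc.L_nonneg w) hc.α_nonneg

theorem Reg.norm_jacStep_le_Λ (hA : Reg A α L r κ) (hc : Consts α L r κ Λ) (w : Joint p d)
    {J : Vec p →L[ℝ] Vec d} (hJ : ‖J‖ ≤ Λ) : ‖jacStep A α w J‖ ≤ Λ := by
  refine (hA.norm_jacStep_le hc w J).trans ?_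
  have := mul_le_mul_of_nonneg_left hJ hc.r_nonneg
  linarith [hc.Λ_eq]

/-- The step is affine in the Jacobian. Its linear part contracts `J - J'`, and the change of its
coefficients between `w` and `w'` acts on `J'`, whose bound `Λ` produces the factor `1 + Λ`. -/
theorem Reg.jacStep_sub_le (hA : Reg A α L r κ) (hc : Consts α L r κ Λ) (w w' : Joint p d)
    (J : Vec p →L[ℝ] Vec d) {J' : Vec p →L[ℝ] Vec d} (hJ' : ‖J'‖ ≤ Λ) :
    ‖jacStep A α w J - jacStep A α w' J'‖ ≤ r * ‖J - J'‖ + α * κ * (1 + Λ) * ‖w - w'‖ := by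
  have e : jacStep A α w J - jacStep A α w' J'
      = (ContinuousLinearMap.id ℝ (Vec d) - α • DY A w).comp (J - J')
        - α • ((DY A w - DY A w').comp J' + (DX A w - DX A w')) := by
    ext1 v
    simp only [jacStep, sub_apply, smul_apply, add_apply, ContinuousLinearMap.comp_apply,
      ContinuousLinearMap.id_apply, map_sub]
    module
  have hα := hc.α_nonneg
  have hD := hA.lipD w w'
  have hDY := (DY_sub_apply_norm_le A A w w').trans hD
  have hDX := (DX_sub_apply_norm_le A A w w').trans hD
  rw [e]
  refine (norm_sub_le _ _).trans (add_le_add ?_ ?_)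
  · refine (ContinuousLinearMap.opNorm_comp_le _ _).trans ?_
    gcongr
    exact hA.norm_step_le hc.r_nonneg w
  · rw [norm_smul, Real.norm_of_nonneg hα]
    have h1 : ‖(DY A w - DY A w').comp J'‖ ≤ κ * ‖w - w'‖ * Λ :=
      (ContinuousLinearMap.opNorm_comp_le _ _).trans
        (mul_le_mul hDY hJ' (norm_nonneg _) ((norm_nonneg _).trans hDY))
    calc _ ≤ α * (κ * ‖w - w'‖ * Λ + κ * ‖w - w'‖) := by
          gcongr
          exact (norm_add_le _ _).trans (add_le_add h1 hDX)
      _ = _ := by ring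

/-- The new remainder is the contracting derivative applied to the old one, minus `α` times the
Taylor remainder of `A` at `w`. The hypothesis on `y' - y` bounds the increment of `w` by `(1 +
Λ)‖h‖`. -/
theorem Reg.jacStep_taylor (hA : Reg A α L r κ) (hc : Consts α L r κ Λ) (x h : Vec p)
    (y y' : Vec d) (J : Vec p →L[ℝ] Vec d) (hy : ‖y' - y‖ ≤ Λ * ‖h‖) :
    ‖(y' - α • A (pt (x + h) y')) - (y - α • A (pt x y)) - jacStep A α (pt x y) J h‖
      ≤ r * ‖y' - y - J h‖ + α * κ * (1 + Λ) ^ 2 * ‖h‖ ^ 2 := by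
  have hα := hc.α_nonneg
  have hκ := hc.κ_nonneg
  set w := pt x y
  set w' := pt (x + h) y'
  have hw : w' - w = pt h (y' - y) := by
    change pt (x + h) y' - pt x y = _
    rw [pt_sub, add_sub_cancel_left]
  have e : (y' - α • A w') - (y - α • A w) - jacStep A α w J h
      = (ContinuousLinearMap.id ℝ (Vec d) - α • DY A w) (y' - y - J h)
        - α • (A w' - A w - fderiv ℝ A w (w' - w)) := by
    rw [hw, fderiv_pt]
    simp only [jacStep, sub_apply, smul_apply, ContinuousLinearMap.comp_apply,
      ContinuousLinearMap.id_apply, map_sub]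
    module
  rw [e]
  refine (norm_sub_le _ _).trans (add_le_add ?_ ?_)
  · exact ContinuousLinearMap.le_of_opNorm_le _ (hA.norm_step_le hc.r_nonneg w) _
  · rw [norm_smul, Real.norm_of_nonneg hα]
    have h1 := norm_sub_fderiv_le hκ hA.diff hA.lipD w w'
    have h2 : ‖w' - w‖ ≤ (1 + Λ) * ‖h‖ := by
      rw [hw]
      exact (norm_pt_le _ _).trans (by linarith)
    calc _ ≤ α * (κ * ((1 + Λ) * ‖h‖) ^ 2) := by
          gcongr
          exact h1.trans (by gcongr)
      _ = _ := by ring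

/-- The Jacobian recursion at a fixed point `w` has a fixed point. -/
theorem Reg.exists_jacStep_fixed (hA : Reg A α L r κ) (hc : Consts α L r κ Λ) (w : Joint p d) :
    ∃ J : Vec p →L[ℝ] Vec d, jacStep A α w J = J := by
  have hcon : ContractingWith ⟨r, hc.r_nonneg⟩ (jacStep A α w) := by
    refine ⟨by exact_mod_cast hc.r_lt_one, LipschitzWith.of_dist_le_mul fun J J' => ?_⟩
    rw [dist_eq_norm, dist_eq_norm]
    have e : jacStep A α w J - jacStep A α w J'
        = (ContinuousLinearMap.id ℝ (Vec d) - α • DY A w).comp (J - J') := by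
      ext1 v
      simp only [jacStep, sub_apply, smul_apply, ContinuousLinearMap.comp_apply,
        ContinuousLinearMap.id_apply, map_sub]
      module
    rw [e]
    refine (ContinuousLinearMap.opNorm_comp_le _ _).trans ?_
    gcongr
    exact hA.norm_step_le hc.r_nonneg w
  exact ⟨ContractingWith.fixedPoint _ hcon, hcon.fixedPoint_isFixedPt⟩

/-- For each `x` the equation `A(x, y) = 0` has a solution. -/
theorem Reg.exists_zero (hA : Reg A α L r κ) (hc : Consts α L r κ Λ) (hα : α ≠ 0) (x : Vec p) :
    ∃ y, A (pt x y) = 0 := by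
  have hcon : ContractingWith ⟨r, hc.r_nonneg⟩ (fun y => y - α • A (pt x y)) := by
    refine ⟨by exact_mod_cast hc.r_lt_one, LipschitzWith.of_dist_le_mul fun y y' => ?_⟩
    rw [dist_eq_norm, dist_eq_norm]
    exact hA.contr x y y'
  refine ⟨ContractingWith.fixedPoint _ hcon, ?_⟩
  have h := hcon.fixedPoint_isFixedPt
  simpa [Function.IsFixedPt, hα] using h

/-- A choice of Jacobian of the solution map at `w = (x, y*(x))`. -/
def jacStar (A : Joint p d → Vec d) (α : ℝ) (w : Joint p d) : Vec p →L[ℝ] Vec d :=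
  Classical.epsilon fun J => jacStep A α w J = J

theorem Reg.jacStep_jacStar (hA : Reg A α L r κ) (hc : Consts α L r κ Λ) (w : Joint p d) :
    jacStep A α w (jacStar A α w) = jacStar A α w :=
  Classical.epsilon_spec (hA.exists_jacStep_fixed hc w)

theorem Reg.norm_jacStar_le (hA : Reg A α L r κ) (hc : Consts α L r κ Λ) (w : Joint p d) :
    ‖jacStar A α w‖ ≤ Λ := by
  have h := hA.norm_jacStep_le hc w (jacStar A α w)
  rw [hA.jacStep_jacStar hc] at h
  simpa using hc.le_Λ_mul (t := 1) (by simpa using h)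

theorem Reg.solution_lip (hA : Reg A α L r κ) (hc : Consts α L r κ Λ) {x x' : Vec p}
    {y y' : Vec d} (hy : A (pt x y) = 0) (hy' : A (pt x' y') = 0) :
    ‖y' - y‖ ≤ Λ * ‖x' - x‖ := by
  have h := hA.step_lip hc.α_nonneg x x' y y'
  rw [hy, hy', smul_zero, sub_zero, sub_zero] at h
  exact hc.le_Λ_mul h

/-- Solutions are fixed points of the gradient step and `jacStar` is a fixed point of `jacStep`, so
`Reg.jacStep_taylor` bounds the remainder by `r` times itself plus a quadratic term. This
differentiates the solution map without inverting the Hessian. -/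
theorem Reg.solution_taylor (hA : Reg A α L r κ) (hc : Consts α L r κ Λ) {x h : Vec p}
    {y y' : Vec d} (hy : A (pt x y) = 0) (hy' : A (pt (x + h) y') = 0) :
    ‖y' - y - jacStar A α (pt x y) h‖ ≤ taylorConst α r κ Λ * ‖h‖ ^ 2 := by
  have h1 := hA.solution_lip hc hy hy'
  rw [add_sub_cancel_left] at h1
  have h2 := hA.jacStep_taylor hc x h y y' (jacStar A α (pt x y)) h1
  rw [hy, hy', smul_zero, sub_zero, sub_zero, hA.jacStep_jacStar hc] at h2
  refine (le_div_of_le_mul_add hc.r_lt_one h2).trans_eq ?_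
  unfold taylorConst
  ring

end Step

/-! ### Inner iterates along a sequence of batches -/

section Trajectory

variable {X : Type*}

/-- The iterates of `y ↦ y - α a_t(x, y)`, where the step `t` uses the map `a (s t)`. -/
def traj (a : X → Joint p d → Vec d) (α : ℝ) (y₀ : Vec d) (x : Vec p) :
    (N : ℕ) → (Fin N → X) → Vec d
  | 0, _ => y₀
  | N + 1, s =>
    traj a α y₀ x N (fun t => s t.castSucc)
      - α • a (s (Fin.last N)) (pt x (traj a α y₀ x N (fun t => s t.castSucc)))

/-- The Jacobians (in `x`) of the iterates `traj`. -/
def jac (a : X → Joint p d → Vec d) (α : ℝ) (y₀ : Vec d) (x : Vec p) :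
    (N : ℕ) → (Fin N → X) → Vec p →L[ℝ] Vec d
  | 0, _ => 0
  | N + 1, s =>
    jacStep (a (s (Fin.last N))) α (pt x (traj a α y₀ x N (fun t => s t.castSucc)))
      (jac a α y₀ x N (fun t => s t.castSucc))

/-- The Jacobian recursion with all derivatives evaluated at the same point `w`. -/
def jacFrozen (a : X → Joint p d → Vec d) (α : ℝ) (w : Joint p d) :
    (N : ℕ) → (Fin N → X) → Vec p →L[ℝ] Vec d
  | 0, _ => 0
  | N + 1, s => jacStep (a (s (Fin.last N))) α w (jacFrozen a α w N (fun t => s t.castSucc))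

variable {a : X → Joint p d → Vec d}

/-- The initial point does not depend on `x`, and `r Λ + α L = Λ` makes the bound `Λ` reproduce
itself, uniformly in `N`. -/
theorem traj_lip (ha : ∀ i, Reg (a i) α L r κ) (hc : Consts α L r κ Λ) (y₀ : Vec d) (x x' : Vec p) :
    ∀ (N : ℕ) (s : Fin N → X), ‖traj a α y₀ x' N s - traj a α y₀ x N s‖ ≤ Λ * ‖x' - x‖
  | 0, s => by
    simpa [traj] using mul_nonneg hc.Λ_nonneg (norm_nonneg (x' - x))
  | N + 1, s => by
    refine ((ha _).step_lip hc.α_nonneg x x' _ _).trans ?_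
    have h1 := mul_le_mul_of_nonneg_left
      (traj_lip ha hc y₀ x x' N (fun t => s t.castSucc)) hc.r_nonneg
    calc _ ≤ r * (Λ * ‖x' - x‖) + α * L * ‖x' - x‖ := by gcongr
      _ = (r * Λ + α * L) * ‖x' - x‖ := by ring
      _ = _ := by rw [hc.Λ_eq]

theorem norm_jac_le (ha : ∀ i, Reg (a i) α L r κ) (hc : Consts α L r κ Λ) (y₀ : Vec d) (x : Vec p) :
    ∀ (N : ℕ) (s : Fin N → X), ‖jac a α y₀ x N s‖ ≤ Λ
  | 0, s => by simpa [jac] using hc.Λ_nonneg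
  | N + 1, s => (ha _).norm_jacStep_le_Λ hc _ (norm_jac_le ha hc y₀ x N _)

theorem norm_jacFrozen_le (ha : ∀ i, Reg (a i) α L r κ) (hc : Consts α L r κ Λ) (w : Joint p d) :
    ∀ (N : ℕ) (s : Fin N → X), ‖jacFrozen a α w N s‖ ≤ Λ
  | 0, s => by simpa [jacFrozen] using hc.Λ_nonneg
  | N + 1, s => (ha _).norm_jacStep_le_Λ hc _ (norm_jacFrozen_le ha hc w N _)

/-- The linearization of the iterates has a quadratic remainder. -/
theorem traj_taylor (ha : ∀ i, Reg (a i) α L r κ) (hc : Consts α L r κ Λ) (y₀ : Vec d)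
    (x h : Vec p) : ∀ (N : ℕ) (s : Fin N → X),
      ‖traj a α y₀ (x + h) N s - traj a α y₀ x N s - jac a α y₀ x N s h‖
        ≤ taylorConst α r κ Λ * ‖h‖ ^ 2
  | 0, s => by
    simpa [traj, jac] using mul_nonneg hc.taylorConst_nonneg (sq_nonneg ‖h‖)
  | N + 1, s => by
    have h1 := traj_lip ha hc y₀ x (x + h) N (fun t => s t.castSucc)
    rw [add_sub_cancel_left] at h1
    refine ((ha (s (Fin.last N))).jacStep_taylor hc x h _ _ _ h1).trans ?_
    have h2 := mul_le_mul_of_nonneg_left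
      (traj_taylor ha hc y₀ x h N (fun t => s t.castSucc)) hc.r_nonneg
    calc _ ≤ r * (taylorConst α r κ Λ * ‖h‖ ^ 2) + α * κ * (1 + Λ) ^ 2 * ‖h‖ ^ 2 := by gcongr
      _ = (r * taylorConst α r κ Λ + α * κ * (1 + Λ) ^ 2) * ‖h‖ ^ 2 := by ring
      _ = _ := by rw [hc.taylorConst_eq]

/-- One step of the distance to a point `y`. -/
theorem traj_succ_sub_le (ha : ∀ i, Reg (a i) α L r κ) (hc : Consts α L r κ Λ) (y₀ y : Vec d)
    (x : Vec p) (N : ℕ) (s : Fin (N + 1) → X) :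
    ‖traj a α y₀ x (N + 1) s - y‖ ≤ r * ‖traj a α y₀ x N (fun t => s t.castSucc) - y‖
      + α * ‖a (s (Fin.last N)) (pt x y)‖ := by
  rw [traj]
  set z := traj a α y₀ x N (fun t => s t.castSucc)
  have e : z - α • a (s (Fin.last N)) (pt x z) - y
      = ((z - α • a (s (Fin.last N)) (pt x z)) - (y - α • a (s (Fin.last N)) (pt x y)))
        - α • a (s (Fin.last N)) (pt x y) := by abel
  rw [e]
  refine (norm_sub_le _ _).trans (add_le_add ((ha _).contr x z y) ?_)
  rw [norm_smul, Real.norm_of_nonneg hc.α_nonneg]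

/-- One step of the distance between the Jacobians and their frozen versions. -/
theorem jac_succ_sub_le (ha : ∀ i, Reg (a i) α L r κ) (hc : Consts α L r κ Λ) (y₀ y : Vec d)
    (x : Vec p) (N : ℕ) (s : Fin (N + 1) → X) :
    ‖jac a α y₀ x (N + 1) s - jacFrozen a α (pt x y) (N + 1) s‖
      ≤ r * ‖jac a α y₀ x N (fun t => s t.castSucc)
          - jacFrozen a α (pt x y) N (fun t => s t.castSucc)‖
        + α * κ * (1 + Λ) * ‖traj a α y₀ x N (fun t => s t.castSucc) - y‖ := by
  refine ((ha (s (Fin.last N))).jacStep_sub_le hc _ _ _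
    (norm_jacFrozen_le ha hc (pt x y) N _)).trans_eq ?_
  rw [norm_pt_sub_right]

theorem continuous_traj (ha : ∀ i, Reg (a i) α L r κ) (hc : Consts α L r κ Λ) (y₀ : Vec d)
    (N : ℕ) (s : Fin N → X) : Continuous fun x : Vec p => traj a α y₀ x N s := by
  refine LipschitzWith.continuous (K := ⟨Λ, hc.Λ_nonneg⟩)
    (LipschitzWith.of_dist_le_mul fun x x' => ?_)
  rw [dist_eq_norm, dist_eq_norm]
  exact traj_lip ha hc y₀ x' x N s

end Trajectory

end PZOBO

/-! ### Expectations over independent inner batches -/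

namespace PZOBO

variable {p d : ℕ} {α L r κ Λ : ℝ}

section Split

variable {X : Type*} [MeasurableSpace X] {E : Type*} [NormedAddCommGroup E] [NormedSpace ℝ E]

/-- Splitting off the last coordinate of a product measure. -/
theorem integral_pi_last (ν : Measure X) [SigmaFinite ν] (N : ℕ) (ψ : X → (Fin N → X) → E) :
    ∫ s, ψ (s (Fin.last N)) (fun t => s t.castSucc) ∂(Measure.pi fun _ : Fin (N + 1) => ν)
      = ∫ z, ψ z.1 z.2 ∂(ν.prod (Measure.pi fun _ : Fin N => ν)) := by
  rw [← (measurePreserving_piFinSuccAbove (fun _ : Fin (N + 1) => ν) (Fin.last N)).integral_comp']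
  refine integral_congr_ae (Filter.Eventually.of_forall fun s => ?_)
  simp only [MeasurableEquiv.piFinSuccAbove, MeasurableEquiv.coe_mk, Fin.insertNthEquiv,
    Equiv.coe_fn_symm_mk]
  congr 1
  funext t
  simp [Fin.removeNth]

variable [CompleteSpace E] [Finite X] [MeasurableSingletonClass X]

theorem integral_pi_last_comp_castSucc (ν : Measure X) [IsProbabilityMeasure ν] (N : ℕ)
    (ψ : (Fin N → X) → E) :
    ∫ s, ψ (fun t => s t.castSucc) ∂(Measure.pi fun _ : Fin (N + 1) => ν)
      = ∫ s, ψ s ∂(Measure.pi fun _ : Fin N => ν) := by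
  rw [integral_pi_last ν N fun _ b => ψ b]
  rw [integral_prod _ Integrable.of_finite]
  simp

theorem integral_pi_last_comp_last (ν : Measure X) [IsProbabilityMeasure ν] (N : ℕ) (ψ : X → E) :
    ∫ s, ψ (s (Fin.last N)) ∂(Measure.pi fun _ : Fin (N + 1) => ν) = ∫ i, ψ i ∂ν := by
  rw [integral_pi_last ν N fun b _ => ψ b]
  rw [integral_prod _ Integrable.of_finite]
  simp

end Split

section IntegralComp

variable {X : Type*} [MeasurableSpace X] {ν : Measure X} {E F H : Type*} [NormedAddCommGroup E]
  [NormedSpace ℝ E] [NormedAddCommGroup F] [NormedSpace ℝ F] [NormedAddCommGroup H]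
  [NormedSpace ℝ H] [CompleteSpace H]

theorem integral_comp_left [CompleteSpace F] (T : F →L[ℝ] H) {φ : X → E →L[ℝ] F} (hφ : Integrable φ ν) :
    ∫ i, T.comp (φ i) ∂ν = T.comp (∫ i, φ i ∂ν) :=
  (ContinuousLinearMap.compL ℝ E F H T).integral_comp_comm hφ

theorem integral_comp_right (T : E →L[ℝ] F) {φ : X → F →L[ℝ] H} (hφ : Integrable φ ν) :
    ∫ i, (φ i).comp T ∂ν = (∫ i, φ i ∂ν).comp T :=
  ((ContinuousLinearMap.compL ℝ E F H).flip T).integral_comp_comm hφ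

end IntegralComp

section Expectation

variable {X : Type*} [MeasurableSpace X] [Finite X] [MeasurableSingletonClass X]
  (ν : Measure X) [IsProbabilityMeasure ν] {a : X → Joint p d → Vec d}

/-- The expected distance of the iterates to `y`. -/
theorem integral_norm_traj_sub_le (ha : ∀ i, Reg (a i) α L r κ) (hc : Consts α L r κ Λ)
    (y₀ y : Vec d) (x : Vec p) {b : ℝ} (hb : ∫ i, ‖a i (pt x y)‖ ∂ν ≤ b) (N : ℕ) :
    ∫ s, ‖traj a α y₀ x N s - y‖ ∂(Measure.pi fun _ : Fin N => ν)
      ≤ r ^ N * ‖y₀ - y‖ + α * b / (1 - r) := by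
  have hr := hc.r_lt_one
  have hα := hc.α_nonneg
  have hb0 : 0 ≤ b := (integral_nonneg fun i => norm_nonneg _).trans hb
  induction N with
  | zero =>
    have : 0 ≤ α * b / (1 - r) := div_nonneg (by positivity) (by linarith)
    simpa [traj] using this
  | succ N ih =>
    calc _ ≤ ∫ s, (r * ‖traj a α y₀ x N (fun t => s t.castSucc) - y‖
            + α * ‖a (s (Fin.last N)) (pt x y)‖) ∂(Measure.pi fun _ : Fin (N + 1) => ν) :=
          integral_mono Integrable.of_finite Integrable.of_finite
            fun s => traj_succ_sub_le ha hc y₀ y x N s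
      _ = r * ∫ s, ‖traj a α y₀ x N s - y‖ ∂(Measure.pi fun _ : Fin N => ν)
            + α * ∫ i, ‖a i (pt x y)‖ ∂ν := by
          rw [integral_add Integrable.of_finite Integrable.of_finite, integral_const_mul,
            integral_const_mul, integral_pi_last_comp_castSucc ν N fun s => ‖traj a α y₀ x N s - y‖,
            integral_pi_last_comp_last ν N fun i => ‖a i (pt x y)‖]
      _ ≤ r * (r ^ N * ‖y₀ - y‖ + α * b / (1 - r)) + α * b := by
          have := hc.r_nonneg
          gcongr
      _ = _ := by
          have : 1 - r ≠ 0 := by linarith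
          field_simp
          ring

/-- The expected distance of the Jacobians to their frozen versions. -/
theorem integral_norm_jac_sub_le (ha : ∀ i, Reg (a i) α L r κ) (hc : Consts α L r κ Λ)
    (y₀ y : Vec d) (x : Vec p) {b c' : ℝ} (hb : ∫ i, ‖a i (pt x y)‖ ∂ν ≤ b)
    (hc' : α * κ * (1 + Λ) = r * c') (N : ℕ) :
    ∫ s, ‖jac a α y₀ x N s - jacFrozen a α (pt x y) N s‖ ∂(Measure.pi fun _ : Fin N => ν)
      ≤ c' * ‖y₀ - y‖ * (N * r ^ N) + r * c' * (α * b / (1 - r)) / (1 - r) := by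
  have hr := hc.r_lt_one
  have hα := hc.α_nonneg
  have hb0 : 0 ≤ b := (integral_nonneg fun i => norm_nonneg _).trans hb
  have hrc : 0 ≤ r * c' := by
    have := hc.κ_nonneg
    have := hc.Λ_nonneg
    rw [← hc']
    positivity
  have hs0 : 0 ≤ α * b / (1 - r) := div_nonneg (by positivity) (by linarith)
  induction N with
  | zero =>
    have : 0 ≤ r * c' * (α * b / (1 - r)) / (1 - r) :=
      div_nonneg (mul_nonneg hrc hs0) (by linarith)
    simpa [jac, jacFrozen] using this
  | succ N ih =>
    calc _ ≤ ∫ s, (r * ‖jac a α y₀ x N (fun t => s t.castSucc)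
              - jacFrozen a α (pt x y) N (fun t => s t.castSucc)‖
            + α * κ * (1 + Λ) * ‖traj a α y₀ x N (fun t => s t.castSucc) - y‖)
            ∂(Measure.pi fun _ : Fin (N + 1) => ν) :=
          integral_mono Integrable.of_finite Integrable.of_finite
            fun s => jac_succ_sub_le ha hc y₀ y x N s
      _ = r * ∫ s, ‖jac a α y₀ x N s - jacFrozen a α (pt x y) N s‖ ∂(Measure.pi fun _ : Fin N => ν)
            + r * c' * ∫ s, ‖traj a α y₀ x N s - y‖ ∂(Measure.pi fun _ : Fin N => ν) := by
          rw [integral_add Integrable.of_finite Integrable.of_finite, integral_const_mul,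
            integral_const_mul, integral_pi_last_comp_castSucc ν N fun s => ‖traj a α y₀ x N s - y‖,
            integral_pi_last_comp_castSucc ν N
              fun s => ‖jac a α y₀ x N s - jacFrozen a α (pt x y) N s‖, hc']
      -- Writing `ακ(1+Λ)` as `r * c'` makes the forcing term carry `r^(N+1)`, the same power as the
      -- contracted term; the coefficients add up to `N + 1`.
      _ ≤ r * (c' * ‖y₀ - y‖ * (N * r ^ N) + r * c' * (α * b / (1 - r)) / (1 - r))
            + r * c' * (r ^ N * ‖y₀ - y‖ + α * b / (1 - r)) := by
          have := hc.r_nonneg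
          gcongr
          exact integral_norm_traj_sub_le ν ha hc y₀ y x hb N
      _ = _ := by
          have : 1 - r ≠ 0 := by linarith
          push_cast
          field_simp
          ring

/-- The expectation of the frozen Jacobian follows the averaged recursion, and so converges
geometrically to its fixed point. -/
theorem norm_integral_jacFrozen_sub_le (hc : Consts α L r κ Λ)
    {A : Joint p d → Vec d} (hA : Reg A α L r κ) {w : Joint p d}
    (hD : ∫ i, fderiv ℝ (a i) w ∂ν = fderiv ℝ A w) {J : Vec p →L[ℝ] Vec d}
    (hJ : jacStep A α w J = J) (N : ℕ) :
    ‖∫ s, jacFrozen a α w N s ∂(Measure.pi fun _ : Fin N => ν) - J‖ ≤ r ^ N * ‖J‖ := by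
  induction N with
  | zero => simp [jacFrozen]
  | succ N ih =>
    have hX : ∫ i, DX (a i) w ∂ν = DX A w := by
      simp only [DX]
      rw [integral_comp_right _ Integrable.of_finite, hD]
    have hY : ∫ i, DY (a i) w ∂ν = DY A w := by
      simp only [DY]
      rw [integral_comp_right _ Integrable.of_finite, hD]
    set I := ∫ s, jacFrozen a α w N s ∂(Measure.pi fun _ : Fin N => ν) with hI
    -- The coefficients of the last step depend only on the last batch, which is independent of the
    -- earlier Jacobian. As the step is affine in that Jacobian, expectation passes through and only
    -- the mean derivative `hD` is seen.
    have hstep : ∫ s, jacFrozen a α w (N + 1) s ∂(Measure.pi fun _ : Fin (N + 1) => ν)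
        = jacStep A α w I := by
      simp only [jacFrozen]
      rw [integral_pi_last ν N fun i b => jacStep (a i) α w (jacFrozen a α w N b),
        integral_prod _ Integrable.of_finite]
      have inner : ∀ i, ∫ b, jacStep (a i) α w (jacFrozen a α w N b)
          ∂(Measure.pi fun _ : Fin N => ν) = jacStep (a i) α w I := by
        intro i
        simp only [jacStep]
        rw [integral_sub Integrable.of_finite Integrable.of_finite, integral_const,
          integral_comp_left _ Integrable.of_finite]
        simp [hI]
      simp only [inner]
      simp only [jacStep]
      rw [integral_sub Integrable.of_finite Integrable.of_finite, integral_smul, hX,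
        integral_comp_right _ Integrable.of_finite,
        integral_sub Integrable.of_finite Integrable.of_finite, integral_smul, hY]
      simp
    rw [hstep]
    have e : jacStep A α w I - J
        = (ContinuousLinearMap.id ℝ (Vec d) - α • DY A w).comp (I - J) := by
      conv_lhs => rw [← hJ]
      ext1 v
      simp only [jacStep, sub_apply, smul_apply, ContinuousLinearMap.comp_apply,
        ContinuousLinearMap.id_apply, map_sub]
      module
    rw [e, pow_succ', mul_assoc]
    refine (ContinuousLinearMap.opNorm_comp_le _ _).trans ?_
    have h1 := hc.r_nonneg
    exact mul_le_mul (hA.norm_step_le h1 w) ih (norm_nonneg _) h1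

end Expectation

/-! ### Uniform indices and the `1/√S` noise of a batch mean -/

section Uniform

variable {E : Type*} [NormedAddCommGroup E]

/-- The law of a uniform index. -/
abbrev unif (m : ℕ) : Measure (Fin m) := uniformOn (Set.univ : Set (Fin m))

theorem isProbabilityMeasure_unif {m : ℕ} (hm : 1 ≤ m) : IsProbabilityMeasure (unif m) := by
  have : Nonempty (Fin m) := ⟨⟨0, hm⟩⟩
  exact isProbabilityMeasure_uniformOn Set.finite_univ Set.univ_nonempty

theorem integral_unif [NormedSpace ℝ E] [CompleteSpace E] {m : ℕ} (v : Fin m → E) :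
    ∫ i, v i ∂(unif m) = mean v := by
  rw [unif, uniformOn, ProbabilityTheory.cond, integral_smul_measure, Measure.restrict_univ,
    Measure.count_apply_finite _ Set.finite_univ, integral_count]
  simp [mean]

theorem integrable_eval {X : Type*} [MeasurableSpace X] {ν : Measure X} [IsProbabilityMeasure ν]
    {Q : ℕ} {φ : X → E} (hφ : Integrable φ ν) (j : Fin Q) :
    Integrable (fun u : Fin Q → X => φ (u j)) (Measure.pi fun _ : Fin Q => ν) :=
  (measurePreserving_eval (fun _ : Fin Q => ν) j).integrable_comp_of_integrable hφ

theorem integrable_mean_eval [NormedSpace ℝ E] {X : Type*} [MeasurableSpace X] {ν : Measure X}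
    [IsProbabilityMeasure ν] {Q : ℕ} {φ : X → E} (hφ : Integrable φ ν) :
    Integrable (fun u : Fin Q → X => mean fun j => φ (u j)) (Measure.pi fun _ : Fin Q => ν) :=
  (integrable_finsetSum _ fun j _ => integrable_eval hφ j).smul _

/-- The expectation of an empirical mean. -/
theorem integral_mean_eval [NormedSpace ℝ E] {X : Type*} [MeasurableSpace X]
    {ν : Measure X} [IsProbabilityMeasure ν] {Q : ℕ} (hQ : 1 ≤ Q) {φ : X → E}
    (hφ : Integrable φ ν) :
    ∫ u, mean (fun j => φ (u j)) ∂(Measure.pi fun _ : Fin Q => ν) = ∫ x, φ x ∂ν := by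
  have h : ∀ j : Fin Q, ∫ u : Fin Q → X, φ (u j) ∂(Measure.pi fun _ : Fin Q => ν)
      = ∫ x, φ x ∂ν := by
    intro j
    have hmp := measurePreserving_eval (fun _ : Fin Q => ν) j
    conv_rhs => rw [← hmp.map_eq]
    rw [integral_map hmp.measurable.aemeasurable (by rw [hmp.map_eq]; exact hφ.aestronglyMeasurable)]
  simp only [mean]
  rw [integral_smul, integral_finsetSum _ fun j _ => integrable_eval hφ j]
  simp only [h]
  exact mean_const hQ _

theorem integral_batch_mean [NormedSpace ℝ E] [CompleteSpace E] {m S : ℕ} (hm : 1 ≤ m)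
    (hS : 1 ≤ S) (v : Fin m → E) :
    ∫ s, mean (fun i => v (s i)) ∂(Measure.pi fun _ : Fin S => unif m) = mean v := by
  have := isProbabilityMeasure_unif hm
  rw [integral_mean_eval hS Integrable.of_finite, integral_unif]

/-- The second moment of a sum of i.i.d. centred vectors. -/
theorem integral_sq_norm_batch_sum [InnerProductSpace ℝ E] [CompleteSpace E] {m : ℕ}
    (hm : 1 ≤ m) {v : Fin m → E} (hv : mean v = 0) (S : ℕ) :
    ∫ s, ‖∑ i, v (s i)‖ ^ 2 ∂(Measure.pi fun _ : Fin S => unif m)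
      = S * mean fun j => ‖v j‖ ^ 2 := by
  have := isProbabilityMeasure_unif hm
  induction S with
  | zero => simp
  | succ S ih =>
    have e : ∀ s : Fin (S + 1) → Fin m, ‖∑ i, v (s i)‖ ^ 2
        = ‖∑ i : Fin S, v (s i.castSucc)‖ ^ 2
          + 2 * inner ℝ (∑ i : Fin S, v (s i.castSucc)) (v (s (Fin.last S)))
          + ‖v (s (Fin.last S))‖ ^ 2 := by
      intro s
      rw [Fin.sum_univ_castSucc, norm_add_sq_real]
    simp only [e]
    rw [integral_add Integrable.of_finite Integrable.of_finite,
      integral_add Integrable.of_finite Integrable.of_finite,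
      integral_pi_last_comp_castSucc (unif m) S fun s => ‖∑ i, v (s i)‖ ^ 2, ih,
      integral_pi_last_comp_last (unif m) S fun j => ‖v j‖ ^ 2, integral_unif,
      integral_const_mul,
      integral_pi_last (unif m) S fun j s => inner ℝ (∑ i : Fin S, v (s i)) (v j),
      integral_prod_symm _ Integrable.of_finite]
    -- Cross terms vanish: integrating the fresh index at fixed earlier ones gives the mean of `v`,
    -- which is zero.
    have h0 : ∀ s : Fin S → Fin m, ∫ j, inner ℝ (∑ i : Fin S, v (s i)) (v j) ∂(unif m) = 0 := by
      intro s
      rw [integral_inner Integrable.of_finite, integral_unif, hv, inner_zero_right]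
    simp only [h0]
    simp
    ring

/-- The mean of a batch of `S` i.i.d. centred vectors is of order `1 / √S`. -/
theorem integral_norm_batch_mean_le [InnerProductSpace ℝ E] [CompleteSpace E] {m S : ℕ}
    (hm : 1 ≤ m) (hS : 1 ≤ S) {v : Fin m → E} (hv : mean v = 0) {σ : ℝ}
    (hσ : (mean fun j => ‖v j‖ ^ 2) ≤ σ ^ 2) :
    ∫ s, ‖mean fun i => v (s i)‖ ∂(Measure.pi fun _ : Fin S => unif m) ≤ |σ| / √(S : ℝ) := by
  have := isProbabilityMeasure_unif hm
  have hS' : (0 : ℝ) < S := by exact_mod_cast hS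
  have h2 : ∫ s, ‖mean fun i => v (s i)‖ ^ 2 ∂(Measure.pi fun _ : Fin S => unif m)
      ≤ σ ^ 2 / S := by
    have e : ∀ s : Fin S → Fin m, ‖mean fun i => v (s i)‖ ^ 2
        = (1 / (S : ℝ)) ^ 2 * ‖∑ i, v (s i)‖ ^ 2 := by
      intro s
      rw [mean, norm_smul, mul_pow, Real.norm_of_nonneg (by positivity)]
    simp only [e]
    rw [integral_const_mul, integral_sq_norm_batch_sum hm hv]
    calc _ ≤ (1 / (S : ℝ)) ^ 2 * (S * σ ^ 2) := by gcongr
      _ = _ := by field_simp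
  -- Jensen's inequality for the square.
  have h3 : (∫ s, ‖mean fun i => v (s i)‖ ∂(Measure.pi fun _ : Fin S => unif m)) ^ 2
      ≤ ∫ s, ‖mean fun i => v (s i)‖ ^ 2 ∂(Measure.pi fun _ : Fin S => unif m) :=
    (convexOn_pow 2).map_integral_le (by fun_prop) isClosed_Ici
      (Filter.Eventually.of_forall fun s => norm_nonneg _) Integrable.of_finite
      Integrable.of_finite
  refine le_of_sq_le_sq (h3.trans (h2.trans_eq ?_)) (by positivity)
  rw [div_pow, sq_abs, Real.sq_sqrt hS'.le]

end Uniform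

end PZOBO

namespace PZOBO

/-! ### Gaussian moments and their dependence on the dimension -/

section Gaussian

variable {p : ℕ}

/-- The `k`-th moment of the standard Gaussian law on `ℝ`. -/
def gaussMoment (k : ℕ) : ℝ := ∫ z, z ^ k ∂(gaussianReal 0 1)

theorem integrable_norm_pow_stdGaussian (k : ℕ) :
    Integrable (fun u : Vec p => ‖u‖ ^ k) (stdGaussian (Vec p)) :=
  (IsGaussian.memLp_id (stdGaussian (Vec p)) k (by simp)).integrable_norm_pow'

/-- The projection on a unit vector is a standard real Gaussian, so its moments depend neither on
`p` nor on the vector. -/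
theorem integral_inner_pow_stdGaussian {e : Vec p} (he : ‖e‖ = 1) (k : ℕ) :
    ∫ u, (inner ℝ e u) ^ k ∂(stdGaussian (Vec p)) = gaussMoment k := by
  have h := IsGaussian.map_eq_gaussianReal (μ := stdGaussian (Vec p)) (innerSL ℝ e)
  rw [integral_strongDual_stdGaussian, variance_dual_stdGaussian, innerSL_apply_norm, he] at h
  have h1 : ((1 : ℝ) ^ 2).toNNReal = 1 := by simp
  rw [h1] at h
  rw [gaussMoment, ← h, integral_map (by fun_prop) (by fun_prop)]
  simp

theorem integrable_inner_pow_stdGaussian (e : Vec p) (k : ℕ) :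
    Integrable (fun u => (inner ℝ e u) ^ k) (stdGaussian (Vec p)) := by
  refine ((integrable_norm_pow_stdGaussian k).const_mul (‖e‖ ^ k)).mono' (by fun_prop)
    (Filter.Eventually.of_forall fun u => ?_)
  rw [norm_pow, ← mul_pow]
  gcongr
  exact norm_inner_le_norm e u

theorem gaussMoment_nonneg (k : ℕ) (hk : Even k) : 0 ≤ gaussMoment k :=
  integral_nonneg fun z => hk.pow_nonneg z

theorem integrable_inner_smul_stdGaussian (a : Vec p) :
    Integrable (fun u => (inner ℝ a u) • u) (stdGaussian (Vec p)) := by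
  refine ((integrable_norm_pow_stdGaussian 2).const_mul ‖a‖).mono' (by fun_prop)
    (Filter.Eventually.of_forall fun u => ?_)
  rw [norm_smul]
  calc _ ≤ ‖a‖ * ‖u‖ * ‖u‖ := by
        gcongr
        exact norm_inner_le_norm a u
    _ = _ := by ring

/-- The standard Gaussian law is isotropic. -/
theorem integral_inner_smul_stdGaussian (a : Vec p) :
    ∫ u, (inner ℝ a u) • u ∂(stdGaussian (Vec p)) = a := by
  refine ext_inner_left ℝ fun b => ?_
  rw [← integral_inner (integrable_inner_smul_stdGaussian a)]
  have h := covarianceBilin_apply (μ := stdGaussian (Vec p)) IsGaussian.memLp_two_id b a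
  simp only [covarianceBilin_stdGaussian, id_eq, integral_id_stdGaussian, sub_zero] at h
  change inner ℝ b a = _ at h
  rw [h]
  refine integral_congr_ae (Filter.Eventually.of_forall fun u => ?_)
  simp only [inner_smul_right]
  rw [mul_comm]

theorem norm_sq_eq_sum (u : Vec p) :
    ‖u‖ ^ 2 = ∑ i, (inner ℝ (EuclideanSpace.single i (1 : ℝ)) u) ^ 2 := by
  rw [EuclideanSpace.real_norm_sq_eq]
  refine Finset.sum_congr rfl fun i _ => ?_
  rw [EuclideanSpace.inner_single_left]
  simp

/-- The power mean inequality `(∑ zᵢ²)³ ≤ p² ∑ zᵢ⁶` reduces to `p` one-dimensional sixth moments. -/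
theorem integral_norm_pow_six_le :
    ∫ u, ‖u‖ ^ 6 ∂(stdGaussian (Vec p)) ≤ gaussMoment 6 * (p : ℝ) ^ 3 := by
  have h : ∀ u : Vec p, ‖u‖ ^ 6
      ≤ (p : ℝ) ^ 2 * ∑ i, (inner ℝ (EuclideanSpace.single i (1 : ℝ)) u) ^ 6 := by
    intro u
    rcases Nat.eq_zero_or_pos p with rfl | hp
    · simp [EuclideanSpace.norm_eq]
    have hp' : (0 : ℝ) < p := by exact_mod_cast hp
    have h1 := pow_sum_div_card_le_sum_pow (s := Finset.univ)
      (f := fun i : Fin p => (inner ℝ (EuclideanSpace.single i (1 : ℝ)) u) ^ 2)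
      (fun i _ => sq_nonneg _) 2
    rw [← norm_sq_eq_sum, Finset.card_univ, Fintype.card_fin, div_le_iff₀ (by positivity)] at h1
    simp only [← pow_mul] at h1
    norm_num at h1
    linarith
  calc _ ≤ ∫ u : Vec p, (p : ℝ) ^ 2 * ∑ i, (inner ℝ (EuclideanSpace.single i (1 : ℝ)) u) ^ 6
          ∂(stdGaussian (Vec p)) :=
        integral_mono (integrable_norm_pow_stdGaussian 6)
          ((integrable_finsetSum _ fun i _ => integrable_inner_pow_stdGaussian _ 6).const_mul _) h
    _ = _ := by
        rw [integral_const_mul, integral_finsetSum _ fun i _ => integrable_inner_pow_stdGaussian _ 6]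
        simp only [fun i : Fin p => integral_inner_pow_stdGaussian
          (e := EuclideanSpace.single i (1 : ℝ)) (by simp) 6]
        simp
        ring

theorem sq_integral_norm_pow_three_le :
    (∫ u, ‖u‖ ^ 3 ∂(stdGaussian (Vec p))) ^ 2 ≤ gaussMoment 6 * (p : ℝ) ^ 3 := by
  have h : (∫ u, ‖u‖ ^ 3 ∂(stdGaussian (Vec p))) ^ 2
      ≤ ∫ u, (‖u‖ ^ 3) ^ 2 ∂(stdGaussian (Vec p)) :=
    (convexOn_pow 2).map_integral_le (by fun_prop) isClosed_Ici
      (Filter.Eventually.of_forall fun u => by simp) (integrable_norm_pow_stdGaussian 3)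
      (by simpa [Function.comp_def, ← pow_mul] using integrable_norm_pow_stdGaussian (p := p) 6)
  refine h.trans ?_
  simp only [← pow_mul]
  exact integral_norm_pow_six_le

theorem integrable_inner_sq_mul_norm_sq (a : Vec p) :
    Integrable (fun u => (inner ℝ a u) ^ 2 * ‖u‖ ^ 2) (stdGaussian (Vec p)) := by
  refine ((integrable_norm_pow_stdGaussian 4).const_mul (‖a‖ ^ 2)).mono' (by fun_prop)
    (Filter.Eventually.of_forall fun u => ?_)
  rw [Real.norm_of_nonneg (by positivity)]
  have h1 : (inner ℝ a u : ℝ) ^ 2 ≤ (‖a‖ * ‖u‖) ^ 2 := by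
    rw [sq_le_sq, abs_of_nonneg (by positivity : 0 ≤ ‖a‖ * ‖u‖)]
    exact abs_real_inner_le_norm a u
  calc _ ≤ (‖a‖ * ‖u‖) ^ 2 * ‖u‖ ^ 2 := by gcongr
    _ = _ := by ring

/-- For a unit vector, `‖u‖²` is a sum of `p` squared coordinates, and each product of two squares
is at most half the sum of fourth powers. Growth linear in `p`, instead of the `p²` of `E‖u‖⁴`,
gives the rate `p/√K`. -/
theorem integral_inner_sq_mul_norm_sq_le (a : Vec p) :
    ∫ u, (inner ℝ a u) ^ 2 * ‖u‖ ^ 2 ∂(stdGaussian (Vec p)) ≤ gaussMoment 4 * p * ‖a‖ ^ 2 := by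
  have unit : ∀ e : Vec p, ‖e‖ = 1 →
      ∫ u, (inner ℝ e u) ^ 2 * ‖u‖ ^ 2 ∂(stdGaussian (Vec p)) ≤ gaussMoment 4 * p := by
    intro e he
    calc _ ≤ ∫ u : Vec p, ∑ i, ((inner ℝ e u) ^ 4
            + (inner ℝ (EuclideanSpace.single i (1 : ℝ)) u) ^ 4) / 2 ∂(stdGaussian (Vec p)) := by
          refine integral_mono (integrable_inner_sq_mul_norm_sq e)
            (integrable_finsetSum _ fun i _ => ((integrable_inner_pow_stdGaussian _ 4).add
              (integrable_inner_pow_stdGaussian _ 4)).div_const 2) fun u => ?_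
          simp only
          rw [norm_sq_eq_sum, Finset.mul_sum]
          refine Finset.sum_le_sum fun i _ => ?_
          nlinarith [sq_nonneg ((inner ℝ e u : ℝ) ^ 2
            - (inner ℝ (EuclideanSpace.single i (1 : ℝ)) u) ^ 2)]
      _ = _ := by
          rw [integral_finsetSum _ fun i _ => by
            exact ((integrable_inner_pow_stdGaussian _ 4).add
              (integrable_inner_pow_stdGaussian _ 4)).div_const 2]
          have hi : ∀ i : Fin p, ∫ u : Vec p, ((inner ℝ e u) ^ 4
              + (inner ℝ (EuclideanSpace.single i (1 : ℝ)) u) ^ 4) / 2 ∂(stdGaussian (Vec p))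
              = gaussMoment 4 := by
            intro i
            rw [integral_div, integral_add (integrable_inner_pow_stdGaussian _ 4)
              (integrable_inner_pow_stdGaussian _ 4), integral_inner_pow_stdGaussian he,
              integral_inner_pow_stdGaussian (by simp)]
            ring
          simp only [hi]
          simp
          ring
  by_cases ha : a = 0
  · simp [ha]
  · have hn : ‖a‖ ≠ 0 := by simpa using ha
    have h1 := unit (‖a‖⁻¹ • a) (by rw [norm_smul, norm_inv, norm_norm, inv_mul_cancel₀ hn])
    have e : ∀ u : Vec p, (inner ℝ a u) ^ 2 * ‖u‖ ^ 2
        = ‖a‖ ^ 2 * ((inner ℝ (‖a‖⁻¹ • a) u) ^ 2 * ‖u‖ ^ 2) := by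
      intro u
      rw [inner_smul_left]
      simp only [conj_trivial]
      field_simp
    simp only [e]
    rw [integral_const_mul]
    calc _ ≤ ‖a‖ ^ 2 * (gaussMoment 4 * p) := by gcongr
      _ = _ := by ring

end Gaussian

end PZOBO

/-! ### Outer functions, the inner solution map and smoothness of `Φ` -/

namespace PZOBO

variable {p d n m : ℕ}

section Outer

variable {M Lf : ℝ≥0}

theorem OuterAssumption.norm_gradient_le {h : Joint p d → ℝ} (hh : OuterAssumption h M Lf)
    (w : Joint p d) : ‖gradient h w‖ ≤ M := by
  rw [gradient, LinearIsometryEquiv.norm_map]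
  exact norm_fderiv_le_of_lipschitz ℝ hh.lipschitz

theorem OuterAssumption.gradient_lip {h : Joint p d → ℝ} (hh : OuterAssumption h M Lf)
    (w w' : Joint p d) : ‖gradient h w - gradient h w'‖ ≤ Lf * ‖w - w'‖ := by
  simpa [dist_eq_norm] using hh.lipschitz_grad.dist_le_mul w w'

theorem OuterAssumption.avg {k : ℕ} (hk : 1 ≤ k) {h : Fin k → Joint p d → ℝ}
    (hh : ∀ i, OuterAssumption (h i) M Lf) : OuterAssumption (avg h) M Lf where
  differentiable := differentiable_avg fun i => (hh i).differentiable
  lipschitz := LipschitzWith.of_dist_le_mul fun w w' => by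
    rw [dist_eq_norm, avg_eq_mean, avg_eq_mean, ← mean_sub]
    exact norm_mean_le hk fun i => by
      simpa [dist_eq_norm] using (hh i).lipschitz.dist_le_mul w w'
  lipschitz_grad := LipschitzWith.of_dist_le_mul fun w w' => by
    rw [dist_eq_norm, dist_eq_norm, gradient_avg fun i => (hh i).differentiable,
      gradient_avg fun i => (hh i).differentiable, ← mean_sub]
    exact norm_mean_le hk fun i => (hh i).gradient_lip w w'

variable {h : Joint p d → ℝ}

theorem OuterAssumption.norm_gradX_le (hh : OuterAssumption h M Lf) (x : Vec p) (y : Vec d) :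
    ‖gradX h x y‖ ≤ M := by
  rw [gradX_eq hh.differentiable]
  exact (norm_fst_le _).trans (hh.norm_gradient_le _)

theorem OuterAssumption.norm_gradY_le (hh : OuterAssumption h M Lf) (x : Vec p) (y : Vec d) :
    ‖gradY h x y‖ ≤ M := by
  rw [gradY_eq hh.differentiable]
  exact (norm_snd_le _).trans (hh.norm_gradient_le _)

theorem OuterAssumption.gradX_sub_le (hh : OuterAssumption h M Lf) (x : Vec p) (y y' : Vec d) :
    ‖gradX h x y - gradX h x y'‖ ≤ Lf * ‖y - y'‖ := by
  rw [gradX_eq hh.differentiable, gradX_eq hh.differentiable, ← WithLp.sub_fst,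
    ← norm_pt_sub_right x y y']
  exact (norm_fst_le _).trans (hh.gradient_lip _ _)

theorem OuterAssumption.gradY_sub_le (hh : OuterAssumption h M Lf) (x : Vec p) (y y' : Vec d) :
    ‖gradY h x y - gradY h x y'‖ ≤ Lf * ‖y - y'‖ := by
  rw [gradY_eq hh.differentiable, gradY_eq hh.differentiable, ← WithLp.sub_snd,
    ← norm_pt_sub_right x y y']
  exact (norm_snd_le _).trans (hh.gradient_lip _ _)

end Outer

theorem continuous_pt {T : Type*} [TopologicalSpace T] {f : T → Vec p} {g : T → Vec d}
    (hf : Continuous f) (hg : Continuous g) : Continuous fun t => pt (f t) (g t) := by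
  have h : (fun t => pt (f t) (g t)) = fun t => inlL (f t) + inrL (g t) :=
    funext fun t => pt_eq_add _ _
  rw [h]
  exact (inlL.continuous.comp hf).add (inrL.continuous.comp hg)

theorem OuterAssumption.continuous_gradX {M Lf : ℝ≥0} {h : Joint p d → ℝ}
    (hh : OuterAssumption h M Lf) {T : Type*} [TopologicalSpace T] {f : T → Vec p} {g : T → Vec d}
    (hf : Continuous f) (hg : Continuous g) : Continuous fun t => gradX h (f t) (g t) := by
  simp only [gradX_eq hh.differentiable]
  exact (WithLp.fstL 2 ℝ (Vec p) (Vec d)).continuous.comp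
    (hh.lipschitz_grad.continuous.comp (continuous_pt hf hg))

theorem OuterAssumption.continuous_gradY {M Lf : ℝ≥0} {h : Joint p d → ℝ}
    (hh : OuterAssumption h M Lf) {T : Type*} [TopologicalSpace T] {f : T → Vec p} {g : T → Vec d}
    (hf : Continuous f) (hg : Continuous g) : Continuous fun t => gradY h (f t) (g t) := by
  simp only [gradY_eq hh.differentiable]
  exact (WithLp.sndL 2 ℝ (Vec p) (Vec d)).continuous.comp
    (hh.lipschitz_grad.continuous.comp (continuous_pt hf hg))

/-- The expected derivative of a mini-batch mean is the derivative of the full mean. -/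
theorem integral_fderiv_batch_mean {E E' : Type*} [NormedAddCommGroup E] [NormedSpace ℝ E]
    [NormedAddCommGroup E'] [NormedSpace ℝ E'] [CompleteSpace E'] {S : ℕ} (hm : 1 ≤ m)
    (hS : 1 ≤ S) {A : Fin m → E → E'} (hA : ∀ j, Differentiable ℝ (A j)) (w : E) :
    ∫ s : Fin S → Fin m, fderiv ℝ (fun w => mean fun i => A (s i) w) w
      ∂(Measure.pi fun _ : Fin S => unif m) = fderiv ℝ (fun w => mean fun j => A j w) w := by
  rw [fderiv_mean hA, ← integral_batch_mean hm hS]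
  exact integral_congr_ae (Filter.Eventually.of_forall fun s => fderiv_mean (fun i => hA (s i)) w)

/-- The standing assumptions on a bilevel problem, together with the constants of the inner
recursion. -/
structure Setup (F : Fin n → Joint p d → ℝ) (G : Fin m → Joint p d → ℝ) (μg : ℝ)
    (Lf Lg M ρ τ : ℝ≥0) (α L r κ Λ σ : ℝ) : Prop where
  n_pos : 1 ≤ n
  m_pos : 1 ≤ m
  μg_pos : 0 < μg
  inner_assumption : ∀ j, InnerAssumption (G j) μg Lg ρ τ
  outer_assumption : ∀ i, OuterAssumption (F i) M Lf
  var : BoundedVariance G σ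
  α_pos : 0 < α
  reg : ∀ j, Reg (fun w : Joint p d => gradY (G j) w.fst w.snd) α L r κ
  consts : Consts α L r κ Λ

/-- The partial gradient `∇_y g` of the averaged inner objective. -/
def fullMap (G : Fin m → Joint p d → ℝ) (w : Joint p d) : Vec d :=
  mean fun j => gradY (G j) w.fst w.snd

/-- The partial gradient `∇_y G(·; s)` of a mini-batch objective. -/
def batchMap {S : ℕ} (G : Fin m → Joint p d → ℝ) (s : Fin S → Fin m) (w : Joint p d) : Vec d :=
  mean fun i => gradY (G (s i)) w.fst w.snd

/-- The Jacobian of the inner solution map. -/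
def solJac (G : Fin m → Joint p d → ℝ) (α : ℝ) (x : Vec p) : Vec p →L[ℝ] Vec d :=
  jacStar (fullMap G) α (pt x (innerSol (avg G) x))

/-- The hypergradient `∇Φ(x)`, in terms of the Jacobian of the inner solution map. -/
def hyperGrad (F : Fin n → Joint p d → ℝ) (G : Fin m → Joint p d → ℝ) (α : ℝ) (x : Vec p) :
    Vec p :=
  gradX (avg F) x (innerSol (avg G) x)
    + ContinuousLinearMap.adjoint (solJac G α x) (gradY (avg F) x (innerSol (avg G) x))

/-- The smoothness constant of the total objective. -/
def smoothConst (M Lf α r κ Λ : ℝ) : ℝ := Lf / 2 * (1 + Λ) ^ 2 + M * taylorConst α r κ Λ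

section SetupLemmas

variable {F : Fin n → Joint p d → ℝ} {G : Fin m → Joint p d → ℝ} {μg : ℝ}
  {Lf Lg M ρ τ : ℝ≥0} {α L r κ Λ σ : ℝ}

theorem Setup.reg_full (h : Setup F G μg Lf Lg M ρ τ α L r κ Λ σ) :
    Reg (fullMap G) α L r κ := Reg.mean h.m_pos h.reg

theorem Setup.reg_batch (h : Setup F G μg Lf Lg M ρ τ α L r κ Λ σ) {S : ℕ} (hS : 1 ≤ S)
    (s : Fin S → Fin m) : Reg (batchMap G s) α L r κ := Reg.mean hS fun i => h.reg (s i)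

theorem Setup.gradY_full (h : Setup F G μg Lf Lg M ρ τ α L r κ Λ σ) (x : Vec p) (y : Vec d) :
    gradY (avg G) x y = fullMap G (pt x y) :=
  gradY_avg (fun j => (h.inner_assumption j).differentiable) x y

/-- The tangent lower bounds of the convex `G j` are averaged; their linear terms add up to the
vanishing full gradient. -/
theorem Setup.isMin_of_zero (h : Setup F G μg Lf Lg M ρ τ α L r κ Λ σ) {x : Vec p} {y : Vec d}
    (hy : fullMap G (pt x y) = 0) (y' : Vec d) : avg G (pt x y) ≤ avg G (pt x y') := by
  have h1 : ∀ j, G j (pt x y) + inner ℝ (gradY (G j) x y) (y' - y) ≤ G j (pt x y') := by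
    intro j
    have h2 := quadratic_le_of_strongConvexOn
      (fun y => hasGradientAt_right (h.inner_assumption j).differentiable x y) ((h.inner_assumption j).strongConvex x)
      y y'
    rw [gradY_eq (h.inner_assumption j).differentiable]
    have := h.μg_pos
    have : 0 ≤ μg / 2 * ‖y' - y‖ ^ 2 := by positivity
    linarith
  have h3 := mean_le_mean h1
  have h4 : (mean fun j => inner ℝ (gradY (G j) x y) (y' - y)) = 0 := by
    have := map_mean ((innerSL ℝ).flip (y' - y)) fun j => gradY (G j) x y
    have h5 : (mean fun j => gradY (G j) x y) = 0 := hy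
    rw [h5, map_zero] at this
    exact this.symm
  have h6 : (mean fun j => G j (pt x y) + inner ℝ (gradY (G j) x y) (y' - y))
      = (mean fun j => G j (pt x y)) + mean fun j => inner ℝ (gradY (G j) x y) (y' - y) := by
    simp [mean, Finset.sum_add_distrib, mul_add]
  rw [h6, h4, add_zero] at h3
  exact h3

/-- The contraction provides a zero of the gradient, hence a minimizer; so the choice in `innerSol`
does return a minimizer, and the gradient vanishes there. -/
theorem Setup.fullMap_innerSol (h : Setup F G μg Lf Lg M ρ τ α L r κ Λ σ) (x : Vec p) :
    fullMap G (pt x (innerSol (avg G) x)) = 0 := by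
  obtain ⟨y, hy⟩ := h.reg_full.exists_zero h.consts h.α_pos.ne' x
  have hmin : ∀ y', avg G (pt x (innerSol (avg G) x)) ≤ avg G (pt x y') :=
    Classical.epsilon_spec (p := fun y : Vec d => ∀ y', avg G (pt x y) ≤ avg G (pt x y'))
      ⟨y, h.isMin_of_zero hy⟩
  rw [← h.gradY_full]
  have hd := hasGradientAt_right (differentiable_avg fun j => (h.inner_assumption j).differentiable) x
    (innerSol (avg G) x)
  have hloc : IsLocalMin (fun y => avg G (pt x y)) (innerSol (avg G) x) :=
    Filter.Eventually.of_forall hmin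
  have h0 := hloc.hasFDerivAt_eq_zero hd.hasFDerivAt
  rw [gradY_eq (differentiable_avg fun j => (h.inner_assumption j).differentiable)]
  simpa using h0

theorem Setup.norm_solJac_le (h : Setup F G μg Lf Lg M ρ τ α L r κ Λ σ) (x : Vec p) :
    ‖solJac G α x‖ ≤ Λ := h.reg_full.norm_jacStar_le h.consts _

theorem Setup.smoothConst_nonneg (h : Setup F G μg Lf Lg M ρ τ α L r κ Λ σ) :
    0 ≤ smoothConst M Lf α r κ Λ := by
  have := h.consts.taylorConst_nonneg
  unfold smoothConst
  positivity

/-- The total objective has a quadratic first-order remainder. -/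
theorem Setup.totalObj_taylor (h : Setup F G μg Lf Lg M ρ τ α L r κ Λ σ) (x v : Vec p) :
    |totalObj F G (x + v) - totalObj F G x - inner ℝ (hyperGrad F G α x) v|
      ≤ smoothConst M Lf α r κ Λ * ‖v‖ ^ 2 := by
  have hf := OuterAssumption.avg h.n_pos h.outer_assumption
  set y := innerSol (avg G) x with hy
  set y' := innerSol (avg G) (x + v) with hy'
  have h1 := h.reg_full.solution_taylor h.consts (h.fullMap_innerSol x)
    (h.fullMap_innerSol (x + v))
  have h2 := h.reg_full.solution_lip h.consts (h.fullMap_innerSol x) (h.fullMap_innerSol (x + v))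
  rw [add_sub_cancel_left, ← hy, ← hy'] at h2
  rw [← hy, ← hy'] at h1
  have h3 := abs_sub_inner_le_of_lipschitz_gradient
    (fun w => (hf.differentiable w).hasGradientAt) hf.gradient_lip (pt x y) (pt (x + v) y')
  have hw : pt (x + v) y' - pt x y = pt v (y' - y) := by rw [pt_sub, add_sub_cancel_left]
  rw [hw, WithLp.prod_inner_apply] at h3
  change |totalObj F G (x + v) - totalObj F G x - (inner ℝ (gradient (avg F) (pt x y)).fst v
    + inner ℝ (gradient (avg F) (pt x y)).snd (y' - y))| ≤ _ at h3
  rw [← gradX_eq hf.differentiable, ← gradY_eq hf.differentiable] at h3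
  -- The chain rule with its error: the Taylor error of `f` along `(v, y' - y)`, plus `∇_y f` paired
  -- with the remainder of the solution map.
  have e : totalObj F G (x + v) - totalObj F G x - inner ℝ (hyperGrad F G α x) v
      = (totalObj F G (x + v) - totalObj F G x - (inner ℝ (gradX (avg F) x y) v
          + inner ℝ (gradY (avg F) x y) (y' - y)))
        + inner ℝ (gradY (avg F) x y) (y' - y - solJac G α x v) := by
    rw [hyperGrad, ← hy, inner_add_left, ContinuousLinearMap.adjoint_inner_left,
      inner_sub_right (gradY (avg F) x y) (y' - y)]
    ring
  have h4 : |inner ℝ (gradY (avg F) x y) (y' - y - solJac G α x v)|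
      ≤ M * (taylorConst α r κ Λ * ‖v‖ ^ 2) :=
    (abs_real_inner_le_norm _ _).trans
      (mul_le_mul (hf.norm_gradY_le x y) h1 (norm_nonneg _) M.coe_nonneg)
  have h5 : ‖pt v (y' - y)‖ ≤ (1 + Λ) * ‖v‖ := (norm_pt_le _ _).trans (by linarith)
  rw [e]
  calc _ ≤ Lf / 2 * ((1 + Λ) * ‖v‖) ^ 2 + M * (taylorConst α r κ Λ * ‖v‖ ^ 2) := by
        refine (abs_add_le _ _).trans (add_le_add (h3.trans ?_) h4)
        gcongr
    _ = _ := by unfold smoothConst; ring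

theorem Setup.hasGradientAt_totalObj (h : Setup F G μg Lf Lg M ρ τ α L r κ Λ σ) (x : Vec p) :
    HasGradientAt (totalObj F G) (hyperGrad F G α x) x := by
  rw [hasGradientAt_iff_hasFDerivAt]
  exact hasFDerivAt_of_norm_sub_le_sq fun v => h.totalObj_taylor x v

theorem Setup.norm_hyperGrad_le (h : Setup F G μg Lf Lg M ρ τ α L r κ Λ σ) (x : Vec p) :
    ‖hyperGrad F G α x‖ ≤ M + Λ * M := by
  have hf := OuterAssumption.avg h.n_pos h.outer_assumption
  refine (norm_add_le _ _).trans (add_le_add (hf.norm_gradX_le _ _) ?_)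
  refine (ContinuousLinearMap.le_opNorm _ _).trans ?_
  rw [LinearIsometryEquiv.norm_map]
  exact mul_le_mul (h.norm_solJac_le x) (hf.norm_gradY_le _ _) (norm_nonneg _) h.consts.Λ_nonneg

theorem Setup.innerSGD_eq_traj (h : Setup F G μg Lf Lg M ρ τ α L r κ Λ σ) {S : ℕ} (y₀ : Vec d)
    (x : Vec p) : ∀ (N : ℕ) (s : Fin N → Fin S → Fin m),
      innerSGD G α y₀ x N s = traj (batchMap G) α y₀ x N s
  | 0, _ => rfl
  | N + 1, s => by
    rw [innerSGD, traj, h.innerSGD_eq_traj y₀ x N,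
      gradY_avg fun i => (h.inner_assumption (s (Fin.last N) i)).differentiable]
    rfl

/-- The noise of the mini-batch gradients at the solution. -/
theorem Setup.integral_norm_batchMap_le (h : Setup F G μg Lf Lg M ρ τ α L r κ Λ σ) {S : ℕ}
    (hS : 1 ≤ S) (x : Vec p) :
    ∫ s : Fin S → Fin m, ‖batchMap G s (pt x (innerSol (avg G) x))‖
      ∂(Measure.pi fun _ : Fin S => unif m) ≤ |σ| / √(S : ℝ) := by
  set w := pt x (innerSol (avg G) x) with hw
  have h0 : (mean fun j => gradY (G j) w.fst w.snd) = 0 := h.fullMap_innerSol x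
  refine integral_norm_batch_mean_le h.m_pos hS h0 ((mean_le_mean fun j => ?_).trans (h.var w))
  have hG := fun j => (h.inner_assumption j).differentiable
  have h1 : (gradient (avg G) w).snd = 0 := by
    rw [← h0]
    exact (gradY_eq (differentiable_avg hG) w.fst w.snd).symm.trans (gradY_avg hG _ _)
  -- At the solution the averaged `y`-gradient is zero, so each `∇_y G j` is a component of the
  -- deviation controlled by the variance bound.
  have h2 : gradY (G j) w.fst w.snd = (gradient (G j) w - gradient (avg G) w).snd := by
    rw [WithLp.sub_snd, h1, sub_zero]
    exact gradY_eq (hG j) w.fst w.snd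
  rw [h2]
  gcongr
  exact norm_snd_le _

theorem Setup.integral_fderiv_batchMap (h : Setup F G μg Lf Lg M ρ τ α L r κ Λ σ) {S : ℕ}
    (hS : 1 ≤ S) (w : Joint p d) :
    ∫ s : Fin S → Fin m, fderiv ℝ (batchMap G s) w ∂(Measure.pi fun _ : Fin S => unif m)
      = fderiv ℝ (fullMap G) w := by
  exact integral_fderiv_batch_mean h.m_pos hS (fun j => (h.reg j).diff) w

end SetupLemmas

end PZOBO

/-! ### The estimator, its linearizations and pathwise bounds -/

namespace PZOBO

variable {p d n m N S Q Df : ℕ}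

/-- The difference quotient of the inner iterates in the direction `u`. -/
def diffQuot (G : Fin m → Joint p d → ℝ) (α μ : ℝ) (y₀ : Vec d) (x : Vec p)
    (s : Fin N → Fin S → Fin m) (u : Vec p) : Vec d :=
  (1 / μ) • (traj (batchMap G) α y₀ (x + μ • u) N s - traj (batchMap G) α y₀ x N s)

/-- The estimator as a function of the directions, for fixed batches. -/
def est (F : Fin n → Joint p d → ℝ) (G : Fin m → Joint p d → ℝ) (α μ : ℝ) (y₀ : Vec d) (x : Vec p)
    (u : Fin Q → Vec p) (s : Fin N → Fin S → Fin m) (D : Fin Df → Fin n) : Vec p :=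
  gradX (avg fun i => F (D i)) x (traj (batchMap G) α y₀ x N s)
    + mean fun j => (inner ℝ (diffQuot G α μ y₀ x s (u j))
        (gradY (avg fun i => F (D i)) x (traj (batchMap G) α y₀ x N s)) : ℝ) • u j

/-- The expectation of the linearized estimator over the directions. -/
def linEst (F : Fin n → Joint p d → ℝ) (G : Fin m → Joint p d → ℝ) (α : ℝ) (y₀ : Vec d) (x : Vec p)
    (s : Fin N → Fin S → Fin m) (D : Fin Df → Fin n) : Vec p :=
  gradX (avg fun i => F (D i)) x (traj (batchMap G) α y₀ x N s)
    + ContinuousLinearMap.adjoint (jac (batchMap G) α y₀ x N s)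
        (gradY (avg fun i => F (D i)) x (traj (batchMap G) α y₀ x N s))

/-- The linearized estimator with all quantities evaluated at the inner solution. -/
def frozenEst (F : Fin n → Joint p d → ℝ) (G : Fin m → Joint p d → ℝ) (α : ℝ) (x : Vec p)
    (s : Fin N → Fin S → Fin m) (D : Fin Df → Fin n) : Vec p :=
  gradX (avg fun i => F (D i)) x (innerSol (avg G) x)
    + ContinuousLinearMap.adjoint (jacFrozen (batchMap G) α (pt x (innerSol (avg G) x)) N s)
        (gradY (avg fun i => F (D i)) x (innerSol (avg G) x))

/-- The law of the inner batches. -/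
abbrev innerLaw (m N S : ℕ) : Measure (Fin N → Fin S → Fin m) :=
  Measure.pi fun _ : Fin N => Measure.pi fun _ : Fin S => unif m

/-- The law of the outer batch. -/
abbrev outerLaw (n Df : ℕ) : Measure (Fin Df → Fin n) := Measure.pi fun _ : Fin Df => unif n

/-- The law of the directions. -/
abbrev dirLaw (p Q : ℕ) : Measure (Fin Q → Vec p) :=
  Measure.pi fun _ : Fin Q => stdGaussian (Vec p)

variable {F : Fin n → Joint p d → ℝ} {G : Fin m → Joint p d → ℝ} {μg : ℝ}
  {Lf Lg M ρ τ : ℝ≥0} {α L r κ Λ σ : ℝ}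

theorem Setup.hyperGradEst_eq (h : Setup F G μg Lf Lg M ρ τ α L r κ Λ σ) (μ : ℝ) (y₀ : Vec d)
    (x : Vec p) (ω : Draw p n m N S Q Df) :
    hyperGradEst F G α μ y₀ x ω = est F G α μ y₀ x ω.1 ω.2.1 ω.2.2 := by
  simp only [hyperGradEst, h.innerSGD_eq_traj]
  rfl

theorem Setup.norm_diffQuot_le (h : Setup F G μg Lf Lg M ρ τ α L r κ Λ σ) (hS : 1 ≤ S)
    {μ : ℝ} (hμ : 0 < μ) (y₀ : Vec d) (x : Vec p) (s : Fin N → Fin S → Fin m) (u : Vec p) :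
    ‖diffQuot G α μ y₀ x s u‖ ≤ Λ * ‖u‖ := by
  have h1 := traj_lip (h.reg_batch hS) h.consts y₀ x (x + μ • u) N s
  rw [add_sub_cancel_left, norm_smul, Real.norm_of_nonneg hμ.le] at h1
  rw [diffQuot, norm_smul, Real.norm_of_nonneg (by positivity), one_div, inv_mul_le_iff₀ hμ]
  linarith

/-- The quadratic remainder of `traj_taylor` at `h = μ u`, divided by `μ`, keeps one factor `μ`. -/
theorem Setup.norm_diffQuot_sub_le (h : Setup F G μg Lf Lg M ρ τ α L r κ Λ σ) (hS : 1 ≤ S)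
    {μ : ℝ} (hμ : 0 < μ) (y₀ : Vec d) (x : Vec p) (s : Fin N → Fin S → Fin m) (u : Vec p) :
    ‖diffQuot G α μ y₀ x s u - jac (batchMap G) α y₀ x N s u‖
      ≤ taylorConst α r κ Λ * μ * ‖u‖ ^ 2 := by
  have h1 := traj_taylor (h.reg_batch hS) h.consts y₀ x (μ • u) N s
  rw [norm_smul, Real.norm_of_nonneg hμ.le, map_smul] at h1
  have e : diffQuot G α μ y₀ x s u - jac (batchMap G) α y₀ x N s u
      = (1 / μ) • (traj (batchMap G) α y₀ (x + μ • u) N s - traj (batchMap G) α y₀ x N s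
        - μ • jac (batchMap G) α y₀ x N s u) := by
    rw [diffQuot, smul_sub _ (_ - _) (μ • _), smul_smul, one_div, inv_mul_cancel₀ hμ.ne', one_smul]
  rw [e, norm_smul, Real.norm_of_nonneg (by positivity), one_div, inv_mul_le_iff₀ hμ]
  linarith

theorem Setup.outer_batch (h : Setup F G μg Lf Lg M ρ τ α L r κ Λ σ) (hDf : 1 ≤ Df)
    (D' : Fin Df → Fin n) : OuterAssumption (avg fun i => F (D' i)) M Lf :=
  OuterAssumption.avg hDf fun i => h.outer_assumption (D' i)

theorem abs_inner_le_of_norm_le {E : Type*} [NormedAddCommGroup E] [InnerProductSpace ℝ E]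
    {a b : E} {A B : ℝ} (ha : ‖a‖ ≤ A) (hb : ‖b‖ ≤ B) : |inner ℝ a b| ≤ A * B :=
  (abs_real_inner_le_norm a b).trans
    (mul_le_mul ha hb (norm_nonneg _) ((norm_nonneg _).trans ha))

/-- A bound of the square of the estimator by a function of the directions only. -/
theorem Setup.sq_norm_est_le (h : Setup F G μg Lf Lg M ρ τ α L r κ Λ σ) (hS : 1 ≤ S)
    (hDf : 1 ≤ Df) {μ : ℝ} (hμ : 0 < μ) (y₀ : Vec d) (x : Vec p) (u : Fin Q → Vec p)
    (s : Fin N → Fin S → Fin m) (D' : Fin Df → Fin n) :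
    ‖est F G α μ y₀ x u s D'‖ ^ 2
      ≤ 2 * M ^ 2 + mean fun j => 2 * (Λ * M) ^ 2 * ‖u j‖ ^ 4 := by
  have hF := h.outer_batch hDf D'
  have hΛ := h.consts.Λ_nonneg
  have h1 : ∀ a b : Vec p, ‖a + b‖ ^ 2 ≤ 2 * ‖a‖ ^ 2 + 2 * ‖b‖ ^ 2 := by
    intro a b
    nlinarith [norm_add_le a b, norm_nonneg (a + b), sq_nonneg (‖a‖ - ‖b‖)]
  refine (h1 _ _).trans (add_le_add ?_ ?_)
  · have := hF.norm_gradX_le x (traj (batchMap G) α y₀ x N s)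
    gcongr
  · refine (mul_le_mul_of_nonneg_left (sq_norm_mean_le _) zero_le_two).trans ?_
    rw [← smul_eq_mul, ← mean_smul]
    refine mean_le_mean fun j => ?_
    rw [norm_smul, smul_eq_mul, mul_pow]
    have := abs_inner_le_of_norm_le (h.norm_diffQuot_le hS hμ y₀ x s (u j))
      (hF.norm_gradY_le x (traj (batchMap G) α y₀ x N s))
    calc _ ≤ 2 * ((Λ * ‖u j‖ * M) ^ 2 * ‖u j‖ ^ 2) := by gcongr; exact this
      _ = _ := by ring

/-- A sharper bound of the square of the estimator, through the linearization. -/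
theorem Setup.sq_norm_est_le_lin (h : Setup F G μg Lf Lg M ρ τ α L r κ Λ σ) (hS : 1 ≤ S)
    (hDf : 1 ≤ Df) {μ : ℝ} (hμ : 0 < μ) (y₀ : Vec d) (x : Vec p) (u : Fin Q → Vec p)
    (s : Fin N → Fin S → Fin m) (D' : Fin Df → Fin n) :
    ‖est F G α μ y₀ x u s D'‖ ^ 2 ≤ 2 * M ^ 2 + mean fun j =>
      (4 * ((inner ℝ (ContinuousLinearMap.adjoint (jac (batchMap G) α y₀ x N s)
        (gradY (avg fun i => F (D' i)) x (traj (batchMap G) α y₀ x N s))) (u j)) ^ 2 * ‖u j‖ ^ 2)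
      + 4 * (taylorConst α r κ Λ * μ * M) ^ 2 * ‖u j‖ ^ 6) := by
  have hF := h.outer_batch hDf D'
  have hΛ := h.consts.Λ_nonneg
  have h1 : ∀ a b : Vec p, ‖a + b‖ ^ 2 ≤ 2 * ‖a‖ ^ 2 + 2 * ‖b‖ ^ 2 := by
    intro a b
    nlinarith [norm_add_le a b, norm_nonneg (a + b), sq_nonneg (‖a‖ - ‖b‖)]
  refine (h1 _ _).trans (add_le_add ?_ ?_)
  · have := hF.norm_gradX_le x (traj (batchMap G) α y₀ x N s)
    gcongr
  · refine (mul_le_mul_of_nonneg_left (sq_norm_mean_le _) zero_le_two).trans ?_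
    rw [← smul_eq_mul, ← mean_smul]
    refine mean_le_mean fun j => ?_
    rw [norm_smul, smul_eq_mul, mul_pow, Real.norm_eq_abs, sq_abs,
      ContinuousLinearMap.adjoint_inner_left, real_inner_comm]
    set v := gradY (avg fun i => F (D' i)) x (traj (batchMap G) α y₀ x N s)
    set J := jac (batchMap G) α y₀ x N s
    have h2 : |inner ℝ v (diffQuot G α μ y₀ x s (u j) - J (u j))|
        ≤ M * (taylorConst α r κ Λ * μ * ‖u j‖ ^ 2) :=
      abs_inner_le_of_norm_le (hF.norm_gradY_le _ _) (h.norm_diffQuot_sub_le hS hμ y₀ x s (u j))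
    have h3 : (inner ℝ v (diffQuot G α μ y₀ x s (u j) - J (u j))) ^ 2
        ≤ (M * (taylorConst α r κ Λ * μ * ‖u j‖ ^ 2)) ^ 2 := by
      rw [← sq_abs]; gcongr
    have h4 : (inner ℝ v (diffQuot G α μ y₀ x s (u j)) : ℝ)
        = inner ℝ v (J (u j)) + inner ℝ v (diffQuot G α μ y₀ x s (u j) - J (u j)) := by
      rw [inner_sub_right]; ring
    have h5 : (inner ℝ v (diffQuot G α μ y₀ x s (u j)) : ℝ) ^ 2 ≤ 2 * (inner ℝ v (J (u j))) ^ 2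
        + 2 * (M * (taylorConst α r κ Λ * μ * ‖u j‖ ^ 2)) ^ 2 := by
      rw [h4]
      nlinarith [sq_nonneg ((inner ℝ v (J (u j)) : ℝ)
        - inner ℝ v (diffQuot G α μ y₀ x s (u j) - J (u j)))]
    calc _ ≤ 2 * ((2 * (inner ℝ v (J (u j))) ^ 2
          + 2 * (M * (taylorConst α r κ Λ * μ * ‖u j‖ ^ 2)) ^ 2) * ‖u j‖ ^ 2) := by gcongr
      _ = _ := by ring

theorem continuous_mean {k : ℕ} {T V : Type*} [TopologicalSpace T] [NormedAddCommGroup V]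
    [NormedSpace ℝ V] {f : Fin k → T → V} (hf : ∀ i, Continuous (f i)) :
    Continuous fun t => mean fun i => f i t := by
  unfold mean
  fun_prop

/-- Batches take finitely many values, so continuity in the point and the directions for each batch
is enough for joint measurability. -/
theorem Setup.continuous_est (h : Setup F G μg Lf Lg M ρ τ α L r κ Λ σ) (hS : 1 ≤ S)
    (hDf : 1 ≤ Df) (μ : ℝ) (y₀ : Vec d) (s : Fin N → Fin S → Fin m) (D' : Fin Df → Fin n) :
    Continuous fun q : Vec p × (Fin Q → Vec p) => est F G α μ y₀ q.1 q.2 s D' := by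
  have hF := h.outer_batch hDf D'
  have hY := continuous_traj (h.reg_batch hS) h.consts y₀ N s
  have hY1 : Continuous fun q : Vec p × (Fin Q → Vec p) => traj (batchMap G) α y₀ q.1 N s :=
    hY.comp continuous_fst
  have hj : ∀ j, Continuous fun q : Vec p × (Fin Q → Vec p) =>
      (inner ℝ (diffQuot G α μ y₀ q.1 s (q.2 j))
        (gradY (avg fun i => F (D' i)) q.1 (traj (batchMap G) α y₀ q.1 N s)) : ℝ) • q.2 j := by
    intro j
    have hu : Continuous fun q : Vec p × (Fin Q → Vec p) => q.2 j :=
      (continuous_apply j).comp continuous_snd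
    have hq : Continuous fun q : Vec p × (Fin Q → Vec p) => diffQuot G α μ y₀ q.1 s (q.2 j) :=
      ((hY.comp (continuous_fst.add (hu.const_smul μ))).sub hY1).const_smul (1 / μ)
    exact (Continuous.inner (𝕜 := ℝ) hq (hF.continuous_gradY continuous_fst hY1)).smul hu
  exact (hF.continuous_gradX continuous_fst hY1).add (continuous_mean hj)

/-- Joint measurability of a function of a continuous and of a discrete variable, with the
variables regrouped. -/
theorem measurable_regroup {X U Z V : Type*} [MeasurableSpace X] [MeasurableSpace U]
    [MeasurableSpace Z] [Countable Z] [MeasurableSingletonClass Z] [MeasurableSpace V]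
    {f : X → U → Z → V} (hf : ∀ z, Measurable fun q : X × U => f q.1 q.2 z) :
    Measurable fun q : X × U × Z => f q.1 q.2.1 q.2.2 := by
  have h1 : Measurable fun q : (X × U) × Z => f q.1.1 q.1.2 q.2 :=
    measurable_from_prod_countable_left hf
  exact h1.comp ((measurable_fst.prodMk (measurable_fst.comp measurable_snd)).prodMk
    (measurable_snd.comp measurable_snd))

theorem Setup.measurable_hyperGradEst (h : Setup F G μg Lf Lg M ρ τ α L r κ Λ σ) (hS : 1 ≤ S)
    (hDf : 1 ≤ Df) (μ : ℝ) (y₀ : Vec d) :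
    Measurable fun q : Vec p × Draw p n m N S Q Df => hyperGradEst F G α μ y₀ q.1 q.2 := by
  have e : (fun q : Vec p × Draw p n m N S Q Df => hyperGradEst F G α μ y₀ q.1 q.2)
      = fun q => est F G α μ y₀ q.1 q.2.1 q.2.2.1 q.2.2.2 :=
    funext fun q => h.hyperGradEst_eq μ y₀ q.1 q.2
  have h1 := measurable_regroup (f := fun x u (z : (Fin N → Fin S → Fin m) × (Fin Df → Fin n)) =>
    est (Q := Q) F G α μ y₀ x u z.1 z.2)
    fun z => (h.continuous_est hS hDf μ y₀ z.1 z.2).measurable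
  rw [e]
  exact h1

end PZOBO

/-! ### Integrability, second moment and bias of the estimator -/

namespace PZOBO

variable {p d n m N S Q Df : ℕ}

variable {F : Fin n → Joint p d → ℝ} {G : Fin m → Joint p d → ℝ} {μg : ℝ}
  {Lf Lg M ρ τ : ℝ≥0} {α L r κ Λ σ : ℝ}

theorem integral_le_of_forall_le {X : Type*} [MeasurableSpace X] {ν : Measure X}
    [IsProbabilityMeasure ν] {f : X → ℝ} (hf : Integrable f ν) {c : ℝ} (h : ∀ x, f x ≤ c) :
    ∫ x, f x ∂ν ≤ c :=
  (integral_mono hf (integrable_const c) h).trans_eq (by simp)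

theorem isProbabilityMeasure_drawLaw (hn : 1 ≤ n) (hm : 1 ≤ m) :
    IsProbabilityMeasure (drawLaw p n m N S Q Df) := by
  have := isProbabilityMeasure_unif hn
  have := isProbabilityMeasure_unif hm
  unfold drawLaw
  infer_instance

/-- A bound for the squared norm of the estimator that depends only on the directions. -/
def estBound (M Λ : ℝ) (ω : Draw p n m N S Q Df) : ℝ :=
  2 * M ^ 2 + mean fun j => 2 * (Λ * M) ^ 2 * ‖ω.1 j‖ ^ 4

theorem integrable_dirBound (M Λ : ℝ) : Integrable (fun u : Fin Q → Vec p =>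
    2 * M ^ 2 + mean fun j => 2 * (Λ * M) ^ 2 * ‖u j‖ ^ 4) (dirLaw p Q) :=
  (integrable_const _).add (integrable_mean_eval
    ((integrable_norm_pow_stdGaussian 4).const_mul (2 * (Λ * M) ^ 2)))

theorem integrable_estBound (hn : 1 ≤ n) (hm : 1 ≤ m) (M Λ : ℝ) :
    Integrable (estBound M Λ) (drawLaw p n m N S Q Df) := by
  have := isProbabilityMeasure_unif hn
  have := isProbabilityMeasure_unif hm
  exact (integrable_dirBound M Λ).comp_fst _

theorem Setup.sq_norm_hyperGradEst_le (h : Setup F G μg Lf Lg M ρ τ α L r κ Λ σ) (hS : 1 ≤ S)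
    (hDf : 1 ≤ Df) {μ : ℝ} (hμ : 0 < μ) (y₀ : Vec d) (x : Vec p) (ω : Draw p n m N S Q Df) :
    ‖hyperGradEst F G α μ y₀ x ω‖ ^ 2 ≤ estBound M Λ ω := by
  rw [h.hyperGradEst_eq]
  exact h.sq_norm_est_le hS hDf hμ y₀ x ω.1 ω.2.1 ω.2.2

theorem norm_le_one_add_sq {E : Type*} [NormedAddCommGroup E] (v : E) : ‖v‖ ≤ 1 + ‖v‖ ^ 2 := by
  nlinarith [sq_nonneg (‖v‖ - 1)]

theorem measurable_section {X Z V : Type*} [MeasurableSpace X] [MeasurableSpace Z]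
    [MeasurableSpace V] {f : X → Z → V} (hf : Measurable fun q : X × Z => f q.1 q.2) (x : X) :
    Measurable (f x) := hf.comp measurable_prodMk_left

theorem Setup.measurable_hyperGradEst_right (h : Setup F G μg Lf Lg M ρ τ α L r κ Λ σ)
    (hS : 1 ≤ S) (hDf : 1 ≤ Df) (μ : ℝ) (y₀ : Vec d) (x : Vec p) :
    Measurable fun ω : Draw p n m N S Q Df => hyperGradEst F G α μ y₀ x ω := by
  have h1 := h.measurable_hyperGradEst (N := N) (Q := Q) hS hDf μ y₀
  exact measurable_section h1 x

theorem Setup.integrable_hyperGradEst (h : Setup F G μg Lf Lg M ρ τ α L r κ Λ σ) (hS : 1 ≤ S)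
    (hDf : 1 ≤ Df) {μ : ℝ} (hμ : 0 < μ) (y₀ : Vec d) (x : Vec p) :
    Integrable (fun ω => hyperGradEst F G α μ y₀ x ω) (drawLaw p n m N S Q Df) := by
  have := isProbabilityMeasure_drawLaw (p := p) (N := N) (S := S) (Q := Q) (Df := Df)
    h.n_pos h.m_pos
  refine ((integrable_const (1 : ℝ)).add (integrable_estBound h.n_pos h.m_pos M Λ)).mono'
    (h.measurable_hyperGradEst_right hS hDf μ y₀ x).aestronglyMeasurable
    (Filter.Eventually.of_forall fun ω => ?_)
  have h1 := h.sq_norm_hyperGradEst_le hS hDf hμ y₀ x ω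
  have h2 := norm_le_one_add_sq (hyperGradEst F G α μ y₀ x ω)
  simp only [Pi.add_apply]
  linarith

theorem Setup.integrable_sq_hyperGradEst (h : Setup F G μg Lf Lg M ρ τ α L r κ Λ σ) (hS : 1 ≤ S)
    (hDf : 1 ≤ Df) {μ : ℝ} (hμ : 0 < μ) (y₀ : Vec d) (x : Vec p) :
    Integrable (fun ω => ‖hyperGradEst F G α μ y₀ x ω‖ ^ 2) (drawLaw p n m N S Q Df) := by
  refine (integrable_estBound h.n_pos h.m_pos M Λ).mono'
    ((h.measurable_hyperGradEst_right hS hDf μ y₀ x).norm.pow_const 2).aestronglyMeasurable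
    (Filter.Eventually.of_forall fun ω => ?_)
  rw [Real.norm_of_nonneg (by positivity)]
  exact h.sq_norm_hyperGradEst_le hS hDf hμ y₀ x ω

/-- The second-moment bound of the estimator. -/
def momentConst (M α r κ Λ : ℝ) (p : ℕ) (μ : ℝ) : ℝ :=
  2 * M ^ 2 + (4 * (gaussMoment 4 * p * (Λ * M) ^ 2)
    + 4 * (taylorConst α r κ Λ * μ * M) ^ 2 * (gaussMoment 6 * (p : ℝ) ^ 3))

theorem Setup.norm_adjoint_jac_le (h : Setup F G μg Lf Lg M ρ τ α L r κ Λ σ) (hS : 1 ≤ S)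
    (hDf : 1 ≤ Df) (y₀ : Vec d) (x : Vec p) (s : Fin N → Fin S → Fin m) (D' : Fin Df → Fin n) :
    ‖ContinuousLinearMap.adjoint (jac (batchMap G) α y₀ x N s)
        (gradY (avg fun i => F (D' i)) x (traj (batchMap G) α y₀ x N s))‖ ≤ Λ * M := by
  refine (ContinuousLinearMap.le_opNorm _ _).trans ?_
  rw [LinearIsometryEquiv.norm_map]
  exact mul_le_mul (norm_jac_le (h.reg_batch hS) h.consts y₀ x N s)
    ((h.outer_batch hDf D').norm_gradY_le _ _) (norm_nonneg _) h.consts.Λ_nonneg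

/-- For fixed batches the directions are integrated. The linear part pairs `u` with a vector of norm
at most `Λ M`, giving a term linear in `p`; the linearization error enters with `μ² p³`. -/
theorem Setup.integral_sq_hyperGradEst_le (h : Setup F G μg Lf Lg M ρ τ α L r κ Λ σ)
    (hS : 1 ≤ S) (hQ : 1 ≤ Q) (hDf : 1 ≤ Df) {μ : ℝ} (hμ : 0 < μ) (y₀ : Vec d) (x : Vec p) :
    ∫ ω, ‖hyperGradEst F G α μ y₀ x ω‖ ^ 2 ∂(drawLaw p n m N S Q Df)
      ≤ momentConst M α r κ Λ p μ := by
  have hn := isProbabilityMeasure_unif h.n_pos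
  have hm := isProbabilityMeasure_unif h.m_pos
  have hint := h.integrable_sq_hyperGradEst (N := N) (Q := Q) hS hDf hμ y₀ x
  rw [drawLaw] at hint ⊢
  rw [integral_prod_symm _ hint]
  refine integral_le_of_forall_le Integrable.of_finite fun z => ?_
  simp only [h.hyperGradEst_eq]
  set a := ContinuousLinearMap.adjoint (jac (batchMap G) α y₀ x N z.1)
        (gradY (avg fun i => F (z.2 i)) x (traj (batchMap G) α y₀ x N z.1)) with ha
  have hna : ‖a‖ ≤ Λ * M := h.norm_adjoint_jac_le hS hDf y₀ x z.1 z.2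
  set K := 4 * (taylorConst α r κ Λ * μ * M) ^ 2 with hK
  have i1 : Integrable (fun u : Vec p => 4 * ((inner ℝ a u) ^ 2 * ‖u‖ ^ 2) + K * ‖u‖ ^ 6)
      (stdGaussian (Vec p)) :=
    ((integrable_inner_sq_mul_norm_sq a).const_mul 4).add
      ((integrable_norm_pow_stdGaussian 6).const_mul K)
  calc _ ≤ ∫ u : Fin Q → Vec p, (2 * (M : ℝ) ^ 2 + mean fun j =>
          (4 * ((inner ℝ a (u j)) ^ 2 * ‖u j‖ ^ 2) + K * ‖u j‖ ^ 6)) ∂(dirLaw p Q) := by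
        refine integral_mono_of_nonneg (Filter.Eventually.of_forall fun u => by positivity)
          ((integrable_const _).add (integrable_mean_eval i1))
          (Filter.Eventually.of_forall fun u => h.sq_norm_est_le_lin hS hDf hμ y₀ x u z.1 z.2)
    _ = 2 * (M : ℝ) ^ 2 + (4 * ∫ u, (inner ℝ a u) ^ 2 * ‖u‖ ^ 2 ∂(stdGaussian (Vec p))
          + K * ∫ u, ‖u‖ ^ 6 ∂(stdGaussian (Vec p))) := by
        rw [integral_add (integrable_const _) (integrable_mean_eval i1),
          integral_mean_eval hQ i1, integral_add ((integrable_inner_sq_mul_norm_sq a).const_mul 4)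
          ((integrable_norm_pow_stdGaussian 6).const_mul K)]
        simp [integral_const_mul]
    _ ≤ _ := by
        have h4 := gaussMoment_nonneg 4 (by decide)
        unfold momentConst
        gcongr
        · exact (integral_inner_sq_mul_norm_sq_le a).trans (by gcongr)
        · exact integral_norm_pow_six_le

/-- By isotropy the Gaussian mean of `⟨Ju, v⟩u` is exactly `Jᵀv`, so only the linearization error of
the difference quotient, times `‖v‖‖u‖`, contributes. -/
theorem Setup.norm_integral_est_sub_linEst_le (h : Setup F G μg Lf Lg M ρ τ α L r κ Λ σ)
    (hS : 1 ≤ S) (hQ : 1 ≤ Q) (hDf : 1 ≤ Df) {μ : ℝ} (hμ : 0 < μ) (y₀ : Vec d) (x : Vec p)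
    (s : Fin N → Fin S → Fin m) (D' : Fin Df → Fin n) :
    ‖∫ u, est F G α μ y₀ x u s D' ∂(dirLaw p Q) - linEst F G α y₀ x s D'‖
      ≤ taylorConst α r κ Λ * μ * M * ∫ u, ‖u‖ ^ 3 ∂(stdGaussian (Vec p)) := by
  have hF := h.outer_batch hDf D'
  have hΛ := h.consts.Λ_nonneg
  have hY := continuous_traj (h.reg_batch hS) h.consts y₀ N s
  simp only [est, linEst]
  set v := gradY (avg fun i => F (D' i)) x (traj (batchMap G) α y₀ x N s)
  have hv : ‖v‖ ≤ M := hF.norm_gradY_le _ _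
  set J := jac (batchMap G) α y₀ x N s
  have hcont : Continuous fun u : Vec p => (inner ℝ (diffQuot G α μ y₀ x s u) v : ℝ) • u := by
    have hq : Continuous fun u : Vec p => diffQuot G α μ y₀ x s u :=
      ((hY.comp (continuous_const.add (continuous_id.const_smul μ))).sub
        continuous_const).const_smul (1 / μ)
    exact (Continuous.inner (𝕜 := ℝ) hq continuous_const).smul continuous_id
  have i1 : Integrable (fun u : Vec p => (inner ℝ (diffQuot G α μ y₀ x s u) v : ℝ) • u)
      (stdGaussian (Vec p)) := by
    refine ((integrable_norm_pow_stdGaussian 2).const_mul (Λ * M)).mono'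
      hcont.aestronglyMeasurable (Filter.Eventually.of_forall fun u => ?_)
    rw [norm_smul]
    have := abs_inner_le_of_norm_le (h.norm_diffQuot_le hS hμ y₀ x s u) hv
    calc _ ≤ Λ * ‖u‖ * M * ‖u‖ := by gcongr; exact this
      _ = _ := by ring
  have i2 := integrable_inner_smul_stdGaussian (ContinuousLinearMap.adjoint J v)
  rw [integral_add (integrable_const _) (integrable_mean_eval i1), integral_mean_eval hQ i1]
  conv_lhs => rw [← integral_inner_smul_stdGaussian (ContinuousLinearMap.adjoint J v)]
  simp only [integral_const, probReal_univ, one_smul, add_sub_add_left_eq_sub]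
  rw [← integral_sub i1 i2, ← integral_const_mul]
  refine norm_integral_le_of_norm_le ((integrable_norm_pow_stdGaussian 3).const_mul _)
    (Filter.Eventually.of_forall fun u => ?_)
  rw [ContinuousLinearMap.adjoint_inner_left, real_inner_comm v (diffQuot G α μ y₀ x s u),
    ← sub_smul, ← inner_sub_right, norm_smul]
  have := abs_inner_le_of_norm_le hv (h.norm_diffQuot_sub_le hS hμ y₀ x s u)
  calc _ ≤ M * (taylorConst α r κ Λ * μ * ‖u‖ ^ 2) * ‖u‖ := by gcongr; exact this
    _ = _ := by ring

/-- The gradients of `F` are changed under the bounded `jac`, and the Jacobian is changed against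
the bounded gradient of `F` at the solution. -/
theorem Setup.norm_linEst_sub_frozenEst_le (h : Setup F G μg Lf Lg M ρ τ α L r κ Λ σ)
    (hS : 1 ≤ S) (hDf : 1 ≤ Df) (y₀ : Vec d) (x : Vec p)
    (s : Fin N → Fin S → Fin m) (D' : Fin Df → Fin n) :
    ‖linEst F G α y₀ x s D' - frozenEst F G α x s D'‖
      ≤ Lf * (1 + Λ) * ‖traj (batchMap G) α y₀ x N s - innerSol (avg G) x‖
        + M * ‖jac (batchMap G) α y₀ x N s
            - jacFrozen (batchMap G) α (pt x (innerSol (avg G) x)) N s‖ := by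
  have hF := h.outer_batch hDf D'
  simp only [linEst, frozenEst]
  set Y := traj (batchMap G) α y₀ x N s
  set y := innerSol (avg G) x
  set J := jac (batchMap G) α y₀ x N s
  set J' := jacFrozen (batchMap G) α (pt x y) N s
  set FD := avg fun i => F (D' i)
  have e : gradX FD x Y + ContinuousLinearMap.adjoint J (gradY FD x Y)
      - (gradX FD x y + ContinuousLinearMap.adjoint J' (gradY FD x y))
      = (gradX FD x Y - gradX FD x y) + ContinuousLinearMap.adjoint J (gradY FD x Y - gradY FD x y)
        + ContinuousLinearMap.adjoint (J - J') (gradY FD x y) := by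
    rw [map_sub, map_sub, sub_apply]
    abel
  have h1 : ‖ContinuousLinearMap.adjoint J (gradY FD x Y - gradY FD x y)‖
      ≤ Λ * (Lf * ‖Y - y‖) := by
    refine (ContinuousLinearMap.le_opNorm _ _).trans ?_
    rw [LinearIsometryEquiv.norm_map]
    exact mul_le_mul (norm_jac_le (h.reg_batch hS) h.consts y₀ x N s) (hF.gradY_sub_le x Y y)
      (norm_nonneg _) h.consts.Λ_nonneg
  have h2 : ‖ContinuousLinearMap.adjoint (J - J') (gradY FD x y)‖ ≤ ‖J - J'‖ * M := by
    refine (ContinuousLinearMap.le_opNorm _ _).trans ?_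
    rw [LinearIsometryEquiv.norm_map]
    gcongr
    exact hF.norm_gradY_le x y
  rw [e]
  calc _ ≤ Lf * ‖Y - y‖ + Λ * (Lf * ‖Y - y‖) + ‖J - J'‖ * M :=
        (norm_add₃_le).trans (add_le_add (add_le_add (hF.gradX_sub_le x Y y) h1) h2)
    _ = _ := by ring

/-- With everything evaluated at `y*(x)`, inner and outer batches enter as a product of independent
factors, so the expectation factorizes. -/
theorem Setup.integral_frozenEst (h : Setup F G μg Lf Lg M ρ τ α L r κ Λ σ) (hDf : 1 ≤ Df)
    (x : Vec p) :
    ∫ z, frozenEst F G α x z.1 z.2 ∂((innerLaw m N S).prod (outerLaw n Df))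
      = gradX (avg F) x (innerSol (avg G) x) + ContinuousLinearMap.adjoint
          (∫ s, jacFrozen (batchMap G) α (pt x (innerSol (avg G) x)) N s ∂(innerLaw m N S))
          (gradY (avg F) x (innerSol (avg G) x)) := by
  have hn := isProbabilityMeasure_unif h.n_pos
  have hm := isProbabilityMeasure_unif h.m_pos
  have hdiff := fun i => (h.outer_assumption i).differentiable
  set y := innerSol (avg G) x
  have hX : ∫ D' : Fin Df → Fin n, gradX (avg fun i => F (D' i)) x y ∂(outerLaw n Df)
      = gradX (avg F) x y := by
    rw [gradX_avg hdiff, ← integral_batch_mean h.n_pos hDf]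
    exact integral_congr_ae (Filter.Eventually.of_forall fun D' => gradX_avg (fun i => hdiff _) x y)
  have hY : ∫ D' : Fin Df → Fin n, gradY (avg fun i => F (D' i)) x y ∂(outerLaw n Df)
      = gradY (avg F) x y := by
    rw [gradY_avg hdiff, ← integral_batch_mean h.n_pos hDf]
    exact integral_congr_ae (Filter.Eventually.of_forall fun D' => gradY_avg (fun i => hdiff _) x y)
  rw [integral_prod _ Integrable.of_finite]
  simp only [frozenEst]
  have inner : ∀ s : Fin N → Fin S → Fin m, ∫ D' : Fin Df → Fin n,
      (gradX (avg fun i => F (D' i)) x y + ContinuousLinearMap.adjoint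
        (jacFrozen (batchMap G) α (pt x y) N s) (gradY (avg fun i => F (D' i)) x y))
        ∂(outerLaw n Df) = gradX (avg F) x y + ContinuousLinearMap.adjoint
        (jacFrozen (batchMap G) α (pt x y) N s) (gradY (avg F) x y) := by
    intro s
    rw [integral_add Integrable.of_finite Integrable.of_finite, hX,
      ContinuousLinearMap.integral_comp_comm _ Integrable.of_finite, hY]
  simp only [y, inner]
  rw [integral_add Integrable.of_finite Integrable.of_finite]
  simp only [integral_const, probReal_univ, one_smul]
  congr 1
  -- The integral is passed through the adjoint by testing against a vector `b`.
  refine ext_inner_left ℝ fun b => ?_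
  rw [← integral_inner Integrable.of_finite, ContinuousLinearMap.adjoint_inner_right,
    ContinuousLinearMap.integral_apply Integrable.of_finite, real_inner_comm,
    ← integral_inner Integrable.of_finite]
  refine integral_congr_ae (Filter.Eventually.of_forall fun s => ?_)
  simp only [ContinuousLinearMap.adjoint_inner_right]
  rw [real_inner_comm]

/-- The bias bound of the estimator. -/
def biasConst (M Lf α r κ Λ R c' b t : ℝ) (N : ℕ) : ℝ :=
  taylorConst α r κ Λ * M * t + (Lf * (1 + Λ) * (r ^ N * R + α * b / (1 - r))
    + M * (c' * R * (N * r ^ N) + r * c' * (α * b / (1 - r)) / (1 - r)) + r ^ N * (Λ * M))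

/-- The mean estimator is compared with the hypergradient through `linEst` and `frozenEst`: Gaussian
smoothing, distance to the inner solution, and truncation of the frozen Jacobian recursion after `N`
steps. -/
theorem Setup.bias_le (h : Setup F G μg Lf Lg M ρ τ α L r κ Λ σ)
    (hS : 1 ≤ S) (hQ : 1 ≤ Q) (hDf : 1 ≤ Df) {μ : ℝ} (hμ : 0 < μ) (y₀ : Vec d) (x : Vec p)
    {R c' t : ℝ} (hR : ‖y₀ - innerSol (avg G) x‖ ≤ R) (hc0 : 0 ≤ c')
    (hc' : α * κ * (1 + Λ) = r * c')
    (ht : μ * ∫ u, ‖u‖ ^ 3 ∂(stdGaussian (Vec p)) ≤ t) :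
    ‖∫ ω, hyperGradEst F G α μ y₀ x ω ∂(drawLaw p n m N S Q Df) - hyperGrad F G α x‖
      ≤ biasConst M Lf α r κ Λ R c' (|σ| / √(S : ℝ)) t N := by
  have hn := isProbabilityMeasure_unif h.n_pos
  have hm := isProbabilityMeasure_unif h.m_pos
  have hr0 := h.consts.r_nonneg
  have hΛ := h.consts.Λ_nonneg
  have hT := h.consts.taylorConst_nonneg
  have hint := h.integrable_hyperGradEst (N := N) (Q := Q) hS hDf hμ y₀ x
  rw [drawLaw] at hint ⊢
  rw [integral_prod_symm _ hint]
  simp only [h.hyperGradEst_eq]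
  set ζ := (innerLaw m N S).prod (outerLaw n Df) with hζ
  set y := innerSol (avg G) x with hy
  set I := ∫ s, jacFrozen (batchMap G) α (pt x y) N s ∂(innerLaw m N S) with hI
  have e1 : ‖∫ z, ∫ u, est F G α μ y₀ x u z.1 z.2 ∂(dirLaw p Q) ∂ζ
      - ∫ z, linEst F G α y₀ x z.1 z.2 ∂ζ‖ ≤ taylorConst α r κ Λ * M * t := by
    rw [← integral_sub Integrable.of_finite Integrable.of_finite]
    refine (norm_integral_le_integral_norm _).trans
      (integral_le_of_forall_le Integrable.of_finite fun z => ?_)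
    refine (h.norm_integral_est_sub_linEst_le hS hQ hDf hμ y₀ x z.1 z.2).trans ?_
    calc _ = taylorConst α r κ Λ * M * (μ * ∫ u, ‖u‖ ^ 3 ∂(stdGaussian (Vec p))) := by ring
      _ ≤ _ := by gcongr
  have e2 : ‖∫ z, linEst F G α y₀ x z.1 z.2 ∂ζ - ∫ z, frozenEst F G α x z.1 z.2 ∂ζ‖
      ≤ Lf * (1 + Λ) * (r ^ N * R + α * (|σ| / √(S : ℝ)) / (1 - r))
        + M * (c' * R * (N * r ^ N) + r * c' * (α * (|σ| / √(S : ℝ)) / (1 - r)) / (1 - r)) := by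
    rw [← integral_sub Integrable.of_finite Integrable.of_finite]
    have hb := h.integral_norm_batchMap_le hS x
    have t1 := integral_norm_traj_sub_le (Measure.pi fun _ : Fin S => unif m)
      (h.reg_batch hS) h.consts y₀ y x hb N
    have t2 := integral_norm_jac_sub_le (Measure.pi fun _ : Fin S => unif m)
      (h.reg_batch hS) h.consts y₀ y x hb hc' N
    calc _ ≤ ∫ z : (Fin N → Fin S → Fin m) × (Fin Df → Fin n),
            (Lf * (1 + Λ) * ‖traj (batchMap G) α y₀ x N z.1 - y‖
            + M * ‖jac (batchMap G) α y₀ x N z.1 - jacFrozen (batchMap G) α (pt x y) N z.1‖) ∂ζ :=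
          (norm_integral_le_integral_norm _).trans
            (integral_mono Integrable.of_finite Integrable.of_finite fun z =>
              h.norm_linEst_sub_frozenEst_le hS hDf y₀ x z.1 z.2)
      _ = Lf * (1 + Λ) * ∫ s, ‖traj (batchMap G) α y₀ x N s - y‖ ∂(innerLaw m N S)
          + M * ∫ s, ‖jac (batchMap G) α y₀ x N s - jacFrozen (batchMap G) α (pt x y) N s‖
            ∂(innerLaw m N S) := by
          rw [hζ, integral_prod _ Integrable.of_finite]
          simp only [integral_const, probReal_univ, one_smul]
          rw [integral_add Integrable.of_finite Integrable.of_finite, integral_const_mul,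
            integral_const_mul]
      _ ≤ _ := by
          gcongr
          · exact t1.trans (by gcongr)
          · exact t2.trans (by gcongr)
  have e3 : ‖∫ z, frozenEst F G α x z.1 z.2 ∂ζ - hyperGrad F G α x‖ ≤ r ^ N * (Λ * M) := by
    rw [hζ, h.integral_frozenEst hDf, hyperGrad, add_sub_add_left_eq_sub]
    have t3 := norm_integral_jacFrozen_sub_le (Measure.pi fun _ : Fin S => unif m) h.consts
      h.reg_full (h.integral_fderiv_batchMap hS (pt x y))
      (h.reg_full.jacStep_jacStar h.consts (pt x y)) N
    have hf := OuterAssumption.avg h.n_pos h.outer_assumption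
    rw [← sub_apply, ← map_sub]
    refine (ContinuousLinearMap.le_opNorm _ _).trans ?_
    rw [LinearIsometryEquiv.norm_map, ← mul_assoc]
    refine mul_le_mul (t3.trans ?_) (hf.norm_gradY_le _ _) (norm_nonneg _) (by positivity)
    gcongr
    exact h.norm_solJac_le x
  unfold biasConst
  set A1 := ∫ z, ∫ u, est F G α μ y₀ x u z.1 z.2 ∂(dirLaw p Q) ∂ζ
  set A2 := ∫ z, linEst F G α y₀ x z.1 z.2 ∂ζ
  set A3 := ∫ z, frozenEst F G α x z.1 z.2 ∂ζ
  have e4 : A1 - hyperGrad F G α x = (A1 - A2) + (A2 - A3) + (A3 - hyperGrad F G α x) := by abel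
  rw [e4]
  refine norm_add₃_le.trans ?_
  linarith

end PZOBO

namespace PZOBO

variable {p d n m N S Q Df : ℕ}

variable {F : Fin n → Joint p d → ℝ} {G : Fin m → Joint p d → ℝ} {μg : ℝ}
  {Lf Lg M ρ τ : ℝ≥0} {α L r κ Λ σ : ℝ}

/-! ### Independence of an iterate and the next draw -/

section Independence

variable {Ω X Z : Type*} [MeasurableSpace Ω] [MeasurableSpace X] [MeasurableSpace Z]
  {P : Measure Ω}

/-- Integrating out an independent variable. -/
theorem integral_indep [IsProbabilityMeasure P] {ξ : Ω → X} {W : Ω → Z} {law : Measure Z} [IsProbabilityMeasure law]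
    (hξ : AEMeasurable ξ P) (hW : HasLaw W law P) (hind : IndepFun ξ W P) {φ : X → Z → ℝ}
    (hφ : Measurable fun q : X × Z => φ q.1 q.2) (hint : Integrable (fun a => φ (ξ a) (W a)) P) :
    Integrable (fun a => ∫ w, φ (ξ a) w ∂law) P ∧
      ∫ a, φ (ξ a) (W a) ∂P = ∫ a, ∫ w, φ (ξ a) w ∂law ∂P := by
  have := Measure.isProbabilityMeasure_map hξ
  have hmap := (indepFun_iff_map_prod_eq_prod_map_map hξ hW.aemeasurable).1 hind
  rw [hW.map_eq] at hmap
  have hpair : AEMeasurable (fun a => (ξ a, W a)) P := hξ.prodMk hW.aemeasurable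
  have hint' : Integrable (fun q : X × Z => φ q.1 q.2) ((P.map ξ).prod law) := by
    rw [← hmap, integrable_map_measure hφ.aestronglyMeasurable hpair]
    exact hint
  refine ⟨hint'.integral_prod_left.comp_aemeasurable hξ, ?_⟩
  have e1 : ∫ a, φ (ξ a) (W a) ∂P = ∫ q, φ q.1 q.2 ∂((P.map ξ).prod law) := by
    rw [← hmap, integral_map hpair hφ.aestronglyMeasurable]
  rw [e1, integral_prod _ hint']
  exact integral_map hξ hint'.integral_prod_left.aestronglyMeasurable

/-- A recursion driven by measurable maps is a measurable function of the past draws. -/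
theorem exists_measurable_past {f : X → Z → X}
    (hf : Measurable fun q : X × Z => f q.1 q.2) {it : (ℕ → Z) → ℕ → X} {x₀ : X}
    (h0 : ∀ w, it w 0 = x₀) (hsucc : ∀ w k, it w (k + 1) = f (it w k) (w k)) (k : ℕ) :
    ∃ Ψ : ((i : Finset.range k) → Z) → X, Measurable Ψ ∧ ∀ w, it w k = Ψ fun i => w i := by
  induction k with
  | zero => exact ⟨fun _ => x₀, measurable_const, h0⟩
  | succ k ih =>
    obtain ⟨Ψ, hΨ, hk⟩ := ih
    have hsub : ∀ i : Finset.range k, (i : ℕ) ∈ Finset.range (k + 1) := fun i =>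
      Finset.mem_range.2 ((Finset.mem_range.1 i.2).trans (Nat.lt_succ_self k))
    refine ⟨fun v => f (Ψ fun i => v ⟨i, hsub i⟩) (v ⟨k, Finset.self_mem_range_succ k⟩), ?_, ?_⟩
    · refine hf.comp (Measurable.prodMk (hΨ.comp ?_) (measurable_pi_apply _))
      exact measurable_pi_lambda _ fun i => measurable_pi_apply _
    · intro w
      rw [hsucc, hk]

/-- The iterate `k` is a measurable function of the draws with index below `k`, a set of indices
disjoint from `{k}`. -/
theorem recursion_indep {f : X → Z → X}
    (hf : Measurable fun q : X × Z => f q.1 q.2) {it : (ℕ → Z) → ℕ → X} {x₀ : X}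
    (h0 : ∀ w, it w 0 = x₀) (hsucc : ∀ w k, it w (k + 1) = f (it w k) (w k))
    {ω : ℕ → Ω → Z} (hω : ∀ k, AEMeasurable (ω k) P) (hind : iIndepFun ω P) (k : ℕ) :
    AEMeasurable (fun a => it (fun l => ω l a) k) P ∧
      IndepFun (fun a => it (fun l => ω l a) k) (ω k) P := by
  obtain ⟨Ψ, hΨ, hk⟩ := exists_measurable_past hf h0 hsucc k
  simp only [hk]
  constructor
  · exact hΨ.comp_aemeasurable (aemeasurable_pi_lambda _ fun i => hω i)
  · have h1 := hind.indepFun_finset₀ (Finset.range k) {k} (by simp) hω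
    exact h1.comp hΨ (measurable_pi_apply (⟨k, Finset.mem_singleton_self k⟩ : ({k} : Finset ℕ)))

end Independence

/-! ### Descent of the total objective along the iterates -/

theorem Setup.gradient_totalObj (h : Setup F G μg Lf Lg M ρ τ α L r κ Λ σ) :
    gradient (totalObj F G) = hyperGrad F G α :=
  funext fun x => (h.hasGradientAt_totalObj x).gradient

theorem Setup.measurable_hyperGrad (h : Setup F G μg Lf Lg M ρ τ α L r κ Λ σ) :
    Measurable (hyperGrad F G α) := by
  rw [← h.gradient_totalObj]
  exact (InnerProductSpace.toDual ℝ (Vec p)).symm.continuous.measurable.comp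
    (measurable_fderiv ℝ (totalObj F G))

/-- The guaranteed decrease of the total objective in one outer step. -/
def decrease (F : Fin n → Joint p d → ℝ) (G : Fin m → Joint p d → ℝ) (α β μ l : ℝ) (y₀ : Vec d)
    (x : Vec p) (w : Draw p n m N S Q Df) : ℝ :=
  β * inner ℝ (hyperGrad F G α x) (hyperGradEst F G α μ y₀ x w)
    - l * β ^ 2 * ‖hyperGradEst F G α μ y₀ x w‖ ^ 2

theorem measurable_step_of_measurable {X Z V : Type*} [MeasurableSpace X] [MeasurableSpace Z]
    [NormedAddCommGroup V] [InnerProductSpace ℝ V] [MeasurableSpace V] [BorelSpace V]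
    [SecondCountableTopology V] {g : X → V} {e : X → Z → V} (hg : Measurable g)
    (he : Measurable fun q : X × Z => e q.1 q.2) (b c : ℝ) :
    Measurable fun q : X × Z => b * inner ℝ (g q.1) (e q.1 q.2) - c * ‖e q.1 q.2‖ ^ 2 := by
  have h1 : Measurable fun q : X × Z => (inner ℝ (g q.1) (e q.1 q.2) : ℝ) :=
    (hg.comp measurable_fst).inner he
  exact (h1.const_mul b).sub ((he.norm.pow_const 2).const_mul c)

theorem Setup.measurable_decrease (h : Setup F G μg Lf Lg M ρ τ α L r κ Λ σ) (hS : 1 ≤ S)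
    (hDf : 1 ≤ Df) (β μ l : ℝ) (y₀ : Vec d) :
    Measurable fun q : Vec p × Draw p n m N S Q Df => decrease F G α β μ l y₀ q.1 q.2 := by
  have h1 := h.measurable_hyperGradEst (N := N) (Q := Q) hS hDf μ y₀
  unfold decrease
  exact measurable_step_of_measurable h.measurable_hyperGrad h1 β (l * β ^ 2)

/-- The upper half of `Setup.totalObj_taylor` at `v = -β` times the estimator. It holds for every
realization; expectations are taken only afterwards. -/
theorem Setup.totalObj_step (h : Setup F G μg Lf Lg M ρ τ α L r κ Λ σ) (β μ : ℝ) (y₀ : Vec d)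
    (x : Vec p) (w : Draw p n m N S Q Df) :
    decrease F G α β μ (smoothConst M Lf α r κ Λ) y₀ x w
      ≤ totalObj F G x - totalObj F G (x - β • hyperGradEst F G α μ y₀ x w) := by
  have h1 := (abs_le.1 (h.totalObj_taylor x (-(β • hyperGradEst F G α μ y₀ x w)))).2
  rw [← sub_eq_add_neg, inner_neg_right, inner_smul_right, norm_neg, norm_smul, mul_pow,
    Real.norm_eq_abs, sq_abs] at h1
  unfold decrease
  linarith

theorem Setup.abs_decrease_le (h : Setup F G μg Lf Lg M ρ τ α L r κ Λ σ) (hS : 1 ≤ S)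
    (hDf : 1 ≤ Df) {β μ l : ℝ} (hμ : 0 < μ) (hβ : 0 ≤ β) (hl : 0 ≤ l) (y₀ : Vec d) (x : Vec p)
    (w : Draw p n m N S Q Df) :
    |decrease F G α β μ l y₀ x w|
      ≤ β * ((M + Λ * M) * (1 + estBound M Λ w)) + l * β ^ 2 * estBound M Λ w := by
  have h1 := h.sq_norm_hyperGradEst_le hS hDf hμ y₀ x w
  have h2 := norm_le_one_add_sq (hyperGradEst F G α μ y₀ x w)
  have h3 := abs_inner_le_of_norm_le (h.norm_hyperGrad_le x)
    (h2.trans (add_le_add le_rfl h1))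
  unfold decrease
  refine (abs_sub _ _).trans (add_le_add ?_ ?_)
  · rw [abs_mul, abs_of_nonneg hβ]
    gcongr
  · rw [abs_of_nonneg (by positivity)]
    gcongr

/-- With `e` the mean estimator and `g` the hypergradient, `⟨g, e⟩ ≥ ‖g‖² - b‖g‖ ≥ ‖g‖²/2 - b²/2`:
the bias costs only its square. -/
theorem Setup.le_integral_decrease (h : Setup F G μg Lf Lg M ρ τ α L r κ Λ σ) (hS : 1 ≤ S)
    (hDf : 1 ≤ Df) {β μ l b C₂ : ℝ} (hμ : 0 < μ) (hβ : 0 ≤ β) (hl : 0 ≤ l) (y₀ : Vec d) (x : Vec p)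
    (hb : ‖∫ w, hyperGradEst F G α μ y₀ x w ∂(drawLaw p n m N S Q Df) - hyperGrad F G α x‖ ≤ b)
    (hC : ∫ w, ‖hyperGradEst F G α μ y₀ x w‖ ^ 2 ∂(drawLaw p n m N S Q Df) ≤ C₂) :
    β * (‖hyperGrad F G α x‖ ^ 2 / 2) - (β * (b ^ 2 / 2) + l * β ^ 2 * C₂)
      ≤ ∫ w, decrease F G α β μ l y₀ x w ∂(drawLaw p n m N S Q Df) := by
  have i1 := h.integrable_hyperGradEst (N := N) (Q := Q) hS hDf hμ y₀ x
  have i2 := h.integrable_sq_hyperGradEst (N := N) (Q := Q) hS hDf hμ y₀ x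
  unfold decrease
  rw [integral_sub ((i1.const_inner (hyperGrad F G α x)).const_mul β) (i2.const_mul _),
    integral_const_mul, integral_const_mul, integral_inner i1]
  set g := hyperGrad F G α x
  set e := ∫ w, hyperGradEst F G α μ y₀ x w ∂(drawLaw p n m N S Q Df)
  have h1 : (inner ℝ g e : ℝ) = ‖g‖ ^ 2 + inner ℝ g (e - g) := by
    rw [inner_sub_right, real_inner_self_eq_norm_sq]; ring
  have h2 := (abs_le.1 (abs_inner_le_of_norm_le (le_refl ‖g‖) hb)).1
  have h3 : ‖g‖ ^ 2 / 2 - b ^ 2 / 2 ≤ inner ℝ g e := by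
    rw [h1]
    nlinarith [sq_nonneg (‖g‖ - b)]
  have h4 := mul_le_mul_of_nonneg_left h3 hβ
  have h5 : l * β ^ 2 * ∫ w, ‖hyperGradEst F G α μ y₀ x w‖ ^ 2 ∂(drawLaw p n m N S Q Df)
      ≤ l * β ^ 2 * C₂ := by gcongr
  linarith

/-- The convergence bound in terms of uniform bounds on the bias and on the second moment of the
estimator. -/
theorem Setup.sum_integral_le (h : Setup F G μg Lf Lg M ρ τ α L r κ Λ σ) (hS : 1 ≤ S)
    (hDf : 1 ≤ Df) {β μ b C₂ ΔΦ : ℝ} (hμ : 0 < μ) (hβ : 0 ≤ β) (x₀ : Vec p) (y₀ : Vec d)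
    (hΔ : ∀ x, totalObj F G x₀ - totalObj F G x ≤ ΔΦ)
    (hb : ∀ x, ‖∫ w, hyperGradEst F G α μ y₀ x w ∂(drawLaw p n m N S Q Df)
      - hyperGrad F G α x‖ ≤ b)
    (hC : ∀ x, ∫ w, ‖hyperGradEst F G α μ y₀ x w‖ ^ 2 ∂(drawLaw p n m N S Q Df) ≤ C₂)
    {Ω : Type*} [MeasurableSpace Ω] {P : Measure Ω} [IsProbabilityMeasure P]
    {ω : ℕ → Ω → Draw p n m N S Q Df} (hlaw : ∀ k, HasLaw (ω k) (drawLaw p n m N S Q Df) P)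
    (hind : iIndepFun ω P) (K : ℕ) :
    (∀ k, Integrable (fun a => ‖hyperGrad F G α
      (iterate F G α β μ x₀ y₀ (fun l => ω l a) k)‖ ^ 2) P) ∧
    β / 2 * ∑ k ∈ Finset.range K, ∫ a, ‖hyperGrad F G α
        (iterate F G α β μ x₀ y₀ (fun l => ω l a) k)‖ ^ 2 ∂P
      ≤ ΔΦ + K * (β * (b ^ 2 / 2) + smoothConst M Lf α r κ Λ * β ^ 2 * C₂) := by
  have hprob := isProbabilityMeasure_drawLaw (p := p) (N := N) (S := S) (Q := Q) (Df := Df)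
    h.n_pos h.m_pos
  have hl := h.smoothConst_nonneg
  set l := smoothConst M Lf α r κ Λ with hldef
  set ξ : ℕ → Ω → Vec p := fun k a => iterate F G α β μ x₀ y₀ (fun l => ω l a) k with hξdef
  have hstep : Measurable fun q : Vec p × Draw p n m N S Q Df =>
      q.1 - β • hyperGradEst F G α μ y₀ q.1 q.2 := by
    have h1 := h.measurable_hyperGradEst (N := N) (Q := Q) hS hDf μ y₀
    exact measurable_fst.sub (h1.const_smul β)
  have hrec := fun k => recursion_indep (P := P)
    (f := fun x w => x - β • hyperGradEst F G α μ y₀ x w) hstep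
    (it := fun w k => iterate F G α β μ x₀ y₀ w k) (x₀ := x₀) (fun w => rfl) (fun w k => rfl)
    (fun k => (hlaw k).aemeasurable) hind k
  have hsq : ∀ k, Integrable (fun a => ‖hyperGrad F G α (ξ k a)‖ ^ 2) P := by
    intro k
    refine (integrable_const ((M + Λ * M : ℝ) ^ 2)).mono'
      ((h.measurable_hyperGrad.comp_aemeasurable (hrec k).1).norm.pow_const 2).aestronglyMeasurable
      (Filter.Eventually.of_forall fun a => ?_)
    rw [Real.norm_of_nonneg (by positivity)]
    have := h.norm_hyperGrad_le (ξ k a)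
    gcongr
  refine ⟨hsq, ?_⟩
  have hdm := h.measurable_decrease (N := N) (Q := Q) hS hDf β μ l y₀
  have hint : ∀ k, Integrable (fun a => decrease F G α β μ l y₀ (ξ k a) (ω k a)) P := by
    intro k
    have hB : Integrable (fun a => estBound (M : ℝ) Λ (ω k a)) P := by
      have h1 := integrable_estBound (p := p) (N := N) (S := S) (Q := Q) (Df := Df)
        h.n_pos h.m_pos M Λ
      rw [← (hlaw k).map_eq] at h1
      exact h1.comp_aemeasurable (hlaw k).aemeasurable
    refine Integrable.mono' (((((integrable_const (1 : ℝ)).add hB).const_mul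
      (M + Λ * M : ℝ)).const_mul β).add (hB.const_mul (l * β ^ 2)))
      (hdm.comp_aemeasurable ((hrec k).1.prodMk (hlaw k).aemeasurable)).aestronglyMeasurable
      (Filter.Eventually.of_forall fun a => ?_)
    exact h.abs_decrease_le hS hDf hμ hβ hl y₀ (ξ k a) (ω k a)
  have hlow : ∀ k, β / 2 * ∫ a, ‖hyperGrad F G α (ξ k a)‖ ^ 2 ∂P
      - (β * (b ^ 2 / 2) + l * β ^ 2 * C₂)
      ≤ ∫ a, decrease F G α β μ l y₀ (ξ k a) (ω k a) ∂P := by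
    intro k
    -- The draw `ω k` is independent of the iterate, so it can be integrated with the iterate
    -- frozen, where the uniform bounds on bias and second moment apply.
    obtain ⟨hi, he⟩ := integral_indep (hrec k).1 (hlaw k) (hrec k).2 hdm (hint k)
    rw [he]
    calc _ = ∫ a, (β * (‖hyperGrad F G α (ξ k a)‖ ^ 2 / 2)
            - (β * (b ^ 2 / 2) + l * β ^ 2 * C₂)) ∂P := by
          rw [integral_sub (((hsq k).div_const 2).const_mul β) (integrable_const _),
            integral_const_mul, integral_div]
          simp only [integral_const, probReal_univ, one_smul]
          ring
      _ ≤ _ := by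
          refine integral_mono ((((hsq k).div_const 2).const_mul β).sub (integrable_const _)) hi
            fun a => ?_
          exact h.le_integral_decrease hS hDf hμ hβ hl y₀ (ξ k a) (hb _) (hC _)
  -- The sum telescopes on every path, and `ΔΦ` bounds the total drop of the objective to any point.
  have htel : ∀ a, ∑ k ∈ Finset.range K, decrease F G α β μ l y₀ (ξ k a) (ω k a) ≤ ΔΦ := by
    intro a
    have h1 : ∀ k ∈ Finset.range K, decrease F G α β μ l y₀ (ξ k a) (ω k a)
        ≤ totalObj F G (ξ k a) - totalObj F G (ξ (k + 1) a) :=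
      fun k _ => h.totalObj_step β μ y₀ (ξ k a) (ω k a)
    refine (Finset.sum_le_sum h1).trans ?_
    rw [Finset.sum_range_sub' fun k => totalObj F G (ξ k a)]
    exact hΔ _
  have hsum : ∑ k ∈ Finset.range K, ∫ a, decrease F G α β μ l y₀ (ξ k a) (ω k a) ∂P ≤ ΔΦ := by
    rw [← integral_finsetSum _ fun k _ => hint k]
    exact integral_le_of_forall_le (integrable_finsetSum _ fun k _ => hint k) htel
  have hfin := (Finset.sum_le_sum fun k (_ : k ∈ Finset.range K) => hlow k).trans hsum
  rw [Finset.sum_sub_distrib, ← Finset.mul_sum, Finset.sum_const, Finset.card_range,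
    nsmul_eq_mul] at hfin
  linarith

end PZOBO

/-! ### Bookkeeping of constants and rates -/

namespace PZOBO

/-- The sequence `N² r^N` tends to zero, hence is bounded; one of the two factors `r^N` is spent on
this. -/
theorem exists_sq_mul_pow_le {r : ℝ} (hr0 : 0 ≤ r) (hr1 : r < 1) :
    ∃ C : ℝ, 0 ≤ C ∧ ∀ N : ℕ, ((N : ℝ) * r ^ N) ^ 2 ≤ C * r ^ N := by
  have h := tendsto_pow_const_mul_const_pow_of_abs_lt_one 2
    (show |r| < 1 by rwa [abs_of_nonneg hr0])
  obtain ⟨C, hC⟩ := h.bddAbove_range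
  have hC' : ∀ N : ℕ, (N : ℝ) ^ 2 * r ^ N ≤ C := fun N => hC ⟨N, rfl⟩
  refine ⟨C, by simpa using hC' 0, fun N => ?_⟩
  calc ((N : ℝ) * r ^ N) ^ 2 = (N : ℝ) ^ 2 * r ^ N * r ^ N := by ring
    _ ≤ C * r ^ N := by
      have := hC' N
      gcongr

theorem add_four_sq_le (a b c e : ℝ) :
    (a + b + c + e) ^ 2 ≤ 4 * (a ^ 2 + b ^ 2 + c ^ 2 + e ^ 2) := by
  nlinarith [sq_nonneg (a - b), sq_nonneg (a - c), sq_nonneg (a - e), sq_nonneg (b - c),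
    sq_nonneg (b - e), sq_nonneg (c - e)]

/-- The coefficient of `r ^ N` in the bias. -/
def biasGeom (M Lf Λ R : ℝ) : ℝ := Lf * (1 + Λ) * R + Λ * M

/-- The coefficient of `N r ^ N` in the bias. -/
def biasLinGeom (M R c' : ℝ) : ℝ := M * c' * R

/-- The coefficient of `1 / √S` in the bias. -/
def biasNoise (M Lf α r Λ c' σ : ℝ) : ℝ :=
  Lf * (1 + Λ) * (α * |σ| / (1 - r)) + M * (r * c' * (α * |σ| / (1 - r)) / (1 - r))

/-- The coefficient of `1 / √K` in the bias. -/
def biasSmoothing (M α r κ Λ c : ℝ) : ℝ := taylorConst α r κ Λ * M * (c * √(gaussMoment 6))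

theorem biasConst_eq (M Lf α r κ Λ R c' σ c : ℝ) (N S K : ℕ) :
    biasConst M Lf α r κ Λ R c' (|σ| / √(S : ℝ)) (c * √(gaussMoment 6) / √(K : ℝ)) N
      = biasGeom M Lf Λ R * r ^ N + biasLinGeom M R c' * (N * r ^ N)
        + biasNoise M Lf α r Λ c' σ * (1 / √(S : ℝ))
        + biasSmoothing M α r κ Λ c * (1 / √(K : ℝ)) := by
  unfold biasConst biasGeom biasLinGeom biasNoise biasSmoothing
  ring

/-- The bias enters squared, and each small factor lies in `[0, 1]`, so its square is at most
itself. Only the term `N r^N` needs the extra constant `C₃`. -/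
theorem sq_biasConst_le {M Lf α r κ Λ R c' σ c C₃ : ℝ} (hr0 : 0 ≤ r) (hr1 : r < 1)
    {N S K p : ℕ} (hS : 1 ≤ S) (hK : 1 ≤ K) (hp : 1 ≤ p)
    (h3 : ((N : ℝ) * r ^ N) ^ 2 ≤ C₃ * r ^ N) :
    biasConst M Lf α r κ Λ R c' (|σ| / √(S : ℝ)) (c * √(gaussMoment 6) / √(K : ℝ)) N ^ 2
      ≤ 4 * ((biasGeom M Lf Λ R ^ 2 + biasLinGeom M R c' ^ 2 * C₃) * r ^ N
        + biasNoise M Lf α r Λ c' σ ^ 2 * (1 / √(S : ℝ))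
        + biasSmoothing M α r κ Λ c ^ 2 * (p / √(K : ℝ))) := by
  rw [biasConst_eq]
  refine (add_four_sq_le _ _ _ _).trans ?_
  have hS1 : (1 : ℝ) ≤ √(S : ℝ) := Real.one_le_sqrt.2 (by exact_mod_cast hS)
  have hK1 : (1 : ℝ) ≤ √(K : ℝ) := Real.one_le_sqrt.2 (by exact_mod_cast hK)
  have hp1 : (1 : ℝ) ≤ p := by exact_mod_cast hp
  have e1 : (r ^ N) ^ 2 ≤ r ^ N := by
    rw [sq]
    exact mul_le_of_le_one_left (pow_nonneg hr0 N) (pow_le_one₀ hr0 hr1.le)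
  have e2 : (1 / √(S : ℝ)) ^ 2 ≤ 1 / √(S : ℝ) := by
    rw [sq]
    exact mul_le_of_le_one_left (by positivity) ((div_le_one (by linarith)).2 hS1)
  have e3 : (1 / √(K : ℝ)) ^ 2 ≤ p / √(K : ℝ) := by
    have h4 : (1 / √(K : ℝ)) ^ 2 ≤ 1 / √(K : ℝ) := by
      rw [sq]
      exact mul_le_of_le_one_left (by positivity) ((div_le_one (by linarith)).2 hK1)
    exact h4.trans (by gcongr)
  simp only [mul_pow _ _ 2] at h3 ⊢
  have f1 := mul_le_mul_of_nonneg_left e1 (sq_nonneg (biasGeom M Lf Λ R))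
  have f2 := mul_le_mul_of_nonneg_left h3 (sq_nonneg (biasLinGeom M R c'))
  have f3 := mul_le_mul_of_nonneg_left e2 (sq_nonneg (biasNoise M Lf α r Λ c' σ))
  have f4 := mul_le_mul_of_nonneg_left e3 (sq_nonneg (biasSmoothing M α r κ Λ c))
  linarith

/-- The second-moment constant per dimension. -/
def momentPerDim (M α r κ Λ c : ℝ) : ℝ :=
  2 * M ^ 2 + (4 * (gaussMoment 4 * (Λ * M) ^ 2)
    + 4 * (taylorConst α r κ Λ * M) ^ 2 * (gaussMoment 6 * c ^ 2))

theorem momentPerDim_nonneg (M α r κ Λ c : ℝ) : 0 ≤ momentPerDim M α r κ Λ c := by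
  have h4 := gaussMoment_nonneg 4 (by decide)
  have h6 := gaussMoment_nonneg 6 (by decide)
  unfold momentPerDim
  positivity

/-- The smoothing parameter is small: `μ² p³ ≤ c² / K`. -/
theorem sq_mul_cube_le {c μ : ℝ} {K d p : ℕ} (hK : 1 ≤ K) (hd : 1 ≤ d) (hp : 1 ≤ p) (hμ : 0 < μ)
    (hle : μ ≤ c / √((K : ℝ) * d * (p : ℝ) ^ 3)) : μ ^ 2 * (p : ℝ) ^ 3 ≤ c ^ 2 / K := by
  have hK1 : (1 : ℝ) ≤ K := by exact_mod_cast hK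
  have hd1 : (1 : ℝ) ≤ d := by exact_mod_cast hd
  have hp1 : (1 : ℝ) ≤ p := by exact_mod_cast hp
  have hp3 : (0 : ℝ) < (p : ℝ) ^ 3 := by positivity
  have h1 : μ ^ 2 ≤ (c / √((K : ℝ) * d * (p : ℝ) ^ 3)) ^ 2 := by gcongr
  rw [div_pow, Real.sq_sqrt (by positivity)] at h1
  calc μ ^ 2 * (p : ℝ) ^ 3 ≤ c ^ 2 / ((K : ℝ) * d * (p : ℝ) ^ 3) * (p : ℝ) ^ 3 := by gcongr
    _ = c ^ 2 / ((K : ℝ) * d) := by field_simp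
    _ ≤ c ^ 2 / K := by
      gcongr
      nlinarith

/-- Since `μ² p³ ≤ c²/K ≤ p c²`, every term is at most linear in `p`. -/
theorem momentConst_le {M α r κ Λ c μ : ℝ} {K p : ℕ} (hK : 1 ≤ K) (hp : 1 ≤ p)
    (hμ : μ ^ 2 * (p : ℝ) ^ 3 ≤ c ^ 2 / K) :
    momentConst M α r κ Λ p μ ≤ p * momentPerDim M α r κ Λ c := by
  have hK1 : (1 : ℝ) ≤ K := by exact_mod_cast hK
  have hp1 : (1 : ℝ) ≤ p := by exact_mod_cast hp
  have h6 := gaussMoment_nonneg 6 (by decide)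
  have h1 : μ ^ 2 * (p : ℝ) ^ 3 ≤ p * c ^ 2 := by
    refine hμ.trans ((div_le_self (sq_nonneg c) hK1).trans ?_)
    exact le_mul_of_one_le_left (sq_nonneg c) hp1
  have h2 : 2 * M ^ 2 ≤ p * (2 * M ^ 2) := le_mul_of_one_le_left (by positivity) hp1
  have h3 := mul_le_mul_of_nonneg_left h1
    (show 0 ≤ 4 * (taylorConst α r κ Λ * M) ^ 2 * gaussMoment 6 by positivity)
  have h4 : momentConst M α r κ Λ p μ = 2 * M ^ 2 + 4 * (gaussMoment 4 * p * (Λ * M) ^ 2)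
      + 4 * (taylorConst α r κ Λ * M) ^ 2 * gaussMoment 6 * (μ ^ 2 * (p : ℝ) ^ 3) := by
    unfold momentConst
    ring
  have h5 : p * momentPerDim M α r κ Λ c = p * (2 * M ^ 2) + 4 * (gaussMoment 4 * p * (Λ * M) ^ 2)
      + 4 * (taylorConst α r κ Λ * M) ^ 2 * gaussMoment 6 * (p * c ^ 2) := by
    unfold momentPerDim
    ring
  rw [h4, h5]
  linarith

/-- `E‖u‖³` is at most `√(gaussMoment 6)` times `p^{3/2}`, the power of `p` that the bound on `μ`
compensates. -/
theorem smoothing_le {c μ : ℝ} {K p : ℕ} (hK : 1 ≤ K) (hc : 0 ≤ c) (hμ0 : 0 < μ)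
    (hμ : μ ^ 2 * (p : ℝ) ^ 3 ≤ c ^ 2 / K) :
    μ * ∫ u, ‖u‖ ^ 3 ∂(stdGaussian (Vec p)) ≤ c * √(gaussMoment 6) / √(K : ℝ) := by
  have hK1 : (1 : ℝ) ≤ K := by exact_mod_cast hK
  have h6 := gaussMoment_nonneg 6 (by decide)
  refine le_of_sq_le_sq ?_ (by positivity)
  rw [div_pow, mul_pow, mul_pow, Real.sq_sqrt h6, Real.sq_sqrt (by linarith)]
  calc _ ≤ μ ^ 2 * (gaussMoment 6 * (p : ℝ) ^ 3) := by
        gcongr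
        exact sq_integral_norm_pow_three_le
    _ = gaussMoment 6 * (μ ^ 2 * (p : ℝ) ^ 3) := by ring
    _ ≤ gaussMoment 6 * (c ^ 2 / K) := by gcongr
    _ = _ := by ring

/-- Serves for positivity of `L_Φ`: no comparison with the smoothness constant `l` is needed, since
the ratio `l / L_Φ` goes into the final constant. -/
theorem le_LΦ {L M ρ τ μg : ℝ} (hL : 0 ≤ L) (hM : 0 ≤ M) (hρ : 0 ≤ ρ) (hτ : 0 ≤ τ)
    (hμ : 0 < μg) : L ≤ LΦ L M ρ τ μg := by
  have h : LΦ L M ρ τ μg = L + ((2 * L ^ 2 + τ * M ^ 2) / μg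
    + (ρ * L * M + L ^ 3 + τ * M * L) / μg ^ 2 + ρ * L ^ 2 * M / μg ^ 3) := by
    unfold LΦ
    ring
  rw [h]
  exact le_add_of_nonneg_right (by positivity)

/-- From the summed descent inequality to the averaged rate. -/
theorem average_le {T ΔΦ b C₂ l ℓ β pK : ℝ} {K : ℕ} (hK : 1 ≤ K) (hℓ : 0 < ℓ)
    (hβ : β = 1 / (ℓ * √(K : ℝ))) (hT : 0 ≤ T) (hΔ : 0 ≤ ΔΦ) (hpK : 1 / √(K : ℝ) ≤ pK)
    (h : β / 2 * T ≤ ΔΦ + K * (β * (b ^ 2 / 2) + l * β ^ 2 * C₂)) :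
    (1 - 1 / √(K : ℝ)) / K * T
      ≤ 2 * ΔΦ * ℓ * pK + b ^ 2 + 2 * l / ℓ * (C₂ / √(K : ℝ)) := by
  have hK1 : (1 : ℝ) ≤ K := by exact_mod_cast hK
  have hs1 : (1 : ℝ) ≤ √(K : ℝ) := Real.one_le_sqrt.2 hK1
  set s := √(K : ℝ) with hs
  have hs2 : (K : ℝ) = s ^ 2 := (Real.sq_sqrt (by linarith)).symm
  have hs0 : 0 < s := by linarith
  rw [hs2] at h ⊢
  have h1 : T ≤ 2 * ℓ * s * (ΔΦ + s ^ 2 * (β * (b ^ 2 / 2) + l * β ^ 2 * C₂)) := by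
    have h2 := mul_le_mul_of_nonneg_left h (show 0 ≤ 2 * ℓ * s by positivity)
    have h3 : 2 * ℓ * s * (β / 2 * T) = T := by rw [hβ]; field_simp
    rwa [h3] at h2
  -- The prefactor `1 - 1/√K` is at most `1` and is dropped.
  have h4 : (1 - 1 / s) / s ^ 2 * T ≤ 1 / s ^ 2 * T := by
    have : 0 ≤ 1 / s := by positivity
    gcongr
    linarith
  calc _ ≤ 1 / s ^ 2 * T := h4
    _ ≤ 1 / s ^ 2 * (2 * ℓ * s * (ΔΦ + s ^ 2 * (β * (b ^ 2 / 2) + l * β ^ 2 * C₂))) := by gcongr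
    _ = 2 * ΔΦ * ℓ * (1 / s) + b ^ 2 + 2 * l / ℓ * (C₂ / s) := by
        rw [hβ]
        field_simp
        ring
    _ ≤ _ := by gcongr

end PZOBO

/-! ### The main theorem: choice of the constants -/

theorem theorem2
    (Lf Lg M ρ τ : ℝ≥0) (μg σ D D₀ ΔΦ c : ℝ) (hμg : 0 < μg)
    (L : ℝ) (hL : L = max (Lf : ℝ) (Lg : ℝ)) (α : ℝ) (hα : α = 2 / (L + μg)) :
    ∃ C : ℝ, ∀ (p d n m : ℕ), 1 ≤ p → 1 ≤ d → 1 ≤ n → 1 ≤ m →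
      ∀ (F : Fin n → PZOBO.Joint p d → ℝ) (G : Fin m → PZOBO.Joint p d → ℝ),
      (∀ j, PZOBO.InnerAssumption (G j) μg Lg ρ τ) →
      (∀ i, PZOBO.OuterAssumption (F i) M Lf) →
      PZOBO.BoundedVariance G σ →
      (∀ x, ‖PZOBO.innerSol (PZOBO.avg G) x‖ ≤ D) →
      ∀ (x₀ : PZOBO.Vec p) (y₀ : PZOBO.Vec d), ‖y₀‖ ≤ D₀ →
      (∀ x, PZOBO.totalObj F G x₀ - PZOBO.totalObj F G x ≤ ΔΦ) →
      ∀ (K N S Q Df : ℕ), 1 ≤ K → 1 ≤ S → 1 ≤ Q → 1 ≤ Df →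
      ∀ (β μ : ℝ), β = 1 / (PZOBO.LΦ L M ρ τ μg * √(K : ℝ)) →
      0 < μ → μ ≤ c / √((K : ℝ) * d * (p : ℝ) ^ 3) →
      ∀ (Ω : Type*) [MeasurableSpace Ω] (P : Measure Ω) [IsProbabilityMeasure P]
        (ω : ℕ → Ω → PZOBO.Draw p n m N S Q Df),
      (∀ k, HasLaw (ω k) (PZOBO.drawLaw p n m N S Q Df) P) →
      iIndepFun ω P →
      Differentiable ℝ (PZOBO.totalObj F G) ∧
      (∀ k < K, Integrable (fun a => ‖gradient (PZOBO.totalObj F G)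
        (PZOBO.iterate F G α β μ x₀ y₀ (fun l => ω l a) k)‖ ^ 2) P) ∧
      (1 - 1 / √(K : ℝ)) / K * ∑ k ∈ Finset.range K,
          ∫ a, ‖gradient (PZOBO.totalObj F G)
            (PZOBO.iterate F G α β μ x₀ y₀ (fun l => ω l a) k)‖ ^ 2 ∂P
        ≤ C * (p / √(K : ℝ) + (1 - α * μg) ^ N + 1 / √(S : ℝ)) := by
  -- For `μg > Lg` no sample function satisfies the assumptions when `d ≥ 1`, and any constant will
  -- do.
  by_cases hμL : μg ≤ Lg
  swap
  · refine ⟨0, fun p d n m _ hd _ hm F G hG => ?_⟩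
    exact absurd ((hG ⟨0, hm⟩).modulus_le hd) hμL
  have hLgL : (Lg : ℝ) ≤ L := hL ▸ le_max_right _ _
  have hμL' : μg ≤ L := hμL.trans hLgL
  have hLpos : 0 < L := hμg.trans_le hμL'
  have hαpos : 0 < α := by rw [hα]; positivity
  obtain ⟨r, hr⟩ : ∃ r, r = 1 - α * μg := ⟨_, rfl⟩
  have hr' : r = (L - μg) / (L + μg) := by
    have : L + μg ≠ 0 := by positivity
    rw [hr, hα]
    field_simp
    ring
  have hr0 : 0 ≤ r := by
    rw [hr']
    exact div_nonneg (by linarith) (by linarith)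
  have hr1 : r < 1 := by
    have := mul_pos hαpos hμg
    linarith
  -- With division by zero equal to zero, `κ = r κ'` is `0` for `r = 0` and `ρ + τ` otherwise; the
  -- factorization supplies the relation `ακ(1+Λ) = r c'` required by the bias bound.
  set κ' : ℝ := (ρ + τ) / r with hκ'
  set κ := r * κ' with hκ
  -- The fixed point of `Λ ↦ rΛ + αL`; as `1 - r = α μg`, it equals `L/μg`.
  set Λ := α * L / (1 - r) with hΛ
  have h1r : 0 < 1 - r := by linarith
  have hκ'0 : 0 ≤ κ' := by positivity
  have hc : PZOBO.Consts α L r κ Λ :=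
    ⟨hαpos.le, hLpos.le, hr0, hr1, by positivity, by positivity, by rw [hΛ]; field_simp; ring⟩
  have hΛ0 := hc.Λ_nonneg
  set c' := α * κ' * (1 + Λ) with hc'
  obtain ⟨C₃, hC₃, hsq⟩ := PZOBO.exists_sq_mul_pow_le hr0 hr1
  set ℓ := PZOBO.LΦ L M ρ τ μg with hℓ
  have hℓ0 : 0 < ℓ :=
    hLpos.trans_le (PZOBO.le_LΦ hLpos.le M.coe_nonneg ρ.coe_nonneg τ.coe_nonneg hμg)
  set l := PZOBO.smoothConst M Lf α r κ Λ with hl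
  set R := D₀ + D with hR
  set B := PZOBO.biasGeom M Lf Λ R ^ 2 + PZOBO.biasLinGeom M R c' ^ 2 * C₃ with hB
  set B' := PZOBO.biasNoise M Lf α r Λ c' σ ^ 2 with hB'
  set B'' := PZOBO.biasSmoothing M α r κ Λ c ^ 2 with hB''
  set C₂ := PZOBO.momentPerDim M α r κ Λ c with hC₂
  have hC₂0 : 0 ≤ C₂ := PZOBO.momentPerDim_nonneg _ _ _ _ _ _
  -- The summands come from the initial gap, the squared bias (the factor `4` from squaring a sum of
  -- four terms) and the second moment; none involves `p`, `d`, `n`, `m` or the algorithm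
  -- parameters.
  refine ⟨2 * ΔΦ * ℓ + 4 * (B + B' + B'') + 2 * l / ℓ * C₂, ?_⟩
  intro p d n m hp hd hn hm F G hG hF hvar hsol x₀ y₀ hy₀ hΔ K N S Q Df hK hS hQ hDf β μ hβ hμ hμle
    Ω _ P _ ω hlaw hind
  have hs : PZOBO.Setup F G μg Lf Lg M ρ τ α L r κ Λ σ :=
    ⟨hn, hm, hμg, hG, hF, hvar, hαpos, fun j => (hG j).reg hμg hLgL hμL' hα hr, hc⟩
  have hl0 : 0 ≤ l := hs.smoothConst_nonneg
  have hΔ0 : 0 ≤ ΔΦ := by simpa using hΔ x₀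
  have hKd : (0 : ℝ) < (K : ℝ) * d * (p : ℝ) ^ 3 := by positivity
  -- A negative `c` would contradict `0 < μ ≤ c/√(Kdp³)`.
  have hc0 : 0 ≤ c := by
    have h1 := hμ.le.trans hμle
    by_contra hneg
    exact absurd h1 (not_le.2 (div_neg_of_neg_of_pos (not_le.1 hneg) (Real.sqrt_pos.2 hKd)))
  have hμ3 := PZOBO.sq_mul_cube_le hK hd hp hμ hμle
  have hp1 : (1 : ℝ) ≤ p := by exact_mod_cast hp
  have hK1 : (1 : ℝ) ≤ √(K : ℝ) := Real.one_le_sqrt.2 (by exact_mod_cast hK)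
  have hβ0 : 0 ≤ β := by rw [hβ]; positivity
  obtain ⟨hint, hsum⟩ := hs.sum_integral_le hS hDf hμ hβ0 x₀ y₀ hΔ
    (fun x => hs.bias_le hS hQ hDf hμ y₀ x (R := R) (c' := c')
      ((norm_sub_le _ _).trans (add_le_add hy₀ (hsol x))) (by positivity)
      (by rw [hκ, hc']; ring) (PZOBO.smoothing_le hK hc0 hμ hμ3))
    (fun x => (hs.integral_sq_hyperGradEst_le hS hQ hDf hμ y₀ x).trans
      (PZOBO.momentConst_le hK hp hμ3)) hlaw hind K
  refine ⟨fun x => (hs.hasGradientAt_totalObj x).differentiableAt, ?_, ?_⟩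
  · intro k _
    rw [hs.gradient_totalObj]
    exact hint k
  · rw [hs.gradient_totalObj, ← hr]
    have h1 := PZOBO.average_le hK hℓ0 hβ
      (Finset.sum_nonneg fun k _ => integral_nonneg fun a => by positivity) hΔ0
      (show 1 / √(K : ℝ) ≤ p / √(K : ℝ) by gcongr) hsum
    have h2 := PZOBO.sq_biasConst_le (M := M) (Lf := Lf) (α := α) (κ := κ) (Λ := Λ) (R := R)
      (c' := c') (σ := σ) (c := c) hr0 hr1 hS hK hp (hsq N)
    have h3 : 2 * l / ℓ * ((p : ℝ) * C₂ / √(K : ℝ)) = 2 * l / ℓ * C₂ * (p / √(K : ℝ)) := by ring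
    rw [← hl, ← hC₂, h3] at h1
    refine h1.trans ?_
    have hX : 0 ≤ (p : ℝ) / √(K : ℝ) := by positivity
    have hY : 0 ≤ r ^ N := pow_nonneg hr0 N
    have hZ : 0 ≤ 1 / √(S : ℝ) := by positivity
    have hB0 : 0 ≤ B := by positivity
    have hB'0 : 0 ≤ B' := by positivity
    have hB''0 : 0 ≤ B'' := by positivity
    have hE : 0 ≤ 2 * ΔΦ * ℓ := by positivity
    have hE' : 0 ≤ 2 * l / ℓ * C₂ := by positivity
    set x := (p : ℝ) / √(K : ℝ)
    set y := r ^ N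
    set z := 1 / √(S : ℝ)
    calc _ ≤ 2 * ΔΦ * ℓ * x + 4 * (B * y + B' * z + B'' * x) + 2 * l / ℓ * C₂ * x := by gcongr
      _ ≤ 2 * ΔΦ * ℓ * (x + y + z) + 4 * (B * (x + y + z) + B' * (x + y + z) + B'' * (x + y + z))
          + 2 * l / ℓ * C₂ * (x + y + z) := by
          gcongr <;> linarith
      _ = _ := by ring

end
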